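/- **Setting.** Let $d\in\{2,3\}$. Consider a fixed geometry of a periodic medium in $\mathbb{R}^d$: a lattice with unit cell $\mathcal V$, and a lattice-periodic partition of $\mathbb{R}^d$ into finitely many measurable phases; $V_\phi\subset\mathcal V$, with $|V_\phi|>0$, is the part of the cell in phase $\phi$. Write $\langle\cdot\rangle$ and $\langle\cdot\rangle_\phi$ for the averages over $\mathcal V$ and $V_\phi$. Phase $\phi$ has constant moduli $\kappa_\phi,\mu_\phi>0$, and the elasticity tensor is $\mathcal L(x)=d\,\kappa(x)\,\mathcal J+2\mu(x)\,\mathcal K$, where $\kappa=\kappa_\phi$, $\mu=\mu_\phi$ in phase $\phi$, $\mathcal J=\frac1d I\otimes I$ and $\mathcal K=\mathcal I-\mathcal J$ are the projectors on spherical and on deviatoric symmetric tensors. The reference moduli $\kappa_0,\mu_0>0$ are the mean moduli, $\langle\kappa\rangle=\kappa_0$ and $\langle\mu\rangle=\mu_0$; put $$\|\delta\mathcal L\|=\sup_x\max\big(|d(\kappa(x)-\kappa_0)|,\,|2(\mu(x)-\mu_0)|\big).$$ For a macroscopic strain $\bar\varepsilon$ (a symmetric tensor), the strain field is $\varepsilon=\bar\varepsilon+\nabla_s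 u$ with $u$ periodic of class $H^1$ and $\nabla\cdot(\mathcal L:\varepsilon)=0$ in the weak sense. The effective tensor $\tilde{\mathcal L}$ is defined by $\langle\mathcal L:\varepsilon\rangle=\tilde{\mathcal L}:\bar\varepsilon$ for all $\bar\varepsilon$. Put $\varepsilon_0=\frac1d\mathrm{tr}\,\varepsilon$, $\varepsilon_{\rm eq}^2=\frac{d-1}{d}\,\mathrm{dev}\,\varepsilon:\mathrm{dev}\,\varepsilon$, likewise $\bar\varepsilon_0,\bar\varepsilon_{\rm eq}$ for $\bar\varepsilon$, and $$n_J=1,\quad n_K=\tfrac{d(d+1)}2-1,\quad \lambda_J^{-1}=d\kappa_0+2(d-1)\mu_0,\quad \lambda_K^{-1}=\frac{2\mu_0\,(d\kappa_0+2(d-1)\mu_0)}{d(d-1)(\kappa_0+2\mu_0)}.$$ **Proposition 3.** Assume that the medium is macroscopically isotropic, i.e. that $\tilde{\mathcal L}$ is isotropic (invariant under all rotations), for all phase moduli $(\kappa_\phi,\mu_\phi)_\phi$ with means $\kappa_0,\mu_0$ and with $\|\delta\mathcal L\|$ small enough. Let $\bar\varepsilon\neq0$ be a fixed macroscopic strain,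 and let $\varepsilon$ be the associated strain field. Then for every phase $\phi$, as $\|\delta\mathcal L\|\to0$ over the phase moduli with means $\kappa_0,\mu_0$: - if $\bar\varepsilon$ is purely spherical ($\mathcal J:\bar\varepsilon=\bar\varepsilon$), then $\langle\varepsilon_{\rm eq}^2\rangle_\phi=o(\|\delta\mathcal L\|)$ and $$\kappa_\phi=\kappa_0+\frac{n_J\lambda_J^{-1}}{2d}\left[1-\frac{\langle\varepsilon_0^2\rangle_\phi}{\bar\varepsilon_0^2}\right]+o(\|\delta\mathcal L\|);$$ - if $\bar\varepsilon$ is purely deviatoric ($\mathcal K:\bar\varepsilon=\bar\varepsilon$), then $\langle\varepsilon_0^2\rangle_\phi=o(\|\delta\mathcal L\|)$ and $$\mu_\phi=\mu_0+\frac{n_K\lambda_K^{-1}}{4}\left[1-\frac{\langle\varepsilon_{\rm eq}^2\rangle_\phi}{\bar\varepsilon_{\rm eq}^2}\right]+o(\|\delta\mathcal L\|).$$ -/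

import Mathlib

open Filter Topology MeasureTheory Asymptotics
open scoped ContDiff

noncomputable section

namespace Elast

/-- The physical space `ℝ^d`. -/
abbrev Space (d : ℕ) := EuclideanSpace ℝ (Fin d)

/-- Second-order tensors, by components. -/
abbrev Tensor2 (d : ℕ) := Matrix (Fin d) (Fin d) ℝ

/-- Fourth-order tensors, by components. -/
abbrev Tensor4 (d : ℕ) := Fin d → Fin d → Fin d → Fin d → ℝ

/-! ### Tensor algebra -/

/-- The scalar product `A : B` of second-order tensors. -/
def inner2 {d : ℕ} (A B : Tensor2 d) : ℝ := ∑ i, ∑ j, A i j * B i j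

/-- The double contraction `T : A`. -/
def contract {d : ℕ} (T : Tensor4 d) (A : Tensor2 d) : Tensor2 d :=
  Matrix.of fun i j => ∑ k, ∑ l, T i j k l * A k l

/-- The scalar product `S :: T` of fourth-order tensors. -/
def inner4 {d : ℕ} (S T : Tensor4 d) : ℝ := ∑ i, ∑ j, ∑ k, ∑ l, S i j k l * T i j k l

/-- Kronecker symbol. -/
def delta {d : ℕ} (i j : Fin d) : ℝ := if i = j then 1 else 0

/-- The symmetrized identity of fourth order. -/
def tensorI (d : ℕ) : Tensor4 d := fun i j k l =>
  (delta i k * delta j l + delta i l * delta j k) / 2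

/-- The spherical projector. -/
def tensorJ (d : ℕ) : Tensor4 d := fun i j k l => delta i j * delta k l / d

/-- The deviatoric projector. -/
def tensorK (d : ℕ) : Tensor4 d := tensorI d - tensorJ d

/-- `n_J = J :: J`. -/
def nJ (d : ℕ) : ℝ := inner4 (tensorJ d) (tensorJ d)

/-- `n_K = K :: K`. -/
def nK (d : ℕ) : ℝ := inner4 (tensorK d) (tensorK d)

/-- A purely spherical second-order tensor. -/
def IsSpherical {d : ℕ} (A : Tensor2 d) : Prop := contract (tensorJ d) A = A

/-- A purely deviatoric second-order tensor. -/
def IsDeviatoric {d : ℕ} (A : Tensor2 d) : Prop := contract (tensorK d) A = A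

/-- The hydrostatic strain `ε₀`. -/
def hydro {d : ℕ} (e : Tensor2 d) : ℝ := e.trace / d

/-- The deviatoric part of a strain. -/
def dev {d : ℕ} (e : Tensor2 d) : Tensor2 d := e - (e.trace / d) • (1 : Tensor2 d)

/-- The Von Mises equivalent strain `ε_eq`. -/
def equivStrain {d : ℕ} (e : Tensor2 d) : ℝ :=
  Real.sqrt (((d : ℝ) - 1) / d * inner2 (dev e) (dev e))

/-- The isotropic elasticity tensor with bulk modulus `κ` and shear modulus `μ`. -/
def isoElasticity (d : ℕ) (κ μ : ℝ) : Tensor4 d :=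
  (d * κ) • tensorJ d + (2 * μ) • tensorK d

/-- Invariance of a fourth-order tensor under all rotations. -/
def IsIsotropic {d : ℕ} (T : Tensor4 d) : Prop :=
  ∀ Q ∈ Matrix.specialOrthogonalGroup (Fin d) ℝ, ∀ i j k l,
    ∑ p, ∑ q, ∑ r, ∑ s, Q i p * Q j q * Q k r * Q l s * T p q r s = T i j k l

/-- The inverse of the coefficient `λ_J` of the Green's tensor. -/
def lamJInv (d : ℕ) (κ₀ μ₀ : ℝ) : ℝ := d * κ₀ + 2 * ((d : ℝ) - 1) * μ₀

/-- The inverse of the coefficient `λ_K` of the Green's tensor. -/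
def lamKInv (d : ℕ) (κ₀ μ₀ : ℝ) : ℝ :=
  2 * μ₀ * (d * κ₀ + 2 * ((d : ℝ) - 1) * μ₀) / (d * ((d : ℝ) - 1) * (κ₀ + 2 * μ₀))

/-! ### Periodic media with `N` homogeneous phases -/

/-- The geometry of a periodic medium with `N` phases: a lattice, given by a basis of `ℝ^d`, and
the map sending a point to the index of the phase it lies in. Every phase has positive volume
in the unit cell. -/
structure Geometry (d N : ℕ) where
  basis : Module.Basis (Fin d) ℝ (Space d)
  phase : Space d → Fin N
  measurable_phase : Measurable phase
  periodic_phase : ∀ i x, phase (x + basis i) = phase x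
  phase_pos : ∀ φ, 0 < volume (ZSpan.fundamentalDomain basis ∩ phase ⁻¹' {φ})

/-- The bulk and shear moduli of the phases. -/
structure PhaseModuli (N : ℕ) where
  κ : Fin N → ℝ
  μ : Fin N → ℝ

variable {d N : ℕ}

/-- The unit cell. -/
def Geometry.cell (g : Geometry d N) : Set (Space d) := ZSpan.fundamentalDomain g.basis

/-- The part of the unit cell occupied by a phase. -/
def Geometry.phaseCell (g : Geometry d N) (φ : Fin N) : Set (Space d) :=
  g.cell ∩ g.phase ⁻¹' {φ}

/-- Periodicity with respect to the lattice of the medium. -/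
def Geometry.IsPeriodic {α : Type*} (g : Geometry d N) (f : Space d → α) : Prop :=
  ∀ i x, f (x + g.basis i) = f x

/-- The bulk modulus field. -/
def Geometry.bulk (g : Geometry d N) (m : PhaseModuli N) (x : Space d) : ℝ := m.κ (g.phase x)

/-- The shear modulus field. -/
def Geometry.shear (g : Geometry d N) (m : PhaseModuli N) (x : Space d) : ℝ := m.μ (g.phase x)

/-- The elasticity tensor field. -/
def Geometry.elasticity (g : Geometry d N) (m : PhaseModuli N) (x : Space d) : Tensor4 d :=
  isoElasticity d (g.bulk m x) (g.shear m x)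

/-- Positive phase moduli with spatial means `κ₀` and `μ₀`. -/
structure IsAdmissible (g : Geometry d N) (κ₀ μ₀ : ℝ) (m : PhaseModuli N) : Prop where
  bulk_pos : ∀ φ, 0 < m.κ φ
  shear_pos : ∀ φ, 0 < m.μ φ
  bulk_mean : ⨍ x in g.cell, g.bulk m x = κ₀
  shear_mean : ⨍ x in g.cell, g.shear m x = μ₀

/-- The contrast `‖δL‖ = sup_x max(|d δκ(x)|, |2 δμ(x)|)`. -/
def contrast (g : Geometry d N) (κ₀ μ₀ : ℝ) (m : PhaseModuli N) : ℝ :=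
  ⨆ x, max |d * (g.bulk m x - κ₀)| |2 * (g.shear m x - μ₀)|

/-- The weak contrast limit: admissible phase moduli, with `‖δL‖ → 0`. -/
def weakContrast (g : Geometry d N) (κ₀ μ₀ : ℝ) : Filter (PhaseModuli N) :=
  comap (contrast g κ₀ μ₀) (𝓝 0) ⊓ 𝓟 {m | IsAdmissible g κ₀ μ₀ m}

/-! ### The periodic elasticity problem -/

/-- The `j`-th partial derivative. -/
def partialDeriv (j : Fin d) (f : Space d → ℝ) (x : Space d) : ℝ :=
  fderiv ℝ f x (EuclideanSpace.single j 1)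

/-- `u` is a periodic displacement field of class `H¹` with weak gradient `G`, that is
`G i j = ∂u_i/∂x_j`. -/
structure IsPeriodicH1 (g : Geometry d N) (u : Space d → Space d) (G : Space d → Tensor2 d) :
    Prop where
  periodic : g.IsPeriodic u
  periodic_grad : g.IsPeriodic G
  memLp : ∀ i, MemLp (fun x => u x i) 2 (volume.restrict g.cell)
  memLp_grad : ∀ i j, MemLp (fun x => G x i j) 2 (volume.restrict g.cell)
  weak_grad : ∀ φ : Space d → ℝ, ContDiff ℝ ∞ φ → g.IsPeriodic φ → ∀ i j,
    ∫ x in g.cell, u x i * partialDeriv j φ x = -∫ x in g.cell, G x i j * φ x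

/-- The symmetric part of a second-order tensor. -/
def symPart (A : Tensor2 d) : Tensor2 d := (2⁻¹ : ℝ) • (A + A.transpose)

/-- The gradient of a differentiable vector field. -/
def gradient (v : Space d → Space d) (x : Space d) : Tensor2 d :=
  Matrix.of fun i j => partialDeriv j (fun y => v y i) x

/-- `ε` is the strain field in the periodic medium for the macroscopic strain `ebar`: it is the
sum of `ebar` and of the symmetrized gradient of a periodic displacement field (which makes it
compatible, with mean value `ebar`), and the stress `L : ε` is in equilibrium, in the weak sense
(with periodic test fields). -/
structure IsStrainField (g : Geometry d N) (m : PhaseModuli N) (ebar : Tensor2 d)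
    (ε : Space d → Tensor2 d) : Prop where
  compatible : ∃ u G, IsPeriodicH1 g u G ∧ ∀ᵐ x, ε x = ebar + symPart (G x)
  equilibrium : ∀ v : Space d → Space d, ContDiff ℝ ∞ v → g.IsPeriodic v →
    ∫ x in g.cell, inner2 (contract (g.elasticity m x) (ε x)) (symPart (gradient v x)) = 0

/-- The effective elasticity tensor: the fourth-order tensor with minor and major symmetries
that maps the mean of the strain to the mean of the stress. -/
structure IsEffectiveTensor (g : Geometry d N) (m : PhaseModuli N) (T : Tensor4 d) : Prop where
  minor_left : ∀ i j k l, T i j k l = T j i k l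
  minor_right : ∀ i j k l, T i j k l = T i j l k
  major : ∀ i j k l, T i j k l = T k l i j
  mean_stress : ∀ ebar : Tensor2 d, ebar.IsSymm → ∀ ε, IsStrainField g m ebar ε →
    ∀ i j, ⨍ x in g.cell, contract (g.elasticity m x) (ε x) i j = contract T ebar i j

/-- Macroscopic isotropy: the effective elasticity tensor is isotropic. -/
def MacroIsotropic (g : Geometry d N) (m : PhaseModuli N) : Prop :=
  ∃ T, IsEffectiveTensor g m T ∧ IsIsotropic T

end Elast

end

noncomputable section

namespace Elast

open Module (Basis)

attribute [local instance] instMeasureSpaceUnitAddCircle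

variable {d N : ℕ}

/-! ### Fourier series on the unit cell of a lattice -/

/-! The strain solves the Lippmann-Schwinger equation `E = ē - Γ (δL : E)`, where `Γ` is the Green
operator of the homogeneous reference medium, a matrix of bounded Fourier multipliers
(`IsStrainField.lippmannSchwinger`). For small contrast `c = ‖δL‖` the operator `Γ δL` has norm
`O(c)`, so in L² the fluctuation `E - ē` is `O(c)` and equals `-Γ (δL : ē)` up to `O(c²)`
(`exists_expansion`). Expanding the square of a strain invariant about `ē`, the quadratic part of
the fluctuation contributes only `O(c²)` to a phase average. If `ē` is spherical the deviatoric
invariant has nothing but that quadratic part, and conversely, which gives the two `o(c)` claims.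
For the other two, what remains is the phase average of the linear observable `ē : Γ (δL : ē)`.

Spherical loading. The polarization is `d ē₀ δκ` times the identity. Since `∑ ξᵢ ξᵢ = |ξ|²`, the
trace of `Γ` applied to `F • 1` has a symbol that is the same at all nonzero frequencies: the
response is pointwise proportional to `δκ` (`trace_green_spherical`), and its average over a phase
is read off at once.

Deviatoric loading. The polarization is `2 δμ ē`, and the symbol of the response operator `R_e : F ↦
e : Γ (F e)` depends on the direction of the frequency. Macroscopic isotropy makes up for this. To
second order, `e : L̃ : e = 2 μ₀ e : e - 4 ⟨δμ, R_e δμ⟩`, with a cubic error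
(`exists_effective_expansion`). An isotropic tensor has a quadratic form proportional to `e : e` on
deviators (`IsIsotropic.exists_quadratic_eq`). Letting the shear contrast tend to zero along a fixed
direction `s` shows that `⟨s, R_e s⟩ / (e : e)` is independent of `e`, for every mean-zero piecewise
constant `s` (`inner_response_proportional`). Its value follows by summing over the columns of `K`:
the summed symbol is `K :: Γ̂(ξ) = λ_K` for all `ξ ≠ 0`, and the summed norms give `n_K`. Thus `n_K
⟨s, R_e s⟩ = (e : e) λ_K ⟨s, s⟩` (`inner_response_self`). Polarizing this quadratic identity and
pairing with the centred indicator of a phase yields the phase average of `R_e δμ`, hence the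
formula for `μ_φ`. -/

/-- The normalized Lebesgue measure on the unit cell of a lattice. -/
def cellMeasure (b : Basis (Fin d) ℝ (Space d)) : Measure (Space d) :=
  (volume (ZSpan.fundamentalDomain b))⁻¹ • volume.restrict (ZSpan.fundamentalDomain b)

theorem volume_fundamentalDomain_ne_top (b : Basis (Fin d) ℝ (Space d)) :
    volume (ZSpan.fundamentalDomain b) ≠ ⊤ :=
  (ZSpan.fundamentalDomain_isBounded b).measure_lt_top.ne

theorem volume_fundamentalDomain_ne_zero (b : Basis (Fin d) ℝ (Space d)) :
    volume (ZSpan.fundamentalDomain b) ≠ 0 :=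
  ZSpan.measure_fundamentalDomain_ne_zero b

instance isProbabilityMeasure_cellMeasure (b : Basis (Fin d) ℝ (Space d)) :
    IsProbabilityMeasure (cellMeasure b) :=
  ⟨by simp [cellMeasure, ENNReal.inv_mul_cancel (volume_fundamentalDomain_ne_zero b)
    (volume_fundamentalDomain_ne_top b)]⟩

/-- The point of the unit cell with given coordinates modulo the lattice. -/
def torusSection (b : Basis (Fin d) ℝ (Space d)) (t : UnitAddTorus (Fin d)) : Space d :=
  ∑ i, ((AddCircle.equivIoc 1 0 (t i) : ℝ)) • b i

/-- This change of variables carries the Fourier theory of the standard torus over to an arbitrary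
lattice cell. -/
theorem measurePreserving_torusSection (b : Basis (Fin d) ℝ (Space d)) :
    MeasurePreserving (torusSection b) volume (cellMeasure b) := by
  have h1 := UnitAddTorus.measurePreserving_equivPiIoc (fun _ : Fin d => (0 : ℝ))
  have h2 : MeasurePreserving
      (Subtype.val : {x : Fin d → ℝ // ∀ i, x i ∈ Set.Ioc (0 : ℝ) (0 + 1)} → Fin d → ℝ)
      (Measure.comap Subtype.val volume)
      (volume.restrict {x : Fin d → ℝ | ∀ i, x i ∈ Set.Ioc (0 : ℝ) (0 + 1)}) :=
    ⟨measurable_subtype_coe, map_comap_subtype_coe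
      (MeasurableSet.univ_pi' (fun i => measurableSet_Ioc)) (volume : Measure (Fin d → ℝ))⟩
  have h3 := h2.comp h1
  -- The chart of the circle uses `(0, 1]`, the fundamental domain `[0, 1)`. Both boxes agree almost
  -- everywhere with the closed one.
  have hset : {x : Fin d → ℝ | ∀ i, x i ∈ Set.Ioc (0 : ℝ) (0 + 1)} =ᵐ[volume]
      {x : Fin d → ℝ | ∀ i, x i ∈ Set.Ico (0 : ℝ) 1} := by
    have e1 := MeasureTheory.Measure.univ_pi_Ioc_ae_eq_Icc
      (μ := fun _ : Fin d => (volume : Measure ℝ)) (f := fun _ => 0) (g := fun _ => 1)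
    have e2 := MeasureTheory.Measure.univ_pi_Ico_ae_eq_Icc
      (μ := fun _ : Fin d => (volume : Measure ℝ)) (f := fun _ => 0) (g := fun _ => 1)
    have s1 : {x : Fin d → ℝ | ∀ i, x i ∈ Set.Ioc (0 : ℝ) (0 + 1)} =
      Set.univ.pi fun _ => Set.Ioc 0 1 := by ext x; simp
    have s2 : {x : Fin d → ℝ | ∀ i, x i ∈ Set.Ico (0 : ℝ) 1} =
      Set.univ.pi fun _ => Set.Ico 0 1 := by ext x; simp
    rw [s1, s2]
    exact e1.trans e2.symm
  rw [Measure.restrict_congr_set hset] at h3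
  set L : Space d ≃L[ℝ] (Fin d → ℝ) := b.equivFunL with hL
  have h4 : L.symm ⁻¹' (ZSpan.fundamentalDomain b) =
      {x : Fin d → ℝ | ∀ i, x i ∈ Set.Ico (0 : ℝ) 1} := by
    ext x
    have : ∀ i, b.repr (L.symm x) i = x i := fun i => by
      have := congrFun (L.apply_symm_apply x) i
      simpa [hL] using this
    simp [ZSpan.mem_fundamentalDomain, this]
  -- By uniqueness of Haar measure the linear change of coordinates scales volume by a constant `c`.
  -- Its value comes later from the torus having total mass one, so no determinant is computed.
  have hadd : (Measure.map L.symm (volume : Measure (Fin d → ℝ))).IsAddHaarMeasure :=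
    L.symm.isAddHaarMeasure_map _
  have h5 := Measure.isAddLeftInvariant_eq_smul
    (Measure.map L.symm (volume : Measure (Fin d → ℝ))) (volume : Measure (Space d))
  set c := (Measure.map L.symm (volume : Measure (Fin d → ℝ))).addHaarScalarFactor
    (volume : Measure (Space d))
  have hmeas := ZSpan.fundamentalDomain_measurableSet b
  have h6 : MeasurePreserving L.symm
      (volume.restrict {x : Fin d → ℝ | ∀ i, x i ∈ Set.Ico (0 : ℝ) 1})
      (c • volume.restrict (ZSpan.fundamentalDomain b)) := by
    refine ⟨L.symm.continuous.measurable, ?_⟩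
    rw [← h4, ← Measure.restrict_map L.symm.continuous.measurable hmeas, h5,
      Measure.restrict_smul]
  have h7 := h6.comp h3
  have h8 : cellMeasure b = c • volume.restrict (ZSpan.fundamentalDomain b) := by
    have hu := h7.measure_preimage MeasurableSet.univ.nullMeasurableSet
    have hv : (volume : Measure (UnitAddTorus (Fin d))) Set.univ = 1 := by
      have : (volume : Measure (UnitAddTorus (Fin d))) =
        Measure.pi fun _ => AddCircle.haarAddCircle := rfl
      rw [this]; simp
    rw [Set.preimage_univ, hv, Measure.smul_apply, Measure.restrict_apply MeasurableSet.univ,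
      Set.univ_inter] at hu
    have hc : (c : ENNReal) = (volume (ZSpan.fundamentalDomain b))⁻¹ := by
      refine ENNReal.eq_inv_of_mul_eq_one_left ?_
      rw [hu]; rfl
    rw [cellMeasure, ← hc]; rfl
  rw [h8]
  have h9 : torusSection b = L.symm ∘ Subtype.val ∘
      (UnitAddTorus.measurableEquivPiIoc fun _ : Fin d => (0 : ℝ)) := by
    funext t
    change _ = b.equivFun.symm _
    rw [Basis.equivFun_symm_apply]
    rfl
  rw [h9]
  exact h7

/-- The frequency of the `n`-th Fourier mode on the unit cell, as a linear form on space. -/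
def freq (b : Basis (Fin d) ℝ (Space d)) (n : Fin d → ℤ) : Space d →L[ℝ] ℝ :=
  LinearMap.toContinuousLinearMap (∑ i, (2 * Real.pi * n i) • b.coord i)

theorem freq_apply (b : Basis (Fin d) ℝ (Space d)) (n : Fin d → ℤ) (x : Space d) :
    freq b n x = ∑ i, 2 * Real.pi * n i * b.repr x i := by
  simp [freq]

/-- The `n`-th Fourier mode. -/
def mode (b : Basis (Fin d) ℝ (Space d)) (n : Fin d → ℤ) (x : Space d) : ℂ :=
  Complex.exp (freq b n x * Complex.I)

theorem mode_torusSection (b : Basis (Fin d) ℝ (Space d)) (n : Fin d → ℤ)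
    (t : UnitAddTorus (Fin d)) : mode b n (torusSection b t) = UnitAddTorus.mFourier n t := by
  have hr : ∀ i, b.repr (torusSection b t) i = AddCircle.equivIoc 1 0 (t i) := fun i => by
    simp [torusSection, Finsupp.single_apply]
  rw [mode, freq_apply, UnitAddTorus.mFourier, ContinuousMap.coe_mk, Complex.ofReal_sum,
    Finset.sum_mul, Complex.exp_sum]
  refine Finset.prod_congr rfl fun i _ => ?_
  rw [hr]
  conv_rhs => rw [← (AddCircle.equivIoc 1 0).symm_apply_apply (t i)]
  change _ = fourier (n i) (((AddCircle.equivIoc 1 0 (t i) : ℝ)) : AddCircle (1 : ℝ))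
  rw [fourier_coe_apply]
  congr 1
  push_cast
  ring

theorem continuous_mode (b : Basis (Fin d) ℝ (Space d)) (n : Fin d → ℤ) :
    Continuous (mode b n) := by
  unfold mode; fun_prop

theorem norm_mode (b : Basis (Fin d) ℝ (Space d)) (n : Fin d → ℤ) (x : Space d) :
    ‖mode b n x‖ = 1 := by
  rw [mode, Complex.norm_exp_ofReal_mul_I]

theorem memLp_mode (b : Basis (Fin d) ℝ (Space d)) (n : Fin d → ℤ) :
    MemLp (mode b n) 2 (cellMeasure b) :=
  MemLp.of_bound (continuous_mode b n).aestronglyMeasurable 1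
    (Eventually.of_forall fun x => (norm_mode b n x).le)

/-- Square-integrable complex functions on the unit cell. -/
abbrev CellL2 (b : Basis (Fin d) ℝ (Space d)) := Lp ℂ 2 (cellMeasure b)

theorem inner_toLp_left (b : Basis (Fin d) ℝ (Space d)) {f : Space d → ℂ}
    (hf : MemLp f 2 (cellMeasure b)) (g : CellL2 b) :
    inner ℂ (hf.toLp f) g = ∫ x, (starRingEnd ℂ) (f x) * g x ∂(cellMeasure b) := by
  rw [L2.inner_def]
  refine integral_congr_ae ?_
  filter_upwards [hf.coeFn_toLp] with x hx
  rw [hx, RCLike.inner_apply, mul_comm]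

theorem inner_toLp (b : Basis (Fin d) ℝ (Space d)) {f g : Space d → ℂ}
    (hf : MemLp f 2 (cellMeasure b)) (hg : MemLp g 2 (cellMeasure b)) :
    inner ℂ (hf.toLp f) (hg.toLp g) = ∫ x, (starRingEnd ℂ) (f x) * g x ∂(cellMeasure b) := by
  rw [inner_toLp_left]
  refine integral_congr_ae ?_
  filter_upwards [hg.coeFn_toLp] with x hx
  rw [hx]

theorem integral_cellMeasure_eq (b : Basis (Fin d) ℝ (Space d)) {f : Space d → ℂ}
    (hf : AEStronglyMeasurable f (cellMeasure b)) :
    ∫ x, f x ∂(cellMeasure b) = ∫ t, f (torusSection b t) := by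
  rw [← (measurePreserving_torusSection b).map_eq] at hf ⊢
  rw [integral_map (measurePreserving_torusSection b).measurable.aemeasurable hf]

theorem orthonormal_mode (b : Basis (Fin d) ℝ (Space d)) :
    Orthonormal ℂ fun n => ((memLp_mode b n).toLp (mode b n) : CellL2 b) := by
  have key : ∀ m n, inner ℂ ((memLp_mode b m).toLp (mode b m) : CellL2 b)
      ((memLp_mode b n).toLp (mode b n)) =
      inner ℂ (UnitAddTorus.mFourierLp 2 m) (UnitAddTorus.mFourierLp 2 n) := by
    intro m n
    rw [inner_toLp, integral_cellMeasure_eq, L2.inner_def]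
    · refine integral_congr_ae ?_
      filter_upwards [UnitAddTorus.coeFn_mFourierLp 2 m, UnitAddTorus.coeFn_mFourierLp 2 n]
        with t h1 h2
      rw [h1, h2, mode_torusSection, mode_torusSection, RCLike.inner_apply, mul_comm]
    · exact ((Complex.continuous_conj.comp (continuous_mode b m)).mul
        (continuous_mode b n)).aestronglyMeasurable
  have h := (orthonormal_iff_ite.1 (UnitAddTorus.orthonormal_mFourier (d := Fin d)))
  rw [orthonormal_iff_ite]
  intro m n
  rw [key, h]

/-- Completeness is inherited from the torus: the pull-back of `f` has vanishing Fourier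
coefficients there, hence is zero, and pulling back preserves the L² norm. -/
theorem eq_zero_of_inner_mode (b : Basis (Fin d) ℝ (Space d)) (f : CellL2 b)
    (hf : ∀ n, inner ℂ ((memLp_mode b n).toLp (mode b n) : CellL2 b) f = 0) : f = 0 := by
  have hs := measurePreserving_torusSection b
  have hg := (Lp.memLp f).comp_measurePreserving hs
  have hz : hg.toLp _ = 0 := by
    apply UnitAddTorus.mFourierBasis.repr.injective
    ext n
    rw [UnitAddTorus.mFourierBasis_repr, map_zero]
    have h1 := hf n
    rw [inner_toLp_left, integral_cellMeasure_eq] at h1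
    · rw [UnitAddTorus.mFourierCoeff]
      refine Eq.trans (integral_congr_ae ?_) h1
      filter_upwards [hg.coeFn_toLp] with t ht
      rw [ht, mode_torusSection, UnitAddTorus.mFourier_neg]
      rfl
    · exact (Complex.continuous_conj.comp (continuous_mode b n)).aestronglyMeasurable.mul
        (Lp.aestronglyMeasurable f)
  have h2 : eLpNorm f 2 (cellMeasure b) = 0 := by
    rw [← eLpNorm_comp_measurePreserving (Lp.aestronglyMeasurable f) hs]
    have := Lp.toLp_coeFn (hg.toLp _) (Lp.memLp _)
    rw [← eLpNorm_congr_ae hg.coeFn_toLp, hz, eLpNorm_congr_ae (Lp.coeFn_zero _ _ _)]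
    simp
  rw [← Lp.enorm_def] at h2
  simpa using h2

/-- The Hilbert basis of Fourier modes. -/
def modeBasis (b : Basis (Fin d) ℝ (Space d)) : HilbertBasis (Fin d → ℤ) ℂ (CellL2 b) :=
  HilbertBasis.mkOfOrthogonalEqBot (orthonormal_mode b) (by
    rw [Submodule.eq_bot_iff]
    intro f hf
    refine eq_zero_of_inner_mode b f fun n => ?_
    exact (Submodule.mem_orthogonal _ _).1 hf _ (Submodule.subset_span ⟨n, rfl⟩))

/-- The Fourier coefficients of a square-integrable function. -/
def coeff (b : Basis (Fin d) ℝ (Space d)) (f : CellL2 b) (n : Fin d → ℤ) : ℂ :=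
  (modeBasis b).repr f n

theorem coeff_eq_inner (b : Basis (Fin d) ℝ (Space d)) (f : CellL2 b) (n : Fin d → ℤ) :
    coeff b f n = inner ℂ ((memLp_mode b n).toLp (mode b n) : CellL2 b) f := by
  rw [coeff, HilbertBasis.repr_apply_apply, modeBasis, HilbertBasis.coe_mkOfOrthogonalEqBot]

theorem coeff_toLp (b : Basis (Fin d) ℝ (Space d)) {f : Space d → ℂ}
    (hf : MemLp f 2 (cellMeasure b)) (n : Fin d → ℤ) :
    coeff b (hf.toLp f) n = ∫ x, (starRingEnd ℂ) (mode b n x) * f x ∂(cellMeasure b) := by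
  rw [coeff_eq_inner, inner_toLp]

theorem ext_coeff (b : Basis (Fin d) ℝ (Space d)) {f g : CellL2 b}
    (h : ∀ n, coeff b f n = coeff b g n) : f = g :=
  (modeBasis b).repr.injective (by ext n; exact h n)

theorem hasSum_inner_coeff (b : Basis (Fin d) ℝ (Space d)) (f g : CellL2 b) :
    HasSum (fun n => (starRingEnd ℂ) (coeff b f n) * coeff b g n) (inner ℂ f g) := by
  have h := (modeBasis b).hasSum_inner_mul_inner f g
  refine Eq.mp (congrArg (fun F => HasSum F _) (funext fun n => ?_)) h
  rw [coeff_eq_inner, coeff_eq_inner, inner_conj_symm, modeBasis,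
    HilbertBasis.coe_mkOfOrthogonalEqBot]

/-! ### Weak derivatives and Fourier coefficients -/

/-- A translate of the cell is again a fundamental domain of the lattice, and a lattice-invariant
function has the same integral over any two of them. -/
theorem setIntegral_cell_translate (b : Basis (Fin d) ℝ (Space d)) {F : Type*}
    [NormedAddCommGroup F] [NormedSpace ℝ F] {h : Space d → F} (hp : ∀ i x, h (x + b i) = h x)
    (v : Space d) :
    ∫ x in ZSpan.fundamentalDomain b, h (x + v) = ∫ x in ZSpan.fundamentalDomain b, h x := by
  have hfd := ZSpan.isAddFundamentalDomain' b (volume : Measure (Space d))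
  have : Countable (Submodule.span ℤ (Set.range b)).toAddSubgroup :=
    inferInstanceAs (Countable (Submodule.span ℤ (Set.range b)))
  have hfd' := hfd.vadd_of_comm v
  have hinv : ∀ w ∈ Submodule.span ℤ (Set.range b), ∀ x, h (x + w) = h x := by
    intro w hw
    induction hw using Submodule.span_induction with
    | mem w hw => obtain ⟨i, rfl⟩ := hw; exact hp i
    | zero => simp
    | add y z _ _ h1 h2 => intro x; rw [← add_assoc, h2, h1]
    | smul a y _ hy =>
      intro x
      induction a using Int.induction_on generalizing x with
      | zero => simp
      | succ n ih => rw [add_smul, one_smul, ← add_assoc, hy, ih]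
      | pred n ih =>
        rw [← hy (x + _), add_assoc, ← add_one_zsmul]
        simpa using ih x
  have h1 := hfd.setIntegral_eq hfd' (f := h) (fun w x => by
    have := hinv w.1 w.2 x
    rwa [add_comm] at this)
  rw [h1]
  rw [← (measurePreserving_add_left (volume : Measure (Space d)) v).setIntegral_preimage_emb
    (measurableEmbedding_addLeft v) h]
  have h3 : (fun x => v + x) ⁻¹' ((v + ·) '' ZSpan.fundamentalDomain b) =
      ZSpan.fundamentalDomain b := Set.preimage_image_eq _ (add_right_injective v)
  erw [h3]
  simp_rw [add_comm]

theorem integral_cellMeasure (b : Basis (Fin d) ℝ (Space d)) {F : Type*}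
    [NormedAddCommGroup F] [NormedSpace ℝ F] (h : Space d → F) :
    ∫ x, h x ∂(cellMeasure b) = (volume (ZSpan.fundamentalDomain b)).toReal⁻¹ •
      ∫ x in ZSpan.fundamentalDomain b, h x := by
  rw [cellMeasure, integral_smul_measure, ENNReal.toReal_inv]

theorem ae_cellMeasure_of_forall_mem (b : Basis (Fin d) ℝ (Space d)) {p : Space d → Prop}
    (h : ∀ x ∈ ZSpan.fundamentalDomain b, p x) : ∀ᵐ x ∂(cellMeasure b), p x := by
  refine Measure.ae_smul_measure ?_ _
  exact (ae_restrict_iff' (ZSpan.fundamentalDomain_measurableSet b)).2 (Eventually.of_forall h)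

theorem isCompact_closure_fundamentalDomain (b : Basis (Fin d) ℝ (Space d)) :
    IsCompact (closure (ZSpan.fundamentalDomain b)) :=
  (ZSpan.fundamentalDomain_isBounded b).isCompact_closure

theorem memLp_of_continuous (b : Basis (Fin d) ℝ (Space d)) {F : Type*} [NormedAddCommGroup F]
    [SecondCountableTopologyEither (Space d) F] {h : Space d → F} (hc : Continuous h)
    (p : ENNReal) : MemLp h p (cellMeasure b) := by
  obtain ⟨C, hC⟩ := (isCompact_closure_fundamentalDomain b).exists_bound_of_continuousOn
    hc.continuousOn
  exact MemLp.of_bound hc.aestronglyMeasurable C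
    (ae_cellMeasure_of_forall_mem b fun x hx => hC x (subset_closure hx))

/-- The integral is the derivative at `t = 0` of `∫ h (x + t v)`, which is constant in `t` by
translation invariance. This avoids boundary terms on a skew cell. -/
theorem integral_fderiv_eq_zero (b : Basis (Fin d) ℝ (Space d)) {F : Type*}
    [NormedAddCommGroup F] [NormedSpace ℝ F] [SecondCountableTopologyEither (Space d) F]
    {h : Space d → F}
    (hp : ∀ i x, h (x + b i) = h x) (hs : ContDiff ℝ 1 h) (v : Space d) :
    ∫ x, fderiv ℝ h x v ∂(cellMeasure b) = 0 := by
  have hcf : Continuous fun x => fderiv ℝ h x v :=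
    (hs.continuous_fderiv one_ne_zero).clm_apply continuous_const
  -- The derivative is evaluated at `x + t v` with `|t| < 1`, so the dominating constant is taken on
  -- the compact sum of the closed cell and a segment.
  obtain ⟨C, hC⟩ := ((isCompact_closure_fundamentalDomain b).add
    ((isCompact_Icc (a := (-1 : ℝ)) (b := 1)).image
      (f := fun t => t • v) (by fun_prop))).exists_bound_of_continuousOn hcf.continuousOn
  have key := hasDerivAt_integral_of_dominated_loc_of_deriv_le (μ := cellMeasure b)
    (F := fun (t : ℝ) x => h (x + t • v)) (F' := fun t x => fderiv ℝ h (x + t • v) v)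
    (x₀ := 0) (s := Set.Ioo (-1) 1) (bound := fun _ => C)
    (Ioo_mem_nhds (by norm_num) (by norm_num))
    (Eventually.of_forall fun t => (hs.continuous.comp (by fun_prop)).aestronglyMeasurable)
    ((memLp_of_continuous b (hs.continuous.comp (by fun_prop)) 1).integrable le_rfl)
    (hcf.comp (by fun_prop)).aestronglyMeasurable
    (ae_cellMeasure_of_forall_mem b fun x hx t ht => hC _
      (Set.add_mem_add (subset_closure hx) ⟨t, ⟨ht.1.le, ht.2.le⟩, rfl⟩))
    (integrable_const C)
    (Eventually.of_forall fun x t _ => by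
      have h1 : HasDerivAt (fun t : ℝ => x + t • v) v t := by
        simpa using ((hasDerivAt_id t).smul_const v).const_add x
      exact ((hs.differentiable one_ne_zero).differentiableAt.hasFDerivAt).comp_hasDerivAt t h1)
  have hconst : (fun t : ℝ => ∫ x, h (x + t • v) ∂(cellMeasure b)) =
      fun _ => ∫ x, h x ∂(cellMeasure b) := by
    funext t
    rw [integral_cellMeasure, integral_cellMeasure, setIntegral_cell_translate b hp]
  have h0 := key.2
  rw [hconst] at h0
  simpa using (h0.unique (hasDerivAt_const _ _))

/-- The components of the wave vector of the `n`-th Fourier mode. -/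
def wave (b : Basis (Fin d) ℝ (Space d)) (n : Fin d → ℤ) (j : Fin d) : ℝ :=
  freq b n (EuclideanSpace.single j 1)

theorem freq_basis (b : Basis (Fin d) ℝ (Space d)) (n : Fin d → ℤ) (i : Fin d) :
    freq b n (b i) = n i * (2 * Real.pi) := by
  rw [freq_apply, Finset.sum_eq_single i]
  · simp; ring
  · intro j _ hj; simp [hj.symm]
  · simp

theorem mode_eq (b : Basis (Fin d) ℝ (Space d)) (n : Fin d → ℤ) (x : Space d) :
    mode b n x = Real.cos (freq b n x) + Real.sin (freq b n x) * Complex.I := by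
  rw [mode, Complex.exp_mul_I, Complex.ofReal_cos, Complex.ofReal_sin]

theorem mode_periodic (b : Basis (Fin d) ℝ (Space d)) (n : Fin d → ℤ) (i : Fin d) (x : Space d) :
    mode b n (x + b i) = mode b n x := by
  rw [mode_eq, mode_eq, map_add, freq_basis, Real.cos_add_int_mul_two_pi,
    Real.sin_add_int_mul_two_pi]

theorem hasFDerivAt_conj_mode (b : Basis (Fin d) ℝ (Space d)) (n : Fin d → ℤ) (x : Space d) :
    HasFDerivAt (fun y => (starRingEnd ℂ) (mode b n y))
      ((freq b n).smulRight (-Complex.I * (starRingEnd ℂ) (mode b n x))) x := by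
  have h : (fun y => (starRingEnd ℂ) (mode b n y)) =
      fun y => Complex.exp (freq b n y * -Complex.I) := by
    funext y
    rw [mode, ← Complex.exp_conj]
    simp
  have hx := congrFun h x
  rw [hx, h]
  have h1 : HasFDerivAt (fun y => (freq b n y : ℂ) * -Complex.I)
      (((freq b n).smulRight (-Complex.I))) x := by
    have := ((freq b n).smulRight (-Complex.I)).hasFDerivAt (x := x)
    refine this.congr_of_eventuallyEq (Eventually.of_forall fun y => ?_)
    simp
  have h2 := h1.cexp
  refine h2.congr_fderiv ?_
  ext v
  simp
  ring

theorem contDiff_conj_mode (b : Basis (Fin d) ℝ (Space d)) (n : Fin d → ℤ) :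
    ContDiff ℝ 1 (fun y => (starRingEnd ℂ) (mode b n y)) := by
  have h : (fun y => (starRingEnd ℂ) (mode b n y)) =
      fun y => Complex.exp (((freq b n).smulRight (-Complex.I)) y) := by
    funext y
    rw [mode, ← Complex.exp_conj]
    simp
  rw [h]
  exact ((freq b n).smulRight (-Complex.I)).contDiff.cexp

theorem memLp_ofReal_of_continuous (b : Basis (Fin d) ℝ (Space d)) {φ : Space d → ℝ}
    (h : Continuous φ) : MemLp (fun x => (φ x : ℂ)) 2 (cellMeasure b) :=
  memLp_of_continuous b (Complex.continuous_ofReal.comp h) 2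

theorem continuous_partialDeriv {φ : Space d → ℝ} (hs : ContDiff ℝ ∞ φ) (j : Fin d) :
    Continuous (partialDeriv j φ) :=
  (hs.continuous_fderiv (by simp)).clm_apply continuous_const

/-- Integration by parts: the derivative of the product of `φ` with the conjugate mode has zero
integral over the cell. -/
theorem coeff_partialDeriv (b : Basis (Fin d) ℝ (Space d)) {φ : Space d → ℝ}
    (hp : ∀ i x, φ (x + b i) = φ x) (hs : ContDiff ℝ ∞ φ) (j : Fin d) (n : Fin d → ℤ) :
    coeff b ((memLp_ofReal_of_continuous b (continuous_partialDeriv hs j)).toLp _) n =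
      Complex.I * wave b n j * coeff b ((memLp_ofReal_of_continuous b hs.continuous).toLp _) n := by
  rw [coeff_toLp, coeff_toLp]
  have hs1 : ContDiff ℝ 1 φ := hs.of_le (by exact_mod_cast le_top)
  have hφ : ContDiff ℝ 1 (fun x => (φ x : ℂ)) := Complex.ofRealCLM.contDiff.comp hs1
  have hz := integral_fderiv_eq_zero b
    (h := fun x => (starRingEnd ℂ) (mode b n x) * (φ x : ℂ))
    (fun i x => by simp only [mode_periodic, hp]) ((contDiff_conj_mode b n).mul hφ)
    (EuclideanSpace.single j 1)
  have hd : ∀ x, fderiv ℝ (fun x => (starRingEnd ℂ) (mode b n x) * (φ x : ℂ)) x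
      (EuclideanSpace.single j 1) = (starRingEnd ℂ) (mode b n x) * (partialDeriv j φ x : ℂ) -
        Complex.I * wave b n j * ((starRingEnd ℂ) (mode b n x) * (φ x : ℂ)) := by
    intro x
    have h1 := hasFDerivAt_conj_mode b n x
    have h2 : HasFDerivAt (fun x => (φ x : ℂ)) (Complex.ofRealCLM.comp (fderiv ℝ φ x)) x :=
      Complex.ofRealCLM.hasFDerivAt.comp x
        (hs1.differentiable one_ne_zero).differentiableAt.hasFDerivAt
    have h3 := (h1.mul h2).fderiv
    change fderiv ℝ (fun x => (starRingEnd ℂ) (mode b n x) * (φ x : ℂ)) x = _ at h3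
    rw [h3]
    simp [partialDeriv, wave]
    ring
  simp_rw [hd] at hz
  have i1 : Continuous fun x => (starRingEnd ℂ) (mode b n x) :=
    Complex.continuous_conj.comp (continuous_mode b n)
  have i2 : Continuous fun x => (φ x : ℂ) := hφ.continuous
  have i3 : Continuous fun x => (partialDeriv j φ x : ℂ) :=
    Complex.continuous_ofReal.comp (continuous_partialDeriv hs j)
  rw [integral_sub, integral_const_mul, sub_eq_zero] at hz
  · exact hz
  · exact (memLp_of_continuous b (i1.mul i3) 1).integrable le_rfl
  · exact ((memLp_of_continuous b (i1.mul i2) 1).integrable le_rfl).const_mul _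

theorem partialDeriv_cos_freq (b : Basis (Fin d) ℝ (Space d)) (n : Fin d → ℤ) (j : Fin d)
    (x : Space d) : partialDeriv j (fun y => Real.cos (freq b n y)) x =
      -(wave b n j * Real.sin (freq b n x)) := by
  rw [partialDeriv, ((freq b n).hasFDerivAt (x := x)).cos.fderiv]
  simp [wave]; ring

theorem partialDeriv_sin_freq (b : Basis (Fin d) ℝ (Space d)) (n : Fin d → ℤ) (j : Fin d)
    (x : Space d) : partialDeriv j (fun y => Real.sin (freq b n y)) x =
      wave b n j * Real.cos (freq b n x) := by
  rw [partialDeriv, ((freq b n).hasFDerivAt (x := x)).sin.fderiv]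
  simp [wave]; ring

theorem integral_mul_eq_inner (b : Basis (Fin d) ℝ (Space d)) {φ : Space d → ℝ}
    (h : MemLp (fun x => (φ x : ℂ)) 2 (cellMeasure b)) (f : CellL2 b) :
    ∫ x, f x * (φ x : ℂ) ∂(cellMeasure b) = inner ℂ (h.toLp _) f := by
  rw [inner_toLp_left]
  simp [mul_comm]

/-- A weak identity `h = ∑ⱼ ∂ⱼ fⱼ` between periodic fields, expressed by Fourier coefficients. -/
theorem weak_divergence_iff (b : Basis (Fin d) ℝ (Space d)) (f : Fin d → CellL2 b)
    (h : CellL2 b) :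
    (∀ φ : Space d → ℝ, ContDiff ℝ ∞ φ → (∀ i x, φ (x + b i) = φ x) →
      ∑ j, ∫ x, f j x * (partialDeriv j φ x : ℂ) ∂(cellMeasure b) +
        ∫ x, h x * (φ x : ℂ) ∂(cellMeasure b) = 0) ↔
    ∀ n, coeff b h n = Complex.I * ∑ j, wave b n j * coeff b (f j) n := by
  constructor
  · intro H n
    -- Test functions are real, so the mode itself is not allowed. Its real and imaginary parts are
    -- tested separately and recombined by `hco`.
    have hcos : ContDiff ℝ ∞ fun x => Real.cos (freq b n x) := (freq b n).contDiff.cos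
    have hsin : ContDiff ℝ ∞ fun x => Real.sin (freq b n x) := (freq b n).contDiff.sin
    have h1 := H _ hcos fun i x => by
      simp only [map_add, freq_basis, Real.cos_add_int_mul_two_pi]
    have h2 := H _ hsin fun i x => by
      simp only [map_add, freq_basis, Real.sin_add_int_mul_two_pi]
    simp only [partialDeriv_cos_freq, partialDeriv_sin_freq] at h1 h2
    set S : CellL2 b → ℂ := fun f => ∫ x, f x * (Real.sin (freq b n x) : ℂ) ∂(cellMeasure b)
    set C : CellL2 b → ℂ := fun f => ∫ x, f x * (Real.cos (freq b n x) : ℂ) ∂(cellMeasure b)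
    have hS : ∀ f : CellL2 b, Integrable (fun x => f x * (Real.sin (freq b n x) : ℂ))
        (cellMeasure b) := fun f =>
      (Lp.memLp f).integrable_mul (memLp_ofReal_of_continuous b hsin.continuous)
    have hC : ∀ f : CellL2 b, Integrable (fun x => f x * (Real.cos (freq b n x) : ℂ))
        (cellMeasure b) := fun f =>
      (Lp.memLp f).integrable_mul (memLp_ofReal_of_continuous b hcos.continuous)
    have hco : ∀ f : CellL2 b, coeff b f n = C f - Complex.I * S f := by
      intro f
      rw [coeff_eq_inner, inner_toLp_left, ← integral_const_mul, ← integral_sub (hC f)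
        ((hS f).const_mul _)]
      congr 1
      funext x
      rw [mode_eq]
      simp only [map_add, map_mul, Complex.conj_ofReal, Complex.conj_I]
      ring
    have e1 : ∀ j, ∫ x, f j x * ((-(wave b n j * Real.sin (freq b n x)) : ℝ) : ℂ)
        ∂(cellMeasure b) = -(wave b n j * S (f j)) := by
      intro j
      rw [← integral_const_mul, ← integral_neg]
      congr 1; funext x; push_cast; ring
    have e2 : ∀ j, ∫ x, f j x * ((wave b n j * Real.cos (freq b n x) : ℝ) : ℂ)
        ∂(cellMeasure b) = wave b n j * C (f j) := by
      intro j
      rw [← integral_const_mul]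
      congr 1; funext x; push_cast; ring
    simp_rw [e1] at h1
    simp_rw [e2] at h2
    change _ + C h = 0 at h1
    change _ + S h = 0 at h2
    rw [Finset.sum_neg_distrib] at h1
    simp_rw [hco, mul_sub, Finset.sum_sub_distrib]
    have e3 : ∑ j, (wave b n j : ℂ) * (Complex.I * S (f j)) =
        Complex.I * ∑ j, wave b n j * S (f j) := by
      rw [Finset.mul_sum]; refine Finset.sum_congr rfl fun j _ => by ring
    rw [e3]
    linear_combination h1 - Complex.I * h2 +
      (∑ j, (wave b n j : ℂ) * S (f j)) * Complex.I_mul_I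
  · intro H φ hs hp
    have hφ := memLp_ofReal_of_continuous b hs.continuous
    -- By Parseval the pairing is a series over frequencies. The conjugated factor `-i ξⱼ` from the
    -- test function makes each term cancel against `H n`.
    have hsum : HasSum (fun _ : Fin d → ℤ => (0 : ℂ))
        (∑ j, ∫ x, f j x * (partialDeriv j φ x : ℂ) ∂(cellMeasure b) +
          ∫ x, h x * (φ x : ℂ) ∂(cellMeasure b)) := by
      rw [integral_mul_eq_inner b hφ]
      simp_rw [fun j => integral_mul_eq_inner b
        (memLp_ofReal_of_continuous b (continuous_partialDeriv hs j)) (f j)]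
      refine Eq.mp (congrArg (fun F => HasSum F _) (funext fun n => ?_))
        ((hasSum_sum fun j _ => hasSum_inner_coeff b _ (f j)).add (hasSum_inner_coeff b _ h))
      simp_rw [coeff_partialDeriv b hp hs, H n, map_mul, Complex.conj_I, Complex.conj_ofReal,
        Finset.mul_sum]
      rw [← Finset.sum_add_distrib]
      refine Finset.sum_eq_zero fun j _ => by ring
    exact (hsum.unique hasSum_zero)

/-! ### Fourier multipliers -/

/-- Multiplication of square-summable sequences by a bounded sequence. -/
def seqMul {ι : Type*} (m : ι → ℂ) (hm : ∃ C, ∀ n, ‖m n‖ ≤ C) :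
    lp (fun _ : ι => ℂ) 2 →L[ℂ] lp (fun _ : ι => ℂ) 2 :=
  have hm' : ∃ C, 0 ≤ C ∧ ∀ n, ‖m n‖ ≤ C :=
    ⟨max hm.choose 0, le_max_right _ _, fun n => (hm.choose_spec n).trans (le_max_left _ _)⟩
  have two : (0 : ℝ) < (2 : ENNReal).toReal := by norm_num
  have hle : ∀ (f : lp (fun _ : ι => ℂ) 2) n, ‖m n * f n‖ ^ (2 : ENNReal).toReal ≤
      hm'.choose ^ (2 : ENNReal).toReal * ‖f n‖ ^ (2 : ENNReal).toReal := fun f n => by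
    rw [norm_mul, Real.mul_rpow (norm_nonneg _) (norm_nonneg _)]
    gcongr
    exact hm'.choose_spec.2 n
  LinearMap.mkContinuous
    { toFun := fun f => ⟨fun n => m n * f n, memℓp_gen (Summable.of_nonneg_of_le
        (fun n => by positivity) (hle f) ((lp.memℓp f).summable two |>.mul_left _))⟩
      map_add' := fun f g => by ext n; exact mul_add _ _ _
      map_smul' := fun c f => by
        ext n
        change m n * (c * f n) = c * (m n * f n)
        ring }
    hm'.choose fun f => by
      have h0 := hm'.choose_spec.1
      refine lp.norm_le_of_forall_sum_le two (by positivity) fun s => ?_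
      rw [Real.mul_rpow h0 (norm_nonneg _)]
      refine (Finset.sum_le_sum fun n _ => hle f n).trans ?_
      rw [← Finset.mul_sum]
      gcongr
      exact lp.sum_rpow_le_norm_rpow two f s

/-- The Fourier multiplier operator of a bounded symbol. -/
def multiplier (b : Basis (Fin d) ℝ (Space d)) (m : (Fin d → ℤ) → ℂ)
    (hm : ∃ C, ∀ n, ‖m n‖ ≤ C) : CellL2 b →L[ℂ] CellL2 b :=
  (modeBasis b).repr.symm.toContinuousLinearEquiv.toContinuousLinearMap.comp
    ((seqMul m hm).comp (modeBasis b).repr.toContinuousLinearEquiv.toContinuousLinearMap)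

theorem coeff_multiplier (b : Basis (Fin d) ℝ (Space d)) (m : (Fin d → ℤ) → ℂ)
    (hm : ∃ C, ∀ n, ‖m n‖ ≤ C) (f : CellL2 b) (n : Fin d → ℤ) :
    coeff b (multiplier b m hm f) n = m n * coeff b f n := by
  simp only [coeff, multiplier, ContinuousLinearMap.comp_apply]
  erw [LinearIsometryEquiv.apply_symm_apply]
  rfl

/-- Taking a Fourier coefficient, as a linear form. -/
def coeffLin (b : Basis (Fin d) ℝ (Space d)) (n : Fin d → ℤ) : CellL2 b →ₗ[ℂ] ℂ where
  toFun f := coeff b f n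
  map_add' f g := by simp [coeff]
  map_smul' c f := by simp [coeff]

theorem coeff_add (b : Basis (Fin d) ℝ (Space d)) (f g : CellL2 b) (n : Fin d → ℤ) :
    coeff b (f + g) n = coeff b f n + coeff b g n := (coeffLin b n).map_add f g

theorem coeff_sub (b : Basis (Fin d) ℝ (Space d)) (f g : CellL2 b) (n : Fin d → ℤ) :
    coeff b (f - g) n = coeff b f n - coeff b g n := (coeffLin b n).map_sub f g

theorem coeff_smul (b : Basis (Fin d) ℝ (Space d)) (c : ℂ) (f : CellL2 b) (n : Fin d → ℤ) :
    coeff b (c • f) n = c * coeff b f n := (coeffLin b n).map_smul c f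

theorem coeff_zero (b : Basis (Fin d) ℝ (Space d)) (n : Fin d → ℤ) :
    coeff b 0 n = 0 := (coeffLin b n).map_zero

theorem coeff_sum (b : Basis (Fin d) ℝ (Space d)) {ι : Type*} (s : Finset ι)
    (f : ι → CellL2 b) (n : Fin d → ℤ) :
    coeff b (∑ i ∈ s, f i) n = ∑ i ∈ s, coeff b (f i) n := map_sum (coeffLin b n) f s

/-- The constant function `1`. -/
def oneL2 (b : Basis (Fin d) ℝ (Space d)) : CellL2 b :=
  (memLp_const (1 : ℂ)).toLp (fun _ => 1)

theorem mode_zero (b : Basis (Fin d) ℝ (Space d)) : mode b 0 = fun _ => 1 := by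
  funext x; simp [mode, freq_apply]

theorem oneL2_eq (b : Basis (Fin d) ℝ (Space d)) :
    oneL2 b = (memLp_mode b 0).toLp (mode b 0) := by
  simp only [oneL2, mode_zero]

theorem coeff_oneL2 (b : Basis (Fin d) ℝ (Space d)) (n : Fin d → ℤ) :
    coeff b (oneL2 b) n = if n = 0 then 1 else 0 := by
  rw [oneL2_eq, coeff_eq_inner, orthonormal_iff_ite.1 (orthonormal_mode b)]

theorem coeff_zero_eq_inner (b : Basis (Fin d) ℝ (Space d)) (f : CellL2 b) :
    coeff b f 0 = inner ℂ (oneL2 b) f := by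
  rw [oneL2_eq, coeff_eq_inner]

theorem coeff_zero_eq_integral (b : Basis (Fin d) ℝ (Space d)) (f : CellL2 b) :
    coeff b f 0 = ∫ x, f x ∂(cellMeasure b) := by
  rw [coeff_zero_eq_inner, oneL2, inner_toLp_left]
  simp

/-! ### Wave vectors -/

/-- The squared length of a wave vector. -/
def waveSq (b : Basis (Fin d) ℝ (Space d)) (n : Fin d → ℤ) : ℝ := ∑ j, wave b n j ^ 2

theorem freq_eq_sum_wave (b : Basis (Fin d) ℝ (Space d)) (n : Fin d → ℤ) (x : Space d) :
    freq b n x = ∑ j, wave b n j * x j := by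
  have hx : x = ∑ j, x j • EuclideanSpace.single j (1 : ℝ) := by
    ext i; simp [Finset.sum_apply, Pi.single_apply]
  conv_lhs => rw [hx]
  simp [wave, mul_comm]

theorem wave_zero (b : Basis (Fin d) ℝ (Space d)) (j : Fin d) : wave b 0 j = 0 := by
  simp [wave, freq_apply]

theorem waveSq_zero (b : Basis (Fin d) ℝ (Space d)) : waveSq b 0 = 0 := by
  simp [waveSq, wave_zero]

theorem waveSq_nonneg (b : Basis (Fin d) ℝ (Space d)) (n : Fin d → ℤ) : 0 ≤ waveSq b n :=
  Finset.sum_nonneg fun _ _ => sq_nonneg _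

theorem wave_sq_le (b : Basis (Fin d) ℝ (Space d)) (n : Fin d → ℤ) (j : Fin d) :
    wave b n j ^ 2 ≤ waveSq b n :=
  Finset.single_le_sum (f := fun j => wave b n j ^ 2) (fun _ _ => sq_nonneg _)
    (Finset.mem_univ j)

/-- The spectral gap of the lattice. If `n i ≠ 0`, the wave vector pairs with `b i` to `2π n i`, of
modulus at least `2π`, and Cauchy-Schwarz bounds its length from below. It makes the symbol `ξⱼ /
|ξ|²` bounded. -/
theorem exists_le_waveSq (b : Basis (Fin d) ℝ (Space d)) :
    ∃ c, 0 < c ∧ ∀ n, n ≠ 0 → c ≤ waveSq b n := by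
  set M : ℝ := 1 + ∑ i, ‖b i‖ ^ 2
  have hM : 0 < M := by positivity
  refine ⟨1 / M, by positivity, fun n hn => ?_⟩
  obtain ⟨i, hi⟩ := Function.ne_iff.1 hn
  have h1 : (freq b n (b i)) ^ 2 ≤ waveSq b n * ‖b i‖ ^ 2 := by
    rw [freq_eq_sum_wave, EuclideanSpace.norm_sq_eq]
    simp only [Real.norm_eq_abs, sq_abs]
    exact Finset.sum_mul_sq_le_sq_mul_sq _ _ _
  rw [freq_basis] at h1
  have h2 : (1 : ℝ) ≤ (n i : ℝ) ^ 2 := by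
    have : (1 : ℤ) ≤ n i ^ 2 := (sq_pos_of_ne_zero (by simpa using hi) : 0 < n i ^ 2)
    exact_mod_cast this
  have h3 : ‖b i‖ ^ 2 ≤ M := by
    have := Finset.single_le_sum (f := fun i => ‖b i‖ ^ 2) (fun _ _ => sq_nonneg _)
      (Finset.mem_univ i)
    simp only [M]; linarith
  rw [div_le_iff₀ hM]
  have h4 : waveSq b n * ‖b i‖ ^ 2 ≤ waveSq b n * M :=
    mul_le_mul_of_nonneg_left h3 (waveSq_nonneg b n)
  have h5 : (1 : ℝ) ≤ (2 * Real.pi) ^ 2 := by nlinarith [Real.pi_gt_three]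
  nlinarith

theorem waveSq_pos (b : Basis (Fin d) ℝ (Space d)) {n : Fin d → ℤ} (hn : n ≠ 0) :
    0 < waveSq b n := by
  obtain ⟨c, hc, h⟩ := exists_le_waveSq b
  exact hc.trans_le (h n hn)

theorem abs_wave_mul_le (b : Basis (Fin d) ℝ (Space d)) (n : Fin d → ℤ) (i j : Fin d) :
    |wave b n i * wave b n j| ≤ waveSq b n := by
  have h1 := wave_sq_le b n i
  have h2 := wave_sq_le b n j
  rw [abs_le]
  constructor <;> nlinarith [sq_nonneg (wave b n i - wave b n j),
    sq_nonneg (wave b n i + wave b n j)]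

/-- The second-order Riesz transforms, of symbol `ξᵢ ξⱼ / |ξ|²`. -/
def riesz (b : Basis (Fin d) ℝ (Space d)) (i j : Fin d) : CellL2 b →L[ℂ] CellL2 b :=
  -- At `n = 0` the quotient is `0 / 0 = 0`, so the operator kills constants and its output has mean
  -- zero.
  multiplier b (fun n => ((wave b n i * wave b n j / waveSq b n : ℝ) : ℂ)) ⟨1, fun n => by
    rw [Complex.norm_real, Real.norm_eq_abs, abs_div, abs_of_nonneg (waveSq_nonneg b n)]
    exact div_le_one_of_le₀ (abs_wave_mul_le b n i j) (waveSq_nonneg b n)⟩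

theorem coeff_riesz (b : Basis (Fin d) ℝ (Space d)) (i j : Fin d) (f : CellL2 b)
    (n : Fin d → ℤ) : coeff b (riesz b i j f) n =
      wave b n i * wave b n j / waveSq b n * coeff b f n := by
  rw [riesz, coeff_multiplier]; push_cast; rfl

/-- The operator of symbol `i ξⱼ / |ξ|²`. -/
def rieszPot (b : Basis (Fin d) ℝ (Space d)) (j : Fin d) : CellL2 b →L[ℂ] CellL2 b :=
  multiplier b (fun n => Complex.I * ((wave b n j / waveSq b n : ℝ) : ℂ)) (by
    obtain ⟨c, hc, h⟩ := exists_le_waveSq b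
    -- The bound comes from `|ξⱼ| ≤ 1 + ξⱼ²`, with `ξⱼ² ≤ |ξ|²` and `1 ≤ |ξ|² / c`.
    refine ⟨1 + 1 / c, fun n => ?_⟩
    rw [norm_mul, Complex.norm_I, one_mul, Complex.norm_real, Real.norm_eq_abs]
    by_cases hn : n = 0
    · subst hn; simp [wave_zero]; positivity
    · have hq := waveSq_pos b hn
      have h1 := h n hn
      rw [abs_div, abs_of_pos hq, div_le_iff₀ hq]
      have h2 : 1 ≤ 1 / c * waveSq b n := by
        rw [one_div, inv_mul_eq_div, le_div_iff₀ hc]; linarith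
      have h3 := wave_sq_le b n j
      have h4 : |wave b n j| ^ 2 ≤ waveSq b n := by rwa [sq_abs]
      nlinarith [sq_nonneg (|wave b n j| - 1)])

theorem coeff_rieszPot (b : Basis (Fin d) ℝ (Space d)) (j : Fin d) (f : CellL2 b)
    (n : Fin d → ℤ) : coeff b (rieszPot b j f) n =
      Complex.I * (wave b n j / waveSq b n) * coeff b f n := by
  rw [rieszPot, coeff_multiplier]; push_cast; rfl

/-! ### The Green operator of the reference medium -/

/-- Square-integrable tensor fields on the unit cell. -/
abbrev TensorL2 (b : Basis (Fin d) ℝ (Space d)) := Fin d → Fin d → CellL2 b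

/-- The components of a tensor field. -/
def comp (b : Basis (Fin d) ℝ (Space d)) (i j : Fin d) : TensorL2 b →L[ℂ] CellL2 b :=
  (ContinuousLinearMap.proj (R := ℂ) (φ := fun _ : Fin d => CellL2 b) j).comp
    (ContinuousLinearMap.proj (R := ℂ) (φ := fun _ : Fin d => Fin d → CellL2 b) i)

/-- `(λ₀ + μ₀) / (λ₀ + 2 μ₀)`, where `λ₀ = κ₀ - 2 μ₀ / d`. -/
def lameRatio (d : ℕ) (κ₀ μ₀ : ℝ) : ℝ :=
  (d * κ₀ + (d - 2) * μ₀) / (d * κ₀ + 2 * (d - 1) * μ₀)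

/-- The gradient of the periodic displacement that balances a polarization in the homogeneous
reference medium. -/
def polGrad (b : Basis (Fin d) ℝ (Space d)) (κ₀ μ₀ : ℝ) : TensorL2 b →L[ℂ] TensorL2 b :=
  ContinuousLinearMap.pi fun i => ContinuousLinearMap.pi fun j =>
    (-(1 / μ₀ : ℂ)) • (∑ l, (riesz b j l).comp (comp b i l) - (lameRatio d κ₀ μ₀ : ℂ) •
      (riesz b i j).comp (∑ k, ∑ l, (riesz b k l).comp (comp b k l)))

theorem polGrad_apply (b : Basis (Fin d) ℝ (Space d)) (κ₀ μ₀ : ℝ) (τ : TensorL2 b)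
    (i j : Fin d) : polGrad b κ₀ μ₀ τ i j = (-(1 / μ₀ : ℂ)) • (∑ l, riesz b j l (τ i l) -
      (lameRatio d κ₀ μ₀ : ℂ) • riesz b i j (∑ k, ∑ l, riesz b k l (τ k l))) := by
  simp [polGrad, comp]

/-- The displacement that balances a polarization in the homogeneous reference medium. -/
def polDisp (b : Basis (Fin d) ℝ (Space d)) (κ₀ μ₀ : ℝ) (τ : TensorL2 b) (i : Fin d) : CellL2 b :=
  (1 / μ₀ : ℂ) • (∑ l, rieszPot b l (τ i l) -
      (lameRatio d κ₀ μ₀ : ℂ) • rieszPot b i (∑ k, ∑ l, riesz b k l (τ k l)))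

/-- The Green operator of the reference medium. -/
def green (b : Basis (Fin d) ℝ (Space d)) (κ₀ μ₀ : ℝ) : TensorL2 b →L[ℂ] TensorL2 b :=
  ContinuousLinearMap.pi fun i => ContinuousLinearMap.pi fun j =>
    (-(1 / 2 : ℂ)) • ((comp b i j).comp (polGrad b κ₀ μ₀) + (comp b j i).comp (polGrad b κ₀ μ₀))

theorem green_apply (b : Basis (Fin d) ℝ (Space d)) (κ₀ μ₀ : ℝ) (τ : TensorL2 b)
    (i j : Fin d) : green b κ₀ μ₀ τ i j =
      (-(1 / 2 : ℂ)) • (polGrad b κ₀ μ₀ τ i j + polGrad b κ₀ μ₀ τ j i) := by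
  simp [green, comp]

/-- The coefficient at frequency `n` of the divergence of a tensor field. -/
def divCoeff (b : Basis (Fin d) ℝ (Space d)) (τ : TensorL2 b) (n : Fin d → ℤ) (i : Fin d) : ℂ :=
  ∑ j, wave b n j * coeff b (τ i j) n

theorem coeff_polGrad (b : Basis (Fin d) ℝ (Space d)) (κ₀ μ₀ : ℝ) (τ : TensorL2 b)
    (i j : Fin d) (n : Fin d → ℤ) : coeff b (polGrad b κ₀ μ₀ τ i j) n =
      -(1 / μ₀) * (wave b n j / waveSq b n * divCoeff b τ n i - lameRatio d κ₀ μ₀ *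
        (wave b n i * wave b n j / waveSq b n ^ 2) * ∑ k, wave b n k * divCoeff b τ n k) := by
  rw [polGrad_apply, coeff_smul, coeff_sub, coeff_smul, coeff_riesz, coeff_sum, coeff_sum]
  simp_rw [coeff_sum, coeff_riesz, divCoeff, Finset.mul_sum]
  congr 2
  · exact Finset.sum_congr rfl fun _ _ => by ring
  · exact Finset.sum_congr rfl fun _ _ => Finset.sum_congr rfl fun _ _ => by ring

theorem coeff_polDisp (b : Basis (Fin d) ℝ (Space d)) (κ₀ μ₀ : ℝ) (τ : TensorL2 b)
    (i : Fin d) (n : Fin d → ℤ) : coeff b (polDisp b κ₀ μ₀ τ i) n =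
      Complex.I / μ₀ * (divCoeff b τ n i / waveSq b n - lameRatio d κ₀ μ₀ *
        (wave b n i / waveSq b n ^ 2) * ∑ k, wave b n k * divCoeff b τ n k) := by
  rw [polDisp, coeff_smul, coeff_sub, coeff_smul, coeff_rieszPot, coeff_sum, coeff_sum]
  simp_rw [coeff_sum, coeff_riesz, coeff_rieszPot, divCoeff]
  rw [mul_sub, mul_sub]
  simp only [Finset.mul_sum, Finset.sum_div]
  congr 1
  · exact Finset.sum_congr rfl fun _ _ => by ring
  · exact Finset.sum_congr rfl fun _ _ => Finset.sum_congr rfl fun _ _ => by ring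

/-- Makes `polGrad` the weak gradient of `polDisp`, so that what the Green operator produces is
compatible. The signs agree through `i² = -1`. -/
theorem coeff_polGrad_eq_polDisp (b : Basis (Fin d) ℝ (Space d)) (κ₀ μ₀ : ℝ) (τ : TensorL2 b)
    (i j : Fin d) (n : Fin d → ℤ) : coeff b (polGrad b κ₀ μ₀ τ i j) n =
      Complex.I * (wave b n j * coeff b (polDisp b κ₀ μ₀ τ i) n) := by
  rw [coeff_polGrad, coeff_polDisp]
  linear_combination (-(1 / μ₀) * (wave b n j / waveSq b n * divCoeff b τ n i -
    lameRatio d κ₀ μ₀ * (wave b n i * wave b n j / waveSq b n ^ 2) *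
      ∑ k, wave b n k * divCoeff b τ n k) : ℂ) * Complex.I_mul_I

/-! ### Fields that are constant in each phase -/

theorem Geometry.measurable_phaseFun (g : Geometry d N) {β : Type*} [MeasurableSpace β]
    (s : Fin N → β) : Measurable fun x => s (g.phase x) :=
  (measurable_of_finite s).comp g.measurable_phase

theorem norm_phaseFun_mul_le (g : Geometry d N) (s : Fin N → ℝ) (x : Space d) (z : ℂ) :
    ‖(s (g.phase x) : ℂ) * z‖ ≤ ‖s‖ * ‖z‖ := by
  rw [norm_mul, Complex.norm_real]
  gcongr
  exact norm_le_pi_norm s _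

theorem memLp_phaseFun_mul (g : Geometry d N) (s : Fin N → ℝ) (f : CellL2 g.basis) :
    MemLp (fun x => (s (g.phase x) : ℂ) * f x) 2 (cellMeasure g.basis) :=
  MemLp.of_le_mul (Lp.memLp f)
    ((Complex.measurable_ofReal.comp (g.measurable_phaseFun s)).aestronglyMeasurable.mul
      (Lp.aestronglyMeasurable f))
    (Eventually.of_forall fun x => norm_phaseFun_mul_le g s x (f x))

/-- Multiplication by a field that is constant in each phase. -/
def phaseMul (g : Geometry d N) (s : Fin N → ℝ) : CellL2 g.basis →L[ℂ] CellL2 g.basis :=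
  LinearMap.mkContinuous
    { toFun := fun f => (memLp_phaseFun_mul g s f).toLp _
      map_add' := fun f h => by
        apply Lp.ext
        filter_upwards [(memLp_phaseFun_mul g s f).coeFn_toLp,
          (memLp_phaseFun_mul g s h).coeFn_toLp, (memLp_phaseFun_mul g s (f + h)).coeFn_toLp,
          Lp.coeFn_add f h, Lp.coeFn_add ((memLp_phaseFun_mul g s f).toLp _)
            ((memLp_phaseFun_mul g s h).toLp _)] with x h1 h2 h3 h4 h5
        rw [h3, h5, Pi.add_apply, h1, h2, h4, Pi.add_apply, mul_add]
      map_smul' := fun c f => by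
        apply Lp.ext
        filter_upwards [(memLp_phaseFun_mul g s f).coeFn_toLp,
          (memLp_phaseFun_mul g s (c • f)).coeFn_toLp,
          Lp.coeFn_smul c f, Lp.coeFn_smul c ((memLp_phaseFun_mul g s f).toLp _)]
          with x h1 h3 h4 h5
        rw [h3, RingHom.id_apply, h5, Pi.smul_apply, h1, h4, Pi.smul_apply, smul_eq_mul,
          smul_eq_mul]
        ring }
    ‖s‖ fun f => by
      refine Lp.norm_le_mul_norm_of_ae_le_mul ?_
      filter_upwards [(memLp_phaseFun_mul g s f).coeFn_toLp] with x h1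
      change ‖((memLp_phaseFun_mul g s f).toLp _ : CellL2 g.basis) x‖ ≤ _
      rw [h1]
      exact norm_phaseFun_mul_le g s x (f x)

theorem coeFn_phaseMul (g : Geometry d N) (s : Fin N → ℝ) (f : CellL2 g.basis) :
    phaseMul g s f =ᵐ[cellMeasure g.basis] fun x => (s (g.phase x) : ℂ) * f x :=
  (memLp_phaseFun_mul g s f).coeFn_toLp

theorem norm_phaseMul_le (g : Geometry d N) (s : Fin N → ℝ) (f : CellL2 g.basis) :
    ‖phaseMul g s f‖ ≤ ‖s‖ * ‖f‖ := by
  refine Lp.norm_le_mul_norm_of_ae_le_mul ?_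
  filter_upwards [coeFn_phaseMul g s f] with x h1
  rw [h1]
  exact norm_phaseFun_mul_le g s x (f x)

theorem phaseMul_add_left (g : Geometry d N) (s r : Fin N → ℝ) (f : CellL2 g.basis) :
    phaseMul g (s + r) f = phaseMul g s f + phaseMul g r f := by
  apply Lp.ext
  filter_upwards [coeFn_phaseMul g s f, coeFn_phaseMul g r f, coeFn_phaseMul g (s + r) f,
    Lp.coeFn_add (phaseMul g s f) (phaseMul g r f)] with x h1 h2 h3 h4
  rw [h3, h4, Pi.add_apply, Pi.add_apply, h1, h2, Complex.ofReal_add, add_mul]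

theorem phaseMul_smul_left (g : Geometry d N) (c : ℝ) (s : Fin N → ℝ) (f : CellL2 g.basis) :
    phaseMul g (c • s) f = (c : ℂ) • phaseMul g s f := by
  apply Lp.ext
  filter_upwards [coeFn_phaseMul g s f, coeFn_phaseMul g (c • s) f,
    Lp.coeFn_smul (c : ℂ) (phaseMul g s f)] with x h1 h3 h4
  rw [h3, h4, Pi.smul_apply, Pi.smul_apply, h1, smul_eq_mul, smul_eq_mul, Complex.ofReal_mul,
    mul_assoc]

theorem phaseMul_const (g : Geometry d N) (c : ℝ) (f : CellL2 g.basis) :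
    phaseMul g (fun _ => c) f = (c : ℂ) • f := by
  apply Lp.ext
  filter_upwards [coeFn_phaseMul g (fun _ => c) f, Lp.coeFn_smul (c : ℂ) f] with x h1 h2
  rw [h1, h2]; rfl

/-- The trace of a tensor field. -/
def traceL2 {b : Basis (Fin d) ℝ (Space d)} (E : TensorL2 b) : CellL2 b := ∑ a, E a a

/-- The action on strain fields of an isotropic elasticity tensor that is constant in each
phase. -/
def stiff (g : Geometry d N) (s r : Fin N → ℝ) : TensorL2 g.basis →L[ℂ] TensorL2 g.basis :=
  ContinuousLinearMap.pi fun i => ContinuousLinearMap.pi fun j =>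
    (phaseMul g s).comp ((delta i j : ℂ) • ∑ a, comp g.basis a a) +
      (phaseMul g r).comp (comp g.basis i j + comp g.basis j i -
        (2 / d * delta i j : ℂ) • ∑ a, comp g.basis a a)

theorem stiff_apply (g : Geometry d N) (s r : Fin N → ℝ) (E : TensorL2 g.basis) (i j : Fin d) :
    stiff g s r E i j = phaseMul g s ((delta i j : ℂ) • traceL2 E) +
      phaseMul g r (E i j + E j i - (2 / d * delta i j : ℂ) • traceL2 E) := by
  have hs : (∑ a, comp g.basis a a) E = traceL2 E := by simp [comp, traceL2]
  rw [← hs]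
  rfl

theorem stiff_add (g : Geometry d N) (s r s' r' : Fin N → ℝ) (E : TensorL2 g.basis) :
    stiff g (s + s') (r + r') E = stiff g s r E + stiff g s' r' E := by
  funext i j
  simp only [stiff_apply, phaseMul_add_left, Pi.add_apply]
  abel

theorem stiff_const_apply (g : Geometry d N) (κ μ : ℝ) (E : TensorL2 g.basis) (i j : Fin d) :
    stiff g (fun _ => κ) (fun _ => μ) E i j = (κ : ℂ) • ((delta i j : ℂ) • traceL2 E) +
      (μ : ℂ) • (E i j + E j i - (2 / d * delta i j : ℂ) • traceL2 E) := by
  rw [stiff_apply, phaseMul_const, phaseMul_const]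

theorem abs_delta_le {d : ℕ} (i j : Fin d) : ‖(delta i j : ℂ)‖ ≤ 1 := by
  unfold delta; split_ifs <;> simp

theorem norm_traceL2_le {b : Basis (Fin d) ℝ (Space d)} (E : TensorL2 b) :
    ‖traceL2 E‖ ≤ d * ‖E‖ := by
  refine (norm_sum_le _ _).trans ?_
  refine (Finset.sum_le_sum fun a _ => (norm_le_pi_norm (E a) a).trans (norm_le_pi_norm E a)).trans
    ?_
  simp

/-- The factor `d` bounds the trace. The factor `4` adds the two transposed entries and the trace
correction, whose norm is at most `2 ‖E‖`. -/
theorem norm_stiff_le (g : Geometry d N) (s r : Fin N → ℝ) (E : TensorL2 g.basis) :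
    ‖stiff g s r E‖ ≤ (d * ‖s‖ + 4 * ‖r‖) * ‖E‖ := by
  have hE : ∀ i j, ‖E i j‖ ≤ ‖E‖ := fun i j =>
    (norm_le_pi_norm (E i) j).trans (norm_le_pi_norm E i)
  refine (pi_norm_le_iff_of_nonneg (by positivity)).2 fun i =>
    (pi_norm_le_iff_of_nonneg (by positivity)).2 fun j => ?_
  have hd : (0 : ℝ) < d := by exact_mod_cast i.pos
  rw [stiff_apply, add_mul]
  refine (norm_add_le _ _).trans (add_le_add ?_ ?_)
  · refine (norm_phaseMul_le g s _).trans ?_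
    rw [norm_smul, mul_comm (d : ℝ), mul_assoc]
    refine mul_le_mul_of_nonneg_left ?_ (norm_nonneg s)
    calc ‖(delta i j : ℂ)‖ * ‖traceL2 E‖ ≤ 1 * (d * ‖E‖) := by
          gcongr
          · exact abs_delta_le i j
          · exact norm_traceL2_le E
      _ = _ := one_mul _
  · refine (norm_phaseMul_le g r _).trans ?_
    rw [mul_comm (4 : ℝ), mul_assoc]
    gcongr
    refine (norm_sub_le _ _).trans ?_
    have h1 := norm_add_le (E i j) (E j i)
    have h2 : ‖(2 / d * delta i j : ℂ) • traceL2 E‖ ≤ 2 * ‖E‖ := by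
      rw [norm_smul, norm_mul, norm_div]
      simp only [Complex.norm_ofNat, Complex.norm_natCast]
      calc 2 / (d : ℝ) * ‖(delta i j : ℂ)‖ * ‖traceL2 E‖ ≤ 2 / (d : ℝ) * 1 * (d * ‖E‖) := by
            gcongr
            · exact abs_delta_le i j
            · exact norm_traceL2_le E
        _ = _ := by field_simp
    linarith [hE i j, hE j i]

/-! ### Pointwise tensor algebra -/

theorem sum_delta_left {d : ℕ} (i : Fin d) (f : Fin d → ℝ) : ∑ k, delta i k * f k = f i := by
  simp [delta]

theorem contract_tensorJ (A : Tensor2 d) (i j : Fin d) :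
    contract (tensorJ d) A i j = delta i j * A.trace / d := by
  simp only [contract, tensorJ, Matrix.of_apply, Matrix.trace, Matrix.diag_apply]
  have : ∀ k, ∑ l, delta i j * delta k l / (d : ℝ) * A k l = delta i j / d * A k k := by
    intro k
    rw [← sum_delta_left k (fun l => A k l), Finset.mul_sum]
    exact Finset.sum_congr rfl fun l _ => by ring
  simp_rw [this]
  rw [← Finset.mul_sum]
  ring

theorem contract_tensorI (A : Tensor2 d) (i j : Fin d) :
    contract (tensorI d) A i j = (A i j + A j i) / 2 := by
  simp only [contract, tensorI, Matrix.of_apply]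
  have : ∀ k, ∑ l, (delta i k * delta j l + delta i l * delta j k) / 2 * A k l =
      (delta i k * A k j + delta j k * A k i) / 2 := by
    intro k
    rw [← sum_delta_left j (fun l => A k l), ← sum_delta_left i (fun l => A k l),
      Finset.mul_sum, Finset.mul_sum, ← Finset.sum_add_distrib, Finset.sum_div]
    exact Finset.sum_congr rfl fun l _ => by ring
  simp_rw [this]
  rw [← Finset.sum_div, Finset.sum_add_distrib, sum_delta_left i (fun k => A k j),
    sum_delta_left j (fun k => A k i)]

theorem contract_tensorK (A : Tensor2 d) (i j : Fin d) :
    contract (tensorK d) A i j = (A i j + A j i) / 2 - delta i j * A.trace / d := by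
  rw [← contract_tensorI, ← contract_tensorJ]
  simp only [contract, tensorK, Matrix.of_apply, Pi.sub_apply, sub_mul, Finset.sum_sub_distrib]

theorem contract_isoElasticity (κ μ : ℝ) (A : Tensor2 d) (i j : Fin d) :
    contract (isoElasticity d κ μ) A i j = κ * (delta i j * A.trace) +
      μ * (A i j + A j i - 2 / d * delta i j * A.trace) := by
  have hd : (d : ℝ) ≠ 0 := by exact_mod_cast i.pos.ne'
  have h : contract (isoElasticity d κ μ) A i j =
      d * κ * contract (tensorJ d) A i j + 2 * μ * contract (tensorK d) A i j := by
    simp only [contract, isoElasticity, Matrix.of_apply, Pi.add_apply, Pi.smul_apply, smul_eq_mul,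
      add_mul, Finset.sum_add_distrib, Finset.mul_sum, mul_assoc]
  rw [h, contract_tensorJ, contract_tensorK]
  field_simp

theorem delta_comm {d : ℕ} (i j : Fin d) : delta i j = delta j i := by
  simp [delta, eq_comm]

theorem contract_isoElasticity_symm (κ μ : ℝ) (A : Tensor2 d) (i j : Fin d) :
    contract (isoElasticity d κ μ) A i j = contract (isoElasticity d κ μ) A j i := by
  rw [contract_isoElasticity, contract_isoElasticity, delta_comm i j]
  ring

theorem inner2_symPart {S A : Tensor2 d} (hS : ∀ i j, S i j = S j i) :
    inner2 S (symPart A) = ∑ i, ∑ j, S i j * A i j := by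
  have h : ∑ i, ∑ j, S i j * A j i = ∑ i, ∑ j, S i j * A i j := by
    rw [Finset.sum_comm]
    exact Finset.sum_congr rfl fun i _ => Finset.sum_congr rfl fun j _ => by rw [hS]
  simp only [inner2, symPart, Matrix.smul_apply, Matrix.add_apply, Matrix.transpose_apply,
    smul_eq_mul]
  have h2 : ∀ i j, S i j * (2⁻¹ * (A i j + A j i)) =
      2⁻¹ * (S i j * A i j) + 2⁻¹ * (S i j * A j i) := fun i j => by ring
  simp_rw [h2, Finset.sum_add_distrib, ← Finset.mul_sum, h]
  ring

/-! ### Real fields and their Fourier coefficients -/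

/-- A real tensor field as an element of `L²`. -/
def tensorToLp {b : Basis (Fin d) ℝ (Space d)} {e : Space d → Tensor2 d}
    (h : ∀ i j, MemLp (fun x => (e x i j : ℂ)) 2 (cellMeasure b)) : TensorL2 b :=
  fun i j => (h i j).toLp _

theorem coeFn_stiff_tensorToLp (g : Geometry d N) (m : PhaseModuli N) {e : Space d → Tensor2 d}
    (h : ∀ i j, MemLp (fun x => (e x i j : ℂ)) 2 (cellMeasure g.basis)) (i j : Fin d) :
    stiff g m.κ m.μ (tensorToLp h) i j =ᵐ[cellMeasure g.basis]
      fun x => (contract (g.elasticity m x) (e x) i j : ℂ) := by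
  have htr : traceL2 (tensorToLp h) =ᵐ[cellMeasure g.basis] fun x => ((e x).trace : ℂ) := by
    have h1 := Lp.coeFn_fun_finsetSum (p := 2) (μ := cellMeasure g.basis) Finset.univ
      (fun a => tensorToLp h a a)
    have h2 : ∀ᵐ x ∂(cellMeasure g.basis), ∀ a, tensorToLp h a a x = (e x a a : ℂ) :=
      ae_all_iff.2 fun a => (h a a).coeFn_toLp
    filter_upwards [h1, h2] with x h1 h2
    rw [traceL2, h1]
    simp [h2, Matrix.trace]
  rw [stiff_apply]
  set T := traceL2 (tensorToLp h) with hT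
  set A := tensorToLp h i j + tensorToLp h j i
  filter_upwards [htr, Lp.coeFn_add (phaseMul g m.κ ((delta i j : ℂ) • T))
      (phaseMul g m.μ (A - (2 / d * delta i j : ℂ) • T)),
    coeFn_phaseMul g m.κ ((delta i j : ℂ) • T),
    coeFn_phaseMul g m.μ (A - (2 / d * delta i j : ℂ) • T),
    Lp.coeFn_smul (delta i j : ℂ) T, Lp.coeFn_smul (2 / d * delta i j : ℂ) T,
    Lp.coeFn_sub A ((2 / d * delta i j : ℂ) • T),
    Lp.coeFn_add (tensorToLp h i j) (tensorToLp h j i), (h i j).coeFn_toLp, (h j i).coeFn_toLp]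
    with x h1 h2 h3 h4 h5 h6 h7 h8 h9 h10
  rw [h2, Pi.add_apply, h3, h4, h5, h7, Pi.sub_apply, h6, h8]
  simp only [Pi.smul_apply, Pi.add_apply, smul_eq_mul, h1]
  change _ + _ * ((h i j).toLp _ x + (h j i).toLp _ x - _) = _
  rw [h9, h10, Geometry.elasticity, contract_isoElasticity]
  simp only [Geometry.bulk, Geometry.shear]
  push_cast
  ring

theorem setIntegral_cell_eq_zero_iff (b : Basis (Fin d) ℝ (Space d)) (f : Space d → ℝ) :
    ∫ x in ZSpan.fundamentalDomain b, f x = 0 ↔ ∫ x, (f x : ℂ) ∂(cellMeasure b) = 0 := by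
  rw [integral_complex_ofReal, Complex.ofReal_eq_zero, integral_cellMeasure, smul_eq_mul, mul_eq_zero,
    inv_eq_zero, ENNReal.toReal_eq_zero_iff]
  simp [volume_fundamentalDomain_ne_zero b, volume_fundamentalDomain_ne_top b]

/-- The case of `weak_divergence_iff` where the flux has `u` as its `j`-th component and zero
elsewhere. -/
theorem weak_grad_iff (b : Basis (Fin d) ℝ (Space d)) {u G : Space d → ℝ}
    (hu : MemLp (fun x => (u x : ℂ)) 2 (cellMeasure b))
    (hG : MemLp (fun x => (G x : ℂ)) 2 (cellMeasure b)) (j : Fin d) :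
    (∀ φ : Space d → ℝ, ContDiff ℝ ∞ φ → (∀ i x, φ (x + b i) = φ x) →
      ∫ x in ZSpan.fundamentalDomain b, u x * partialDeriv j φ x =
        -∫ x in ZSpan.fundamentalDomain b, G x * φ x) ↔
    ∀ n, coeff b (hG.toLp _) n = Complex.I * (wave b n j * coeff b (hu.toLp _) n) := by
  have key := weak_divergence_iff b (fun k => if k = j then hu.toLp _ else 0) (hG.toLp _)
  have e1 : ∀ n, ∑ k, (wave b n k : ℂ) *
      coeff b (if k = j then hu.toLp (fun x => (u x : ℂ)) else 0) n =
      wave b n j * coeff b (hu.toLp _) n := by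
    intro n
    rw [Finset.sum_eq_single j]
    · simp
    · intro k _ hk; simp [hk, coeff_zero]
    · simp
  simp only [e1] at key
  rw [← key]
  refine forall_congr' fun φ => forall_congr' fun hφ => forall_congr' fun hp => ?_
  rw [Finset.sum_eq_single j]
  rotate_left
  · intro k _ hk
    rw [← integral_zero (Space d) ℂ]
    refine integral_congr_ae ?_
    simp only [hk, if_false]
    filter_upwards [Lp.coeFn_zero ℂ 2 (cellMeasure b)] with x hx
    rw [hx]; simp
  · simp
  have c1 : ∫ x, (if j = j then hu.toLp (fun x => (u x : ℂ)) else 0 : CellL2 b) x *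
      (partialDeriv j φ x : ℂ) ∂(cellMeasure b) =
      ((∫ x, u x * partialDeriv j φ x ∂(cellMeasure b) : ℝ) : ℂ) := by
    rw [← integral_complex_ofReal]
    refine integral_congr_ae ?_
    simp only [if_true]
    filter_upwards [hu.coeFn_toLp] with x hx
    rw [hx]; push_cast; rfl
  have c2 : ∫ x, (hG.toLp (fun x => (G x : ℂ)) : CellL2 b) x *
      (φ x : ℂ) ∂(cellMeasure b) = ((∫ x, G x * φ x ∂(cellMeasure b) : ℝ) : ℂ) := by
    rw [← integral_complex_ofReal]
    refine integral_congr_ae ?_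
    filter_upwards [hG.coeFn_toLp] with x hx
    rw [hx]; push_cast; rfl
  rw [c1, c2, ← Complex.ofReal_add, Complex.ofReal_eq_zero, integral_cellMeasure,
    integral_cellMeasure, ← smul_add, smul_eq_zero, inv_eq_zero, ENNReal.toReal_eq_zero_iff]
  simp [volume_fundamentalDomain_ne_zero b, volume_fundamentalDomain_ne_top b,
    eq_neg_iff_add_eq_zero]

/-- The stress is symmetric, so the symmetrized gradient of a test field may be replaced by the full
one. The equation then splits into one scalar divergence equation per row, each isolated by test
fields directed along a coordinate axis. -/
theorem equilibrium_iff (g : Geometry d N) (m : PhaseModuli N) {e : Space d → Tensor2 d}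
    (h : ∀ i j, MemLp (fun x => (e x i j : ℂ)) 2 (cellMeasure g.basis)) :
    (∀ v : Space d → Space d, ContDiff ℝ ∞ v → g.IsPeriodic v →
      ∫ x in g.cell, inner2 (contract (g.elasticity m x) (e x)) (symPart (gradient v x)) = 0) ↔
    ∀ n i, divCoeff g.basis (stiff g m.κ m.μ (tensorToLp h)) n i = 0 := by
  set b := g.basis with hb
  set S := stiff g m.κ m.μ (tensorToLp h) with hS
  have hpt : ∀ (v : Space d → Space d) x,
      inner2 (contract (g.elasticity m x) (e x)) (symPart (gradient v x)) =
      ∑ i, ∑ j, contract (g.elasticity m x) (e x) i j * partialDeriv j (fun y => v y i) x :=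
    fun v x => inner2_symPart fun i j => contract_isoElasticity_symm _ _ _ i j
  have hint : ∀ (φ : Space d → ℝ), ContDiff ℝ ∞ φ → ∀ i j,
      Integrable (fun x => S i j x * (partialDeriv j φ x : ℂ)) (cellMeasure b) :=
    fun φ hφ i j => (Lp.memLp (S i j)).integrable_mul
      (memLp_ofReal_of_continuous b (continuous_partialDeriv hφ j))
  have hcomp : ∀ (v : Space d → Space d), ContDiff ℝ ∞ v → ∀ i, ContDiff ℝ ∞ fun y => v y i :=
    fun v hv i => (EuclideanSpace.proj (𝕜 := ℝ) i).contDiff.comp hv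
  have hI : ∀ (v : Space d → Space d), ContDiff ℝ ∞ v →
      ∫ x, ((inner2 (contract (g.elasticity m x) (e x)) (symPart (gradient v x)) : ℝ) : ℂ)
        ∂(cellMeasure b) =
      ∑ i, ∑ j, ∫ x, S i j x * (partialDeriv j (fun y => v y i) x : ℂ) ∂(cellMeasure b) := by
    intro v hv
    simp_rw [hpt]
    rw [← Finset.sum_congr rfl fun i _ => integral_finsetSum _ fun j _ =>
      hint _ (hcomp v hv i) i j, ← integral_finsetSum _ fun i _ =>
        integrable_finsetSum _ fun j _ => hint _ (hcomp v hv i) i j]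
    refine integral_congr_ae ?_
    have hae : ∀ᵐ x ∂(cellMeasure b), ∀ i j, S i j x =
        (contract (g.elasticity m x) (e x) i j : ℂ) :=
      ae_all_iff.2 fun i => ae_all_iff.2 fun j => coeFn_stiff_tensorToLp g m h i j
    filter_upwards [hae] with x hx
    simp [hx]
  have hdiv : ∀ i, (∀ n, divCoeff b S n i = 0) ↔ (∀ φ : Space d → ℝ, ContDiff ℝ ∞ φ →
      (∀ i x, φ (x + b i) = φ x) →
      ∑ j, ∫ x, S i j x * (partialDeriv j φ x : ℂ) ∂(cellMeasure b) = 0) := by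
    intro i
    have key := weak_divergence_iff b (S i) 0
    have h0 : ∀ φ : Space d → ℝ, ∫ x, (0 : CellL2 b) x * (φ x : ℂ) ∂(cellMeasure b) = 0 := by
      intro φ
      rw [← integral_zero (Space d) ℂ]
      refine integral_congr_ae ?_
      filter_upwards [Lp.coeFn_zero ℂ 2 (cellMeasure b)] with x hx
      rw [hx]; simp
    simp only [h0, add_zero, coeff_zero] at key
    rw [key]
    refine forall_congr' fun n => ?_
    rw [divCoeff]
    constructor
    · intro h; rw [h, mul_zero]
    · intro h; exact (mul_eq_zero.1 h.symm).resolve_left Complex.I_ne_zero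
  constructor
  · intro H n i
    revert n
    rw [hdiv]
    intro φ hφ hp
    have hv : ContDiff ℝ ∞ fun x => φ x • (EuclideanSpace.single i (1 : ℝ) : Space d) :=
      hφ.smul contDiff_const
    have h1 := (setIntegral_cell_eq_zero_iff b _).1 (H _ hv fun k x => by simp only [← hb, hp])
    rw [hI _ hv, Finset.sum_eq_single i] at h1
    · simpa using h1
    · intro k _ hk
      refine Finset.sum_eq_zero fun j _ => ?_
      simp [hk, partialDeriv]
    · simp
  · intro H v hv hp
    refine (setIntegral_cell_eq_zero_iff b _).2 ?_
    rw [hI v hv]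
    refine Finset.sum_eq_zero fun i _ => ?_
    exact (hdiv i).1 (fun n => H n i) _ (hcomp v hv i) fun k x => by
      have := hp k x
      simp only [← hb] at this
      rw [this]

/-! ### The periodic elasticity problem in Fourier space -/

theorem ofReal_waveSq (b : Basis (Fin d) ℝ (Space d)) (n : Fin d → ℤ) :
    (waveSq b n : ℂ) = ∑ j, (wave b n j : ℂ) * wave b n j := by
  simp [waveSq, sq]

theorem sum_delta_left_complex {d : ℕ} (i : Fin d) (f : Fin d → ℂ) :
    ∑ k, (delta i k : ℂ) * f k = f i := by
  have h : ∀ k, (delta i k : ℂ) * f k = if i = k then f k else 0 := by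
    intro k; unfold delta; split_ifs <;> simp
  simp [h]

/-- The divergence of the stress in the homogeneous reference medium, in terms of the
displacement. -/
theorem divCoeff_stiff_const (g : Geometry d N) (κ μ : ℝ) (E : TensorL2 g.basis)
    (u : Fin d → ℂ) (n : Fin d → ℤ)
    (hE : ∀ i j, coeff g.basis (E i j) n =
      Complex.I / 2 * (wave g.basis n j * u i + wave g.basis n i * u j)) (i : Fin d) :
    divCoeff g.basis (stiff g (fun _ => κ) (fun _ => μ) E) n i =
      Complex.I * ((κ - 2 / d * μ + μ) * (∑ k, wave g.basis n k * u k) * wave g.basis n i +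
        μ * waveSq g.basis n * u i) := by
  set p := ∑ k, (wave g.basis n k : ℂ) * u k with hp
  have htr : coeff g.basis (traceL2 E) n = Complex.I * p := by
    rw [traceL2, coeff_sum, hp, Finset.mul_sum]
    refine Finset.sum_congr rfl fun k _ => ?_
    rw [hE]; ring
  have h1 : ∀ j, (wave g.basis n j : ℂ) * coeff g.basis (stiff g (fun _ => κ) (fun _ => μ) E i j) n =
      (delta i j : ℂ) * ((κ - 2 / d * μ) * Complex.I * p * wave g.basis n j) +
      (μ * Complex.I * u i * (wave g.basis n j * wave g.basis n j) + μ * Complex.I * wave g.basis n i * (wave g.basis n j * u j)) := by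
    intro j
    rw [stiff_const_apply, coeff_add, coeff_smul, coeff_smul, coeff_smul, coeff_sub, coeff_add,
      coeff_smul, htr, hE, hE]
    ring
  rw [divCoeff]
  rw [Finset.sum_congr rfl fun j _ => h1 j, Finset.sum_add_distrib, Finset.sum_add_distrib,
    sum_delta_left_complex, ← Finset.mul_sum, ← Finset.mul_sum, ← ofReal_waveSq, ← hp]
  ring

theorem lame_denom_pos {d : ℕ} (hd : 2 ≤ d) {κ₀ μ₀ : ℝ} (hκ : 0 < κ₀) (hμ : 0 < μ₀) :
    0 < d * κ₀ + 2 * ((d : ℝ) - 1) * μ₀ := by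
  have : (2 : ℝ) ≤ d := by exact_mod_cast hd
  have : 0 < (d : ℝ) - 1 := by linarith
  positivity

/-- With the Lamé coefficient `λ₀ = κ₀ - 2 μ₀ / d`, this is `ρ (λ₀ + 2 μ₀) = λ₀ + μ₀`, the form
needed to invert the acoustic tensor. -/
theorem ofReal_lameRatio {d : ℕ} (hd : 2 ≤ d) {κ₀ μ₀ : ℝ} (hκ : 0 < κ₀) (hμ : 0 < μ₀) :
    (lameRatio d κ₀ μ₀ : ℂ) * (κ₀ - 2 / d * μ₀ + μ₀ + μ₀) = κ₀ - 2 / d * μ₀ + μ₀ := by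
  have h := (lame_denom_pos hd hκ hμ).ne'
  have hd0 : (d : ℝ) ≠ 0 := by positivity
  have : lameRatio d κ₀ μ₀ * (κ₀ - 2 / d * μ₀ + μ₀ + μ₀) = κ₀ - 2 / d * μ₀ + μ₀ := by
    rw [lameRatio, div_mul_eq_mul_div, div_eq_iff h]
    field_simp
    ring
  have h2 := congrArg Complex.ofReal this
  push_cast at h2
  exact h2

theorem lame_ne_zero {d : ℕ} (hd : 2 ≤ d) {κ₀ μ₀ : ℝ} (hκ : 0 < κ₀) (hμ : 0 < μ₀) :
    (κ₀ - 2 / d * μ₀ + μ₀ + μ₀ : ℂ) ≠ 0 := by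
  have h := lame_denom_pos hd hκ hμ
  have hd0 : (0 : ℝ) < d := by positivity
  have : κ₀ - 2 / d * μ₀ + μ₀ + μ₀ ≠ 0 := by
    have h2 : κ₀ - 2 / d * μ₀ + μ₀ + μ₀ = (d * κ₀ + 2 * ((d : ℝ) - 1) * μ₀) / d := by
      field_simp; ring
    rw [h2]; positivity
  have h3 := Complex.ofReal_ne_zero.2 this
  push_cast at h3
  exact h3

/-- A displacement that balances a polarization is the one given by the Green operator. -/
theorem coeff_polGrad_of_balance (hd : 2 ≤ d) (b : Basis (Fin d) ℝ (Space d)) {κ₀ μ₀ : ℝ}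
    (hκ : 0 < κ₀) (hμ : 0 < μ₀) (τ : TensorL2 b) (u : Fin d → ℂ) (n : Fin d → ℤ)
    (H : ∀ i, Complex.I * ((κ₀ - 2 / d * μ₀ + μ₀) * (∑ k, wave b n k * u k) * wave b n i +
        μ₀ * waveSq b n * u i) + divCoeff b τ n i = 0) (i j : Fin d) :
    Complex.I * (wave b n j * u i) = coeff b (polGrad b κ₀ μ₀ τ i j) n := by
  rw [coeff_polGrad]
  by_cases hn : n = 0
  · subst hn; simp [wave_zero]
  set q : ℂ := (waveSq b n : ℂ) with hq
  have hq0 : q ≠ 0 := by simpa [hq] using (waveSq_pos b hn).ne'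
  set p := ∑ k, (wave b n k : ℂ) * u k with hp
  set T := ∑ k, (wave b n k : ℂ) * divCoeff b τ n k with hT
  set lam : ℂ := κ₀ - 2 / d * μ₀ + μ₀ with hlam
  have hμ0 : (μ₀ : ℂ) ≠ 0 := by exact_mod_cast hμ.ne'
  have hρ : (lameRatio d κ₀ μ₀ : ℂ) * (lam + μ₀) = lam := ofReal_lameRatio hd hκ hμ
  have hl : lam + μ₀ ≠ 0 := lame_ne_zero hd hκ hμ
  -- Contracting the balance equation with the wave vector determines the longitudinal part `p = ξ ·
  -- u`. The equation for each component then gives `u i`.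
  have h1 : Complex.I * ((lam + μ₀) * p * q) + T = 0 := by
    have h2 : ∑ k, (wave b n k : ℂ) * (Complex.I * (lam * p * wave b n k + μ₀ * q * u k) +
        divCoeff b τ n k) = 0 := Finset.sum_eq_zero fun k _ => by rw [H k, mul_zero]
    have h3 : ∀ k, (wave b n k : ℂ) * (Complex.I * (lam * p * wave b n k + μ₀ * q * u k) +
        divCoeff b τ n k) = Complex.I * lam * p * (wave b n k * wave b n k) +
          Complex.I * μ₀ * q * (wave b n k * u k) + wave b n k * divCoeff b τ n k :=
      fun k => by ring
    simp_rw [h3] at h2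
    rw [Finset.sum_add_distrib, Finset.sum_add_distrib, ← Finset.mul_sum, ← Finset.mul_sum,
      ← ofReal_waveSq, ← hp, ← hT, ← hq] at h2
    linear_combination h2
  have hρ' : (lameRatio d κ₀ μ₀ : ℂ) = lam / (lam + μ₀) := by rw [eq_div_iff hl, hρ]
  have hT' : T = -(Complex.I * ((lam + μ₀) * p * q)) := by linear_combination h1
  have hi : divCoeff b τ n i = -(Complex.I * (lam * p * wave b n i + μ₀ * q * u i)) := by
    linear_combination H i
  rw [hρ', hT', hi]
  field_simp
  ring

/-- The displacement given by the Green operator balances the polarization. -/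
theorem balance_polDisp (hd : 2 ≤ d) (b : Basis (Fin d) ℝ (Space d)) {κ₀ μ₀ : ℝ}
    (hκ : 0 < κ₀) (hμ : 0 < μ₀) (τ : TensorL2 b) (n : Fin d → ℤ) (i : Fin d) :
    Complex.I * ((κ₀ - 2 / d * μ₀ + μ₀) *
      (∑ k, wave b n k * coeff b (polDisp b κ₀ μ₀ τ k) n) * wave b n i +
        μ₀ * waveSq b n * coeff b (polDisp b κ₀ μ₀ τ i) n) + divCoeff b τ n i = 0 := by
  by_cases hn : n = 0
  · subst hn; simp [wave_zero, divCoeff, waveSq_zero]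
  simp_rw [coeff_polDisp]
  set q : ℂ := (waveSq b n : ℂ) with hq
  have hq0 : q ≠ 0 := by simpa [hq] using (waveSq_pos b hn).ne'
  set T := ∑ k, (wave b n k : ℂ) * divCoeff b τ n k with hT
  set lam : ℂ := κ₀ - 2 / d * μ₀ + μ₀ with hlam
  have hμ0 : (μ₀ : ℂ) ≠ 0 := by exact_mod_cast hμ.ne'
  have hρ : (lameRatio d κ₀ μ₀ : ℂ) * (lam + μ₀) = lam := ofReal_lameRatio hd hκ hμ
  have hl : lam + μ₀ ≠ 0 := lame_ne_zero hd hκ hμ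
  have hρ' : (lameRatio d κ₀ μ₀ : ℂ) = lam / (lam + μ₀) := by rw [eq_div_iff hl, hρ]
  have h1 : ∑ k, (wave b n k : ℂ) * (Complex.I / μ₀ * (divCoeff b τ n k / q -
      lameRatio d κ₀ μ₀ * (wave b n k / q ^ 2) * T)) =
      Complex.I / μ₀ * (T / q - lameRatio d κ₀ μ₀ * T / q) := by
    have h3 : ∀ k, (wave b n k : ℂ) * (Complex.I / μ₀ * (divCoeff b τ n k / q -
        lameRatio d κ₀ μ₀ * (wave b n k / q ^ 2) * T)) =
        Complex.I / μ₀ / q * (wave b n k * divCoeff b τ n k) -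
        Complex.I / μ₀ * lameRatio d κ₀ μ₀ * T / q ^ 2 * (wave b n k * wave b n k) :=
      fun k => by ring
    simp_rw [h3]
    rw [Finset.sum_sub_distrib, ← Finset.mul_sum, ← Finset.mul_sum, ← ofReal_waveSq, ← hT, ← hq]
    field_simp
  rw [h1, hρ']
  field_simp
  linear_combination (μ₀ * q * (lam + μ₀) * divCoeff b τ n i) * Complex.I_mul_I

/-- A constant tensor field. -/
def constL2 (b : Basis (Fin d) ℝ (Space d)) (e : Tensor2 d) : TensorL2 b :=
  fun i j => (e i j : ℂ) • oneL2 b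

theorem coeff_constL2 (b : Basis (Fin d) ℝ (Space d)) (e : Tensor2 d) (i j : Fin d)
    {n : Fin d → ℤ} (hn : n ≠ 0) : coeff b (constL2 b e i j) n = 0 := by
  rw [constL2, coeff_smul, coeff_oneL2, if_neg hn, mul_zero]

theorem divCoeff_add (b : Basis (Fin d) ℝ (Space d)) (σ τ : TensorL2 b) (n : Fin d → ℤ)
    (i : Fin d) : divCoeff b (σ + τ) n i = divCoeff b σ n i + divCoeff b τ n i := by
  simp only [divCoeff, Pi.add_apply, coeff_add, mul_add, Finset.sum_add_distrib]

/-- The stress polarization operator `δL` with respect to the reference medium. -/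
def contrastOp (g : Geometry d N) (κ₀ μ₀ : ℝ) (m : PhaseModuli N) :
    TensorL2 g.basis →L[ℂ] TensorL2 g.basis :=
  stiff g (fun φ => m.κ φ - κ₀) (fun φ => m.μ φ - μ₀)

theorem stiff_eq_add_contrastOp (g : Geometry d N) (κ₀ μ₀ : ℝ) (m : PhaseModuli N)
    (E : TensorL2 g.basis) : stiff g m.κ m.μ E =
      stiff g (fun _ => κ₀) (fun _ => μ₀) E + contrastOp g κ₀ μ₀ m E := by
  rw [contrastOp, ← stiff_add]
  congr 2
  · funext φ; simp
  · funext φ; simp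

theorem ae_cellMeasure_of_ae (b : Basis (Fin d) ℝ (Space d)) {p : Space d → Prop}
    (h : ∀ᵐ x, p x) : ∀ᵐ x ∂(cellMeasure b), p x :=
  Measure.ae_smul_measure (ae_restrict_of_ae h) _

theorem memLp_cellMeasure (b : Basis (Fin d) ℝ (Space d)) {f : Space d → ℝ}
    (h : MemLp f 2 (volume.restrict (ZSpan.fundamentalDomain b))) :
    MemLp (fun x => (f x : ℂ)) 2 (cellMeasure b) :=
  (h.smul_measure (ENNReal.inv_ne_top.2 (volume_fundamentalDomain_ne_zero b))).ofReal

theorem memLp_of_memLp_cellMeasure (b : Basis (Fin d) ℝ (Space d)) {f : Space d → ℝ}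
    (h : MemLp f 2 (cellMeasure b)) :
    MemLp f 2 (volume.restrict (ZSpan.fundamentalDomain b)) := by
  have h1 := h.smul_measure (volume_fundamentalDomain_ne_top b)
  rwa [cellMeasure, smul_smul, ENNReal.mul_inv_cancel (volume_fundamentalDomain_ne_zero b)
    (volume_fundamentalDomain_ne_top b), one_smul] at h1

theorem memLp_strain (g : Geometry d N) {ebar : Tensor2 d} {G ε : Space d → Tensor2 d}
    (hG : ∀ i j, MemLp (fun x => (G x i j : ℂ)) 2 (cellMeasure g.basis))
    (hε : ∀ᵐ x ∂(cellMeasure g.basis), ε x = ebar + symPart (G x)) (i j : Fin d) :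
    MemLp (fun x => (ε x i j : ℂ)) 2 (cellMeasure g.basis) := by
  have h1 : MemLp (fun x => (ebar i j : ℂ) + (2⁻¹ : ℂ) • ((G x i j : ℂ) + (G x j i : ℂ))) 2
      (cellMeasure g.basis) :=
    (memLp_const (ebar i j : ℂ)).add (((hG i j).add (hG j i)).const_smul (2⁻¹ : ℂ))
  refine h1.ae_eq ?_
  filter_upwards [hε] with x hx
  rw [hx]
  simp [symPart]
  ring

theorem tensorToLp_eq (g : Geometry d N) {ebar : Tensor2 d} {G ε : Space d → Tensor2 d}
    (hG : ∀ i j, MemLp (fun x => (G x i j : ℂ)) 2 (cellMeasure g.basis))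
    (hE : ∀ i j, MemLp (fun x => (ε x i j : ℂ)) 2 (cellMeasure g.basis))
    (hε : ∀ᵐ x ∂(cellMeasure g.basis), ε x = ebar + symPart (G x)) (i j : Fin d) :
    tensorToLp hE i j = constL2 g.basis ebar i j +
      (2⁻¹ : ℂ) • (tensorToLp hG i j + tensorToLp hG j i) := by
  apply Lp.ext
  filter_upwards [hε, (hE i j).coeFn_toLp, (hG i j).coeFn_toLp, (hG j i).coeFn_toLp,
    Lp.coeFn_add (constL2 g.basis ebar i j) ((2⁻¹ : ℂ) • (tensorToLp hG i j + tensorToLp hG j i)),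
    Lp.coeFn_smul (2⁻¹ : ℂ) (tensorToLp hG i j + tensorToLp hG j i),
    Lp.coeFn_add (tensorToLp hG i j) (tensorToLp hG j i),
    Lp.coeFn_smul (ebar i j : ℂ) (oneL2 g.basis),
    (memLp_const (1 : ℂ)).coeFn_toLp (μ := cellMeasure g.basis) (p := 2)]
    with x h0 h1 h2 h3 h4 h5 h6 h7 h8
  rw [h4, Pi.add_apply, h5, Pi.smul_apply, h6, Pi.add_apply, constL2, h7, Pi.smul_apply, oneL2, h8]
  simp only [tensorToLp]
  rw [h1, h2, h3, h0]
  simp [symPart]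
  ring

/-- The Lippmann-Schwinger equation. -/
theorem IsStrainField.lippmannSchwinger (hd : 2 ≤ d) {g : Geometry d N} {κ₀ μ₀ : ℝ}
    (hκ : 0 < κ₀) (hμ : 0 < μ₀) {m : PhaseModuli N} {ebar : Tensor2 d}
    {ε : Space d → Tensor2 d} (h : IsStrainField g m ebar ε) :
    ∃ hE : ∀ i j, MemLp (fun x => (ε x i j : ℂ)) 2 (cellMeasure g.basis),
      tensorToLp hE = constL2 g.basis ebar -
        green g.basis κ₀ μ₀ (contrastOp g κ₀ μ₀ m (tensorToLp hE)) := by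
  obtain ⟨⟨u, G, hu, hε⟩, heq⟩ := h
  have hU : ∀ i, MemLp (fun x => (u x i : ℂ)) 2 (cellMeasure g.basis) :=
    fun i => memLp_cellMeasure g.basis (hu.memLp i)
  have hG : ∀ i j, MemLp (fun x => (G x i j : ℂ)) 2 (cellMeasure g.basis) :=
    fun i j => memLp_cellMeasure g.basis (hu.memLp_grad i j)
  have hε' := ae_cellMeasure_of_ae g.basis hε
  have hE := memLp_strain g hG hε'
  refine ⟨hE, ?_⟩
  set E := tensorToLp hE with hEdef
  have hgrad : ∀ i j n, coeff g.basis (tensorToLp hG i j) n =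
      Complex.I * (wave g.basis n j * coeff g.basis ((hU i).toLp _) n) := fun i j =>
    (weak_grad_iff g.basis (hU i) (hG i j) j).1 fun φ hφ hp => hu.weak_grad φ hφ hp i j
  have hsum : ∀ i j, E i j = constL2 g.basis ebar i j +
      (2⁻¹ : ℂ) • (tensorToLp hG i j + tensorToLp hG j i) := tensorToLp_eq g hG hE hε'
  have hdiv := (equilibrium_iff g m hE).1 heq
  set τ := contrastOp g κ₀ μ₀ m E with hτ
  have hpol : ∀ i j, tensorToLp hG i j = polGrad g.basis κ₀ μ₀ τ i j := by
    intro i j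
    refine ext_coeff _ fun n => ?_
    rw [hgrad]
    by_cases hn : n = 0
    · subst hn; simp [coeff_polGrad, wave_zero]
    refine coeff_polGrad_of_balance hd g.basis hκ hμ τ
      (fun i => coeff g.basis ((hU i).toLp _) n) n (fun i => ?_) i j
    -- Since `L = L₀ + δL`, equilibrium of the true stress says that the displacement balances the
    -- polarization `τ = δL : E` in the reference medium.
    rw [← divCoeff_stiff_const g κ₀ μ₀ E, ← divCoeff_add, hτ, ← stiff_eq_add_contrastOp]
    · exact hdiv n i
    · intro i j
      rw [hsum, coeff_add, coeff_smul, coeff_add, coeff_constL2 _ _ _ _ hn, hgrad, hgrad]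
      ring
  funext i j
  rw [Pi.sub_apply, Pi.sub_apply, green_apply, hsum, hpol, hpol]
  module

/-! ### Existence of strain fields -/

theorem memLp_re (b : Basis (Fin d) ℝ (Space d)) (f : CellL2 b) :
    MemLp (fun x => ((f x).re : ℂ)) 2 (cellMeasure b) :=
  (Lp.memLp f).re.ofReal

/-- The real part of a square-integrable function. -/
def reL2 (b : Basis (Fin d) ℝ (Space d)) (f : CellL2 b) : CellL2 b := (memLp_re b f).toLp _

theorem coeFn_reL2 (b : Basis (Fin d) ℝ (Space d)) (f : CellL2 b) :
    reL2 b f =ᵐ[cellMeasure b] fun x => ((f x).re : ℂ) := (memLp_re b f).coeFn_toLp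

theorem freq_neg (b : Basis (Fin d) ℝ (Space d)) (n : Fin d → ℤ) (x : Space d) :
    freq b (-n) x = -freq b n x := by
  simp [freq_apply, ← Finset.sum_neg_distrib]

theorem wave_neg (b : Basis (Fin d) ℝ (Space d)) (n : Fin d → ℤ) (j : Fin d) :
    wave b (-n) j = -wave b n j := freq_neg b n _

theorem mode_neg (b : Basis (Fin d) ℝ (Space d)) (n : Fin d → ℤ) (x : Space d) :
    mode b (-n) x = (starRingEnd ℂ) (mode b n x) := by
  rw [mode, mode, freq_neg, ← Complex.exp_conj]
  simp

theorem integrable_conj_mode_mul (b : Basis (Fin d) ℝ (Space d)) (f : CellL2 b)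
    (n : Fin d → ℤ) :
    Integrable (fun x => (starRingEnd ℂ) (mode b n x) * f x) (cellMeasure b) :=
  (memLp_of_continuous b (Complex.continuous_conj.comp (continuous_mode b n)) 2).integrable_mul
    (Lp.memLp f)

/-- The Lippmann-Schwinger equation is solved in complex L², while a strain field is real. This
formula lets gradient relations and equilibrium pass to real parts, by using each at `n` and,
conjugated, at `-n`. -/
theorem coeff_reL2 (b : Basis (Fin d) ℝ (Space d)) (f : CellL2 b) (n : Fin d → ℤ) :
    coeff b (reL2 b f) n = (coeff b f n + (starRingEnd ℂ) (coeff b f (-n))) / 2 := by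
  rw [reL2, coeff_toLp, coeff_eq_inner, coeff_eq_inner, inner_toLp_left, inner_toLp_left,
    ← integral_conj, ← integral_add (integrable_conj_mode_mul b f n)]
  · rw [← integral_div]
    congr 1
    funext x
    rw [mode_neg, map_mul, Complex.conj_conj, ← mul_add, Complex.add_conj]
    push_cast
    ring
  · exact (LinearIsometryEquiv.integrable_comp_iff (Complex.conjLIE)).2
      (integrable_conj_mode_mul b f (-n))

theorem reL2_add (b : Basis (Fin d) ℝ (Space d)) (f h : CellL2 b) :
    reL2 b (f + h) = reL2 b f + reL2 b h :=
  ext_coeff b fun n => by simp only [coeff_reL2, coeff_add, map_add]; ring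

theorem reL2_ofReal_smul (b : Basis (Fin d) ℝ (Space d)) (c : ℝ) (f : CellL2 b) :
    reL2 b ((c : ℂ) • f) = (c : ℂ) • reL2 b f :=
  ext_coeff b fun n => by
    simp only [coeff_reL2, coeff_smul, map_mul, Complex.conj_ofReal]; ring

theorem reL2_sub (b : Basis (Fin d) ℝ (Space d)) (f h : CellL2 b) :
    reL2 b (f - h) = reL2 b f - reL2 b h :=
  ext_coeff b fun n => by simp only [coeff_reL2, coeff_sub, map_sub]; ring

theorem reL2_sum (b : Basis (Fin d) ℝ (Space d)) {ι : Type*} (s : Finset ι) (f : ι → CellL2 b) :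
    reL2 b (∑ i ∈ s, f i) = ∑ i ∈ s, reL2 b (f i) :=
  ext_coeff b fun n => by
    simp only [coeff_reL2, coeff_sum, map_sum]
    rw [← Finset.sum_add_distrib, Finset.sum_div]

theorem reL2_oneL2 (b : Basis (Fin d) ℝ (Space d)) : reL2 b (oneL2 b) = oneL2 b :=
  ext_coeff b fun n => by
    rw [coeff_reL2, coeff_oneL2, coeff_oneL2]
    by_cases hn : n = 0 <;> simp [hn]

theorem reL2_phaseMul (g : Geometry d N) (s : Fin N → ℝ) (f : CellL2 g.basis) :
    reL2 g.basis (phaseMul g s f) = phaseMul g s (reL2 g.basis f) := by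
  apply Lp.ext
  filter_upwards [coeFn_reL2 g.basis (phaseMul g s f), coeFn_reL2 g.basis f,
    coeFn_phaseMul g s f, coeFn_phaseMul g s (reL2 g.basis f)] with x h1 h2 h3 h4
  rw [h1, h4, h3, h2]
  simp

theorem stiff_reL2 (g : Geometry d N) (s r : Fin N → ℝ) (E : TensorL2 g.basis) (i j : Fin d) :
    stiff g s r (fun i j => reL2 g.basis (E i j)) i j = reL2 g.basis (stiff g s r E i j) := by
  have htr : traceL2 (fun i j => reL2 g.basis (E i j)) = reL2 g.basis (traceL2 E) := by
    rw [traceL2, traceL2, reL2_sum]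
  have hc : (2 / d * delta i j : ℂ) = ((2 / d * delta i j : ℝ) : ℂ) := by push_cast; rfl
  rw [stiff_apply, stiff_apply, htr, hc, reL2_add, reL2_phaseMul, reL2_phaseMul, reL2_sub,
    reL2_add, reL2_ofReal_smul, reL2_ofReal_smul]

theorem divCoeff_stiff_of_lippmannSchwinger (hd : 2 ≤ d) {g : Geometry d N} {κ₀ μ₀ : ℝ}
    (hκ : 0 < κ₀) (hμ : 0 < μ₀) {m : PhaseModuli N} {ebar : Tensor2 d} {E : TensorL2 g.basis}
    (hE : E = constL2 g.basis ebar - green g.basis κ₀ μ₀ (contrastOp g κ₀ μ₀ m E))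
    (n : Fin d → ℤ) (i : Fin d) : divCoeff g.basis (stiff g m.κ m.μ E) n i = 0 := by
  by_cases hn : n = 0
  · subst hn; simp [divCoeff, wave_zero]
  rw [stiff_eq_add_contrastOp g κ₀ μ₀, divCoeff_add]
  set τ := contrastOp g κ₀ μ₀ m E
  rw [divCoeff_stiff_const g κ₀ μ₀ E (fun i => coeff g.basis (polDisp g.basis κ₀ μ₀ τ i) n) n]
  · exact balance_polDisp hd g.basis hκ hμ τ n i
  · intro i j
    rw [hE, Pi.sub_apply, Pi.sub_apply, green_apply, coeff_sub, coeff_constL2 _ _ _ _ hn,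
      coeff_smul, coeff_add, coeff_polGrad_eq_polDisp, coeff_polGrad_eq_polDisp]
    ring

theorem fract_add_basis (b : Basis (Fin d) ℝ (Space d)) (i : Fin d) (x : Space d) :
    ZSpan.fract b (x + b i) = ZSpan.fract b x :=
  ZSpan.fract_add_ZSpan b x (Submodule.subset_span ⟨i, rfl⟩)

/-- A solution of the Lippmann-Schwinger equation gives a strain field. -/
theorem exists_isStrainField (hd : 2 ≤ d) {g : Geometry d N} {κ₀ μ₀ : ℝ}
    (hκ : 0 < κ₀) (hμ : 0 < μ₀) {m : PhaseModuli N} {ebar : Tensor2 d} {E : TensorL2 g.basis}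
    (hE : E = constL2 g.basis ebar - green g.basis κ₀ μ₀ (contrastOp g κ₀ μ₀ m E)) :
    ∃ ε, IsStrainField g m ebar ε := by
  set τ := contrastOp g κ₀ μ₀ m E with hτ
  set U := polDisp g.basis κ₀ μ₀ τ with hU
  set P := polGrad g.basis κ₀ μ₀ τ with hP
  -- Composing an L² representative with the reduction to the cell makes it periodic at every point
  -- and does not change it on the cell.
  set u : Space d → Space d := fun x => WithLp.toLp 2 fun i => (U i (ZSpan.fract g.basis x)).re
  set G : Space d → Tensor2 d := fun x => Matrix.of fun i j => (P i j (ZSpan.fract g.basis x)).re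
  have hcell : ∀ f : CellL2 g.basis, (fun x => (f x).re) =ᵐ[cellMeasure g.basis]
      fun x => (f (ZSpan.fract g.basis x)).re := fun f =>
    ae_cellMeasure_of_forall_mem g.basis fun x hx => by simp only [ZSpan.fract_eq_self.2 hx]
  have hmem : ∀ f : CellL2 g.basis, MemLp (fun x => (f (ZSpan.fract g.basis x)).re) 2 (cellMeasure g.basis) :=
    fun f => (Lp.memLp f).re.ae_eq (hcell f)
  have huL : ∀ i, MemLp (fun x => (u x i : ℂ)) 2 (cellMeasure g.basis) := fun i => (hmem (U i)).ofReal
  have hGL : ∀ i j, MemLp (fun x => (G x i j : ℂ)) 2 (cellMeasure g.basis) :=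
    fun i j => (hmem (P i j)).ofReal
  have hto : ∀ (f : CellL2 g.basis) (h : MemLp (fun x => ((f (ZSpan.fract g.basis x)).re : ℂ)) 2
      (cellMeasure g.basis)), h.toLp _ = reL2 g.basis f := fun f h => by
    refine MemLp.toLp_congr _ _ ?_
    filter_upwards [hcell f] with x hx
    rw [hx]
  have hGto : ∀ i j, (hGL i j).toLp _ = reL2 g.basis (P i j) := fun i j => hto (P i j) _
  have huto : ∀ i, (huL i).toLp _ = reL2 g.basis (U i) := fun i => hto (U i) _
  have hεeq : ∀ᵐ x ∂(cellMeasure g.basis), (ebar + symPart (G x)) = ebar + symPart (G x) :=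
    Eventually.of_forall fun _ => rfl
  refine ⟨fun x => ebar + symPart (G x), ⟨u, G, ⟨?_, ?_, ?_, ?_, ?_⟩, Eventually.of_forall
    fun _ => rfl⟩, ?_⟩
  · intro i x
    simp only [u, fract_add_basis]
  · intro i x
    simp only [G, fract_add_basis]
  · exact fun i => memLp_of_memLp_cellMeasure g.basis (hmem (U i))
  · exact fun i j => memLp_of_memLp_cellMeasure g.basis (hmem (P i j))
  · intro φ hφ hp i j
    refine (weak_grad_iff g.basis (huL i) (hGL i j) j).2 (fun n => ?_) φ hφ hp
    rw [hGto, huto, coeff_reL2, coeff_reL2, hP, hU, coeff_polGrad_eq_polDisp,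
      coeff_polGrad_eq_polDisp, wave_neg]
    simp only [map_mul, Complex.conj_I, Complex.conj_ofReal]
    push_cast
    ring
  · refine (equilibrium_iff g m (memLp_strain g hGL hεeq)).2 fun n i => ?_
    have hre : tensorToLp (memLp_strain g hGL hεeq) = fun i j => reL2 g.basis (E i j) := by
      funext i j
      have h2 : (2⁻¹ : ℂ) = ((2⁻¹ : ℝ) : ℂ) := by push_cast; rfl
      have hEij : E i j = constL2 g.basis ebar i j + (2⁻¹ : ℂ) • (P i j + P j i) := by
        rw [hE, Pi.sub_apply, Pi.sub_apply, green_apply]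
        module
      rw [tensorToLp_eq g hGL (memLp_strain g hGL hεeq) hεeq, hEij, reL2_add, h2,
        reL2_ofReal_smul, reL2_add, constL2, reL2_ofReal_smul, reL2_oneL2]
      congr 2
      exact congrArg₂ _ (hGto i j) (hGto j i)
    rw [hre, divCoeff]
    have hz := divCoeff_stiff_of_lippmannSchwinger hd hκ hμ hE
    have h1 := hz n i
    -- The real part of the stress mixes its coefficient at `n` with the conjugate of that at `-n`.
    -- Both are divergence free.
    have h2 := congrArg (starRingEnd ℂ) (hz (-n) i)
    simp only [divCoeff, wave_neg, map_sum, map_mul, Complex.conj_ofReal, map_zero,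
      Complex.ofReal_neg, neg_mul, Finset.sum_neg_distrib, map_neg, neg_eq_zero] at h1 h2
    simp_rw [stiff_reL2, coeff_reL2]
    have h3 : ∀ j, (wave g.basis n j : ℂ) * ((coeff g.basis (stiff g m.κ m.μ E i j) n +
        (starRingEnd ℂ) (coeff g.basis (stiff g m.κ m.μ E i j) (-n))) / 2) =
        (wave g.basis n j * coeff g.basis (stiff g m.κ m.μ E i j) n) / 2 +
        (wave g.basis n j * (starRingEnd ℂ) (coeff g.basis (stiff g m.κ m.μ E i j) (-n))) / 2 :=
      fun j => by ring
    simp_rw [h3]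
    rw [Finset.sum_add_distrib, ← Finset.sum_div, ← Finset.sum_div, h1, h2]
    simp

/-! ### Weak-contrast expansion of the strain field -/

theorem Geometry.exists_phase_eq (g : Geometry d N) (φ : Fin N) : ∃ x, g.phase x = φ := by
  have h := g.phase_pos φ
  obtain ⟨x, hx⟩ := nonempty_of_measure_ne_zero h.ne'
  exact ⟨x, hx.2⟩

theorem contrast_nonneg (g : Geometry d N) (κ₀ μ₀ : ℝ) (m : PhaseModuli N) :
    0 ≤ contrast g κ₀ μ₀ m :=
  Real.iSup_nonneg fun _ => (abs_nonneg _).trans (le_max_left _ _)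

theorem bddAbove_contrast (g : Geometry d N) (κ₀ μ₀ : ℝ) (m : PhaseModuli N) :
    BddAbove (Set.range fun x => max |d * (g.bulk m x - κ₀)| |2 * (g.shear m x - μ₀)|) := by
  refine ((Set.finite_range fun φ : Fin N =>
    max |d * (m.κ φ - κ₀)| |2 * (m.μ φ - μ₀)|).subset ?_).bddAbove
  rintro _ ⟨x, rfl⟩
  exact ⟨g.phase x, rfl⟩

/-- Each phase has positive volume, so it is attained at some point and is seen by the supremum over
points. -/
theorem max_le_contrast (g : Geometry d N) (κ₀ μ₀ : ℝ) (m : PhaseModuli N) (φ : Fin N) :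
    max |d * (m.κ φ - κ₀)| |2 * (m.μ φ - μ₀)| ≤ contrast g κ₀ μ₀ m := by
  obtain ⟨x, rfl⟩ := g.exists_phase_eq φ
  exact le_ciSup (bddAbove_contrast g κ₀ μ₀ m) x

theorem contrast_le (g : Geometry d N) (κ₀ μ₀ : ℝ) (m : PhaseModuli N) {C : ℝ}
    (h : ∀ φ, max |d * (m.κ φ - κ₀)| |2 * (m.μ φ - μ₀)| ≤ C) : contrast g κ₀ μ₀ m ≤ C :=
  have : Nonempty (Space d) := ⟨0⟩
  ciSup_le fun x => h (g.phase x)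

theorem mul_norm_bulk_le (g : Geometry d N) (κ₀ μ₀ : ℝ) (m : PhaseModuli N) :
    d * ‖fun φ => m.κ φ - κ₀‖ ≤ contrast g κ₀ μ₀ m := by
  have h : ‖(d : ℝ) • fun φ => m.κ φ - κ₀‖ ≤ contrast g κ₀ μ₀ m :=
    (pi_norm_le_iff_of_nonneg (contrast_nonneg g κ₀ μ₀ m)).2 fun φ =>
      (le_max_left _ _).trans (max_le_contrast g κ₀ μ₀ m φ)
  rwa [norm_smul, Real.norm_natCast] at h

theorem mul_norm_shear_le (g : Geometry d N) (κ₀ μ₀ : ℝ) (m : PhaseModuli N) :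
    2 * ‖fun φ => m.μ φ - μ₀‖ ≤ contrast g κ₀ μ₀ m := by
  have h : ‖(2 : ℝ) • fun φ => m.μ φ - μ₀‖ ≤ contrast g κ₀ μ₀ m :=
    (pi_norm_le_iff_of_nonneg (contrast_nonneg g κ₀ μ₀ m)).2 fun φ =>
      (le_max_right _ _).trans (max_le_contrast g κ₀ μ₀ m φ)
  rwa [norm_smul, Real.norm_ofNat] at h

/-- The operator of the Lippmann-Schwinger equation. -/
def scatterOp (g : Geometry d N) (κ₀ μ₀ : ℝ) (m : PhaseModuli N) :
    TensorL2 g.basis →L[ℂ] TensorL2 g.basis :=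
  (green g.basis κ₀ μ₀).comp (contrastOp g κ₀ μ₀ m)

/-- The constant `3` is `1 + 2`: in `norm_stiff_le`, `d ‖δκ‖` is at most the contrast and `4 ‖δμ‖`
at most twice the contrast. -/
theorem norm_scatterOp_le (g : Geometry d N) (κ₀ μ₀ : ℝ) (m : PhaseModuli N) :
    ‖scatterOp g κ₀ μ₀ m‖ ≤ 3 * ‖green g.basis κ₀ μ₀‖ * contrast g κ₀ μ₀ m := by
  have hc := contrast_nonneg g κ₀ μ₀ m
  refine ContinuousLinearMap.opNorm_le_bound _ (by positivity) fun E => ?_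
  refine ((green g.basis κ₀ μ₀).le_opNorm _).trans ?_
  have h1 : ‖contrastOp g κ₀ μ₀ m E‖ ≤ 3 * contrast g κ₀ μ₀ m * ‖E‖ := by
    refine (norm_stiff_le g _ _ E).trans ?_
    gcongr
    linarith [mul_norm_bulk_le g κ₀ μ₀ m, mul_norm_shear_le g κ₀ μ₀ m]
  calc _ ≤ ‖green g.basis κ₀ μ₀‖ * (3 * contrast g κ₀ μ₀ m * ‖E‖) :=
      mul_le_mul_of_nonneg_left h1 (norm_nonneg _)
    _ = _ := by ring

/-- Neumann series for `1 + A`. Existence of a strain field is needed because an effective tensor is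
constrained only through the strain fields that exist. -/
theorem exists_eq_sub_apply {X : Type*} [NormedAddCommGroup X] [NormedSpace ℂ X]
    [CompleteSpace X] (A : X →L[ℂ] X) (hA : ‖A‖ < 1) (c : X) : ∃ E, E = c - A E := by
  have h : ‖-A‖ < 1 := by rwa [norm_neg]
  let u := Units.oneSub (-A) h
  have hu : (u : X →L[ℂ] X) = 1 + A := by simp [u, Units.val_oneSub]
  refine ⟨(↑u⁻¹ : X →L[ℂ] X) c, ?_⟩
  have h1 : ((u : X →L[ℂ] X) * (↑u⁻¹ : X →L[ℂ] X)) c = c := by rw [Units.mul_inv]; rfl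
  rw [hu] at h1
  simp only [ContinuousLinearMap.mul_def, ContinuousLinearMap.comp_apply,
    _root_.add_apply, one_apply_eq_self] at h1
  exact eq_sub_of_add_eq h1

/-- From `E - c = -A E` and `‖E‖ ≤ 2 ‖c‖` comes the first bound. Applying `A` once more, `E - c + A
c = -A (E - c)` gains another factor `‖A‖`. -/
theorem norm_sub_le_of_eq_sub_apply {X : Type*} [NormedAddCommGroup X] [NormedSpace ℂ X]
    {A : X →L[ℂ] X} (hA : ‖A‖ ≤ 1 / 2) {E c : X} (hE : E = c - A E) :
    ‖E - c‖ ≤ 2 * ‖A‖ * ‖c‖ ∧ ‖E - c + A c‖ ≤ 2 * ‖A‖ ^ 2 * ‖c‖ := by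
  have h1 : E - c = -A E := by
    conv_lhs => rw [hE]
    abel
  have h2 : ‖E‖ ≤ 2 * ‖c‖ := by
    have h3 : ‖E‖ ≤ ‖c‖ + ‖A E‖ := by
      conv_lhs => rw [hE]
      exact norm_sub_le _ _
    have h4 : ‖A E‖ ≤ 1 / 2 * ‖E‖ := (A.le_opNorm E).trans (by gcongr)
    linarith
  have h5 : ‖E - c‖ ≤ 2 * ‖A‖ * ‖c‖ := by
    rw [h1, norm_neg]
    calc ‖A E‖ ≤ ‖A‖ * ‖E‖ := A.le_opNorm E
      _ ≤ ‖A‖ * (2 * ‖c‖) := by gcongr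
      _ = _ := by ring
  refine ⟨h5, ?_⟩
  have h6 : E - c + A c = -A (E - c) := by rw [map_sub, h1]; abel
  rw [h6, norm_neg]
  calc ‖A (E - c)‖ ≤ ‖A‖ * ‖E - c‖ := A.le_opNorm _
    _ ≤ ‖A‖ * (2 * ‖A‖ * ‖c‖) := by gcongr
    _ = _ := by ring

/-- First-order expansion of the strain field in the weak contrast limit. -/
theorem exists_expansion (hd : 2 ≤ d) (g : Geometry d N) {κ₀ μ₀ : ℝ} (hκ : 0 < κ₀) (hμ : 0 < μ₀)
    (ebar : Tensor2 d) : ∃ r > 0, ∃ C ≥ 0, ∀ m, contrast g κ₀ μ₀ m ≤ r →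
      (∃ ε, IsStrainField g m ebar ε) ∧
      ∀ ε, IsStrainField g m ebar ε →
        ∃ hE : ∀ i j, MemLp (fun x => (ε x i j : ℂ)) 2 (cellMeasure g.basis),
          ‖tensorToLp hE - constL2 g.basis ebar‖ ≤ C * contrast g κ₀ μ₀ m ∧
          ‖tensorToLp hE - constL2 g.basis ebar + green g.basis κ₀ μ₀
            (contrastOp g κ₀ μ₀ m (constL2 g.basis ebar))‖ ≤ C * contrast g κ₀ μ₀ m ^ 2 := by
  -- Adding `1` ensures `1 ≤ B`, hence `B ≤ B ^ 2`, so that one constant serves both estimates.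
  set B : ℝ := 3 * ‖green g.basis κ₀ μ₀‖ + 1 with hB
  have hB1 : 1 ≤ B := by
    have := norm_nonneg (green g.basis κ₀ μ₀)
    linarith
  set c := constL2 g.basis ebar
  refine ⟨1 / (2 * B), by positivity, 2 * B ^ 2 * ‖c‖, by positivity, fun m hm => ?_⟩
  have hc := contrast_nonneg g κ₀ μ₀ m
  have hA : ‖scatterOp g κ₀ μ₀ m‖ ≤ B * contrast g κ₀ μ₀ m :=
    (norm_scatterOp_le g κ₀ μ₀ m).trans (by gcongr; linarith)
  have hA2 : ‖scatterOp g κ₀ μ₀ m‖ ≤ 1 / 2 := by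
    refine hA.trans ?_
    calc B * contrast g κ₀ μ₀ m ≤ B * (1 / (2 * B)) := by gcongr
      _ = 1 / 2 := by field_simp
  constructor
  · obtain ⟨E, hE⟩ := exists_eq_sub_apply (scatterOp g κ₀ μ₀ m) (by linarith) c
    exact exists_isStrainField hd hκ hμ hE
  · intro ε hε
    obtain ⟨hE, hEq⟩ := hε.lippmannSchwinger hd hκ hμ
    obtain ⟨h1, h2⟩ := norm_sub_le_of_eq_sub_apply hA2
      (E := tensorToLp hE) (c := c) hEq
    refine ⟨hE, h1.trans ?_, h2.trans ?_⟩
    · calc 2 * ‖scatterOp g κ₀ μ₀ m‖ * ‖c‖ ≤ 2 * (B * contrast g κ₀ μ₀ m) * ‖c‖ := by gcongr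
        _ ≤ 2 * (B ^ 2 * contrast g κ₀ μ₀ m) * ‖c‖ := by
          gcongr
          nlinarith
        _ = _ := by ring
    · calc 2 * ‖scatterOp g κ₀ μ₀ m‖ ^ 2 * ‖c‖ ≤ 2 * (B * contrast g κ₀ μ₀ m) ^ 2 * ‖c‖ := by
            gcongr
        _ = _ := by ring

theorem tendsto_contrast (g : Geometry d N) (κ₀ μ₀ : ℝ) :
    Tendsto (contrast g κ₀ μ₀) (weakContrast g κ₀ μ₀) (𝓝 0) :=
  tendsto_comap.mono_left inf_le_left

theorem eventually_contrast_le (g : Geometry d N) (κ₀ μ₀ : ℝ) {r : ℝ} (hr : 0 < r) :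
    ∀ᶠ m in weakContrast g κ₀ μ₀, contrast g κ₀ μ₀ m ≤ r :=
  (tendsto_contrast g κ₀ μ₀).eventually (eventually_le_nhds hr)

theorem eventually_isAdmissible (g : Geometry d N) (κ₀ μ₀ : ℝ) :
    ∀ᶠ m in weakContrast g κ₀ μ₀, IsAdmissible g κ₀ μ₀ m :=
  mem_inf_of_right (mem_principal_self _)

/-- Every remainder below is in fact quadratic in the contrast, and the contrast tends to zero along
the filter. -/
theorem isLittleO_contrast (g : Geometry d N) (κ₀ μ₀ : ℝ) {f : PhaseModuli N → ℝ} {C : ℝ}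
    (h : ∀ᶠ m in weakContrast g κ₀ μ₀, |f m| ≤ C * contrast g κ₀ μ₀ m ^ 2) :
    f =o[weakContrast g κ₀ μ₀] contrast g κ₀ μ₀ := by
  have h1 : f =O[weakContrast g κ₀ μ₀] fun m => contrast g κ₀ μ₀ m ^ 2 :=
    IsBigO.of_bound C (h.mono fun m hm => by
      rw [Real.norm_eq_abs, Real.norm_eq_abs, abs_of_nonneg (sq_nonneg (contrast g κ₀ μ₀ m))]
      exact hm)
  refine h1.trans_isLittleO ?_
  have h2 : (contrast g κ₀ μ₀) =o[weakContrast g κ₀ μ₀] fun _ => (1 : ℝ) :=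
    (isLittleO_one_iff ℝ).2 (tendsto_contrast g κ₀ μ₀)
  simpa [sq] using h2.mul_isBigO (isBigO_refl (contrast g κ₀ μ₀) _)

/-! ### Averages over a phase -/

/-- The volume fraction of a phase. -/
def volFrac (g : Geometry d N) (φ : Fin N) : ℝ :=
  (volume (g.phaseCell φ)).toReal / (volume g.cell).toReal

theorem measurableSet_phase (g : Geometry d N) (φ : Fin N) :
    MeasurableSet (g.phase ⁻¹' {φ}) := g.measurable_phase (measurableSet_singleton φ)

theorem volume_cell_toReal_pos (g : Geometry d N) : 0 < (volume g.cell).toReal :=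
  ENNReal.toReal_pos (volume_fundamentalDomain_ne_zero g.basis)
    (volume_fundamentalDomain_ne_top g.basis)

theorem volume_phaseCell_toReal_pos (g : Geometry d N) (φ : Fin N) :
    0 < (volume (g.phaseCell φ)).toReal :=
  ENNReal.toReal_pos (g.phase_pos φ).ne' (measure_ne_top_of_subset Set.inter_subset_left
    (volume_fundamentalDomain_ne_top g.basis))

theorem volFrac_pos (g : Geometry d N) (φ : Fin N) : 0 < volFrac g φ :=
  div_pos (volume_phaseCell_toReal_pos g φ) (volume_cell_toReal_pos g)

/-- The weight of the average over a phase. -/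
def phaseWeight (g : Geometry d N) (φ : Fin N) : Fin N → ℝ := Pi.single φ (volFrac g φ)⁻¹

/-- Turns a phase average into a pairing over the whole cell with a bounded weight, to which L²
bounds and Fourier analysis apply. -/
theorem setAverage_phaseCell (g : Geometry d N) (φ : Fin N) (f : Space d → ℝ) :
    ⨍ x in g.phaseCell φ, f x =
      ∫ x, phaseWeight g φ (g.phase x) * f x ∂(cellMeasure g.basis) := by
  have h1 : ∀ x, phaseWeight g φ (g.phase x) * f x =
      (g.phase ⁻¹' {φ}).indicator (fun x => (volFrac g φ)⁻¹ * f x) x := by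
    intro x
    by_cases hx : g.phase x = φ
    · simp [phaseWeight, hx, Set.indicator]
    · simp [phaseWeight, hx, Set.indicator]
  simp_rw [h1]
  rw [integral_cellMeasure, setIntegral_indicator (measurableSet_phase g φ), setAverage_eq,
    integral_const_mul, smul_eq_mul, smul_eq_mul, volFrac, Measure.real]
  have h2 := (volume_cell_toReal_pos g).ne'
  have h3 := (volume_phaseCell_toReal_pos g φ).ne'
  change _ = (volume g.cell).toReal⁻¹ * (_ * ∫ x in g.phaseCell φ, f x)
  field_simp

theorem setAverage_cell (g : Geometry d N) (f : Space d → ℝ) :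
    ⨍ x in g.cell, f x = ∫ x, f x ∂(cellMeasure g.basis) := by
  rw [setAverage_eq, integral_cellMeasure]; rfl

/-- A field that is constant in each phase, in `L²`. -/
def phaseL2 (g : Geometry d N) (s : Fin N → ℝ) : CellL2 g.basis := phaseMul g s (oneL2 g.basis)

theorem coeFn_oneL2 (b : Basis (Fin d) ℝ (Space d)) :
    oneL2 b =ᵐ[cellMeasure b] fun _ => (1 : ℂ) := (memLp_const (1 : ℂ)).coeFn_toLp

theorem coeFn_phaseL2 (g : Geometry d N) (s : Fin N → ℝ) :
    phaseL2 g s =ᵐ[cellMeasure g.basis] fun x => (s (g.phase x) : ℂ) := by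
  filter_upwards [coeFn_phaseMul g s (oneL2 g.basis), coeFn_oneL2 g.basis] with x h1 h2
  rw [phaseL2, h1, h2, mul_one]

theorem inner_phaseL2_toLp (g : Geometry d N) (s : Fin N → ℝ) {f : Space d → ℝ}
    (hf : MemLp (fun x => (f x : ℂ)) 2 (cellMeasure g.basis)) :
    inner ℂ (phaseL2 g s) (hf.toLp _) =
      ((∫ x, s (g.phase x) * f x ∂(cellMeasure g.basis) : ℝ) : ℂ) := by
  rw [L2.inner_def, ← integral_complex_ofReal]
  refine integral_congr_ae ?_
  filter_upwards [coeFn_phaseL2 g s, hf.coeFn_toLp] with x h1 h2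
  rw [h1, h2, RCLike.inner_apply, mul_comm, Complex.ofReal_mul]
  simp

theorem norm_toLp_sq (b : Basis (Fin d) ℝ (Space d)) {f : Space d → ℝ}
    (hf : MemLp (fun x => (f x : ℂ)) 2 (cellMeasure b)) :
    ‖hf.toLp _‖ ^ 2 = ∫ x, f x ^ 2 ∂(cellMeasure b) := by
  have h := inner_toLp b hf hf
  rw [inner_self_eq_norm_sq_to_K] at h
  have h2 : ∀ x, (starRingEnd ℂ) (f x : ℂ) * (f x : ℂ) = ((f x ^ 2 : ℝ) : ℂ) := fun x => by
    rw [Complex.conj_ofReal]; push_cast; ring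
  simp_rw [h2] at h
  rw [integral_complex_ofReal] at h
  refine Complex.ofReal_injective ?_
  rw [← h]
  push_cast
  rfl

theorem phaseWeight_nonneg (g : Geometry d N) (φ ψ : Fin N) : 0 ≤ phaseWeight g φ ψ := by
  have := (volFrac_pos g φ).le
  by_cases h : ψ = φ
  · subst h; simpa [phaseWeight] using this
  · simp [phaseWeight, h]

theorem phaseWeight_le (g : Geometry d N) (φ ψ : Fin N) :
    phaseWeight g φ ψ ≤ (volFrac g φ)⁻¹ := by
  have := (volFrac_pos g φ).le
  by_cases h : ψ = φ
  · subst h; simp [phaseWeight]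
  · simpa [phaseWeight, h] using this

theorem memLp_re_of_ofReal (b : Basis (Fin d) ℝ (Space d)) {f : Space d → ℝ}
    (hf : MemLp (fun x => (f x : ℂ)) 2 (cellMeasure b)) : MemLp f 2 (cellMeasure b) := by
  simpa using hf.re

/-- Phase averages of quadratic remainders. -/
theorem setAverage_phaseCell_le (g : Geometry d N) (φ : Fin N) {η : Space d → Tensor2 d}
    (hη : ∀ i j, MemLp (fun x => (η x i j : ℂ)) 2 (cellMeasure g.basis)) {R : Space d → ℝ}
    (h0 : ∀ x, 0 ≤ R x) {C : ℝ} (hC : 0 ≤ C) (hR : ∀ x, R x ≤ C * ∑ i, ∑ j, η x i j ^ 2) :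
    |⨍ x in g.phaseCell φ, R x| ≤ C * (volFrac g φ)⁻¹ * d ^ 2 * ‖tensorToLp hη‖ ^ 2 := by
  have hw := (inv_pos.2 (volFrac_pos g φ)).le
  rw [setAverage_phaseCell, abs_of_nonneg (integral_nonneg fun x =>
    mul_nonneg (phaseWeight_nonneg g φ _) (h0 x))]
  have hint : ∀ i j, Integrable (fun x => η x i j ^ 2) (cellMeasure g.basis) := fun i j =>
    (memLp_re_of_ofReal g.basis (hη i j)).integrable_sq
  calc ∫ x, phaseWeight g φ (g.phase x) * R x ∂(cellMeasure g.basis)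
      ≤ ∫ x, (volFrac g φ)⁻¹ * (C * ∑ i, ∑ j, η x i j ^ 2) ∂(cellMeasure g.basis) := by
        refine integral_mono_of_nonneg (Eventually.of_forall fun x =>
          mul_nonneg (phaseWeight_nonneg g φ _) (h0 x)) ?_ (Eventually.of_forall fun x => ?_)
        · exact ((integrable_finsetSum _ fun i _ => integrable_finsetSum _ fun j _ =>
            hint i j).const_mul _).const_mul _
        · exact mul_le_mul (phaseWeight_le g φ _) (hR x) (h0 x) hw
    _ = C * (volFrac g φ)⁻¹ * ∑ i, ∑ j, ‖tensorToLp hη i j‖ ^ 2 := by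
        rw [integral_const_mul, integral_const_mul, integral_finsetSum _ fun i _ =>
          integrable_finsetSum _ fun j _ => hint i j]
        simp_rw [integral_finsetSum _ fun j _ => hint _ j, tensorToLp, norm_toLp_sq]
        ring
    _ ≤ C * (volFrac g φ)⁻¹ * ∑ _i : Fin d, ∑ _j : Fin d, ‖tensorToLp hη‖ ^ 2 := by
        gcongr with i _ j _
        exact (norm_le_pi_norm (tensorToLp hη i) j).trans (norm_le_pi_norm (tensorToLp hη) i)
    _ = _ := by simp; ring

/-! ### Spherical and deviatoric strains -/

theorem inner2_self_nonneg (A : Tensor2 d) : 0 ≤ inner2 A A :=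
  Finset.sum_nonneg fun _ _ => Finset.sum_nonneg fun _ _ => mul_self_nonneg _

theorem inner2_self_eq (A : Tensor2 d) : inner2 A A = ∑ i, ∑ j, A i j ^ 2 := by
  simp [inner2, sq]

theorem inner2_add_self (A B : Tensor2 d) :
    inner2 (A + B) (A + B) = inner2 A A + 2 * inner2 A B + inner2 B B := by
  simp only [inner2, Matrix.add_apply, Finset.mul_sum, ← Finset.sum_add_distrib]
  exact Finset.sum_congr rfl fun _ _ => Finset.sum_congr rfl fun _ _ => by ring

theorem inner2_smul_one (A : Tensor2 d) (c : ℝ) :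
    inner2 (c • (1 : Tensor2 d)) A = c * A.trace := by
  simp [inner2, Matrix.one_apply, Matrix.trace, Finset.mul_sum]

theorem inner2_comm (A B : Tensor2 d) : inner2 A B = inner2 B A := by
  simp [inner2, mul_comm]

theorem inner2_dev_self (hd : d ≠ 0) (A : Tensor2 d) :
    inner2 (dev A) (dev A) = inner2 A A - A.trace ^ 2 / d := by
  have hd' : (d : ℝ) ≠ 0 := by exact_mod_cast hd
  have h1 : dev A = (-(A.trace / d)) • (1 : Tensor2 d) + A := by rw [dev, neg_smul]; abel
  rw [h1, inner2_add_self, inner2_smul_one, inner2_smul_one]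
  simp only [Matrix.trace_smul, Matrix.trace_one, Fintype.card_fin, smul_eq_mul]
  field_simp
  ring

theorem equivStrain_sq (hd : 2 ≤ d) (A : Tensor2 d) :
    equivStrain A ^ 2 = ((d : ℝ) - 1) / d * (inner2 A A - A.trace ^ 2 / d) := by
  have h2 : (2 : ℝ) ≤ d := by exact_mod_cast hd
  have h3 : 0 ≤ ((d : ℝ) - 1) / d := div_nonneg (by linarith) (by linarith)
  rw [equivStrain, Real.sq_sqrt (mul_nonneg h3 (inner2_self_nonneg _)),
    inner2_dev_self (by omega)]

theorem equivStrain_sq_le (hd : 2 ≤ d) (A : Tensor2 d) : equivStrain A ^ 2 ≤ inner2 A A := by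
  have h2 : (2 : ℝ) ≤ d := by exact_mod_cast hd
  have h3 := inner2_self_nonneg (dev A)
  rw [inner2_dev_self (by omega)] at h3
  rw [equivStrain_sq hd]
  have h4 : ((d : ℝ) - 1) / d ≤ 1 := div_le_one_of_le₀ (by linarith) (by linarith)
  have h5 : 0 ≤ A.trace ^ 2 / d := by positivity
  nlinarith

theorem hydro_sq_le (hd : 2 ≤ d) (A : Tensor2 d) : hydro A ^ 2 ≤ inner2 A A := by
  have h2 : (2 : ℝ) ≤ d := by exact_mod_cast hd
  have h3 := inner2_self_nonneg (dev A)
  rw [inner2_dev_self (by omega)] at h3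
  have h4 : hydro A ^ 2 = A.trace ^ 2 / d / d := by rw [hydro]; ring
  have h5 : 0 ≤ A.trace ^ 2 / d := by positivity
  have h6 : A.trace ^ 2 / d / d ≤ A.trace ^ 2 / d := div_le_self h5 (by linarith)
  linarith

theorem IsSpherical.eq {A : Tensor2 d} (hA : IsSpherical A) : A = (A.trace / d) • 1 := by
  conv_lhs => rw [← hA]
  ext i j
  rw [contract_tensorJ, Matrix.smul_apply, Matrix.one_apply, delta, smul_eq_mul]
  ring

theorem IsDeviatoric.symm {A : Tensor2 d} (hA : IsDeviatoric A) (i j : Fin d) :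
    A i j = A j i := by
  rw [← hA, contract_tensorK, contract_tensorK, delta_comm]
  ring

theorem IsDeviatoric.trace {A : Tensor2 d} (hA : IsDeviatoric A) : A.trace = 0 := by
  have h : A.trace = A.trace - d * A.trace / d := by
    conv_lhs => rw [← hA]
    simp only [Matrix.trace, Matrix.diag_apply, contract_tensorK]
    rw [Finset.sum_sub_distrib]
    simp [delta]
    ring
  by_cases hd : d = 0
  · subst hd; simp [Matrix.trace]
  have hd' : (d : ℝ) ≠ 0 := by exact_mod_cast hd
  rw [mul_div_cancel_left₀ _ hd'] at h
  linarith

/-! ### Expansion of the phase averages -/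

theorem traceL2_constL2 (b : Basis (Fin d) ℝ (Space d)) (e : Tensor2 d) :
    traceL2 (constL2 b e) = (e.trace : ℂ) • oneL2 b := by
  simp only [traceL2, constL2, ← Finset.sum_smul, Matrix.trace, Matrix.diag_apply]
  push_cast
  rfl

theorem contrastOp_constL2 (g : Geometry d N) (κ₀ μ₀ : ℝ) (m : PhaseModuli N) (e : Tensor2 d)
    (i j : Fin d) : contrastOp g κ₀ μ₀ m (constL2 g.basis e) i j =
      (delta i j * e.trace : ℂ) • phaseL2 g (fun φ => m.κ φ - κ₀) +
      (e i j + e j i - 2 / d * delta i j * e.trace : ℂ) • phaseL2 g (fun φ => m.μ φ - μ₀) := by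
  rw [contrastOp, stiff_apply, traceL2_constL2, constL2, constL2, smul_smul, smul_smul,
    ← add_smul, ← sub_smul, map_smul, map_smul]
  rfl

/-- The phase weight as an element of `L²`. -/
def weightL2 (g : Geometry d N) (φ : Fin N) : CellL2 g.basis := phaseL2 g (phaseWeight g φ)

theorem tensorToLp_sub_constL2 (g : Geometry d N) (ebar : Tensor2 d) {ε : Space d → Tensor2 d}
    (hE : ∀ i j, MemLp (fun x => (ε x i j : ℂ)) 2 (cellMeasure g.basis)) :
    ∃ hη : ∀ i j, MemLp (fun x => ((ε x - ebar) i j : ℂ)) 2 (cellMeasure g.basis),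
      tensorToLp (e := fun x => ε x - ebar) hη = tensorToLp hE - constL2 g.basis ebar := by
  have hη : ∀ i j, MemLp (fun x => ((ε x - ebar) i j : ℂ)) 2 (cellMeasure g.basis) :=
    fun i j => by
      have := (hE i j).sub (memLp_const (ebar i j : ℂ))
      refine this.ae_eq (Eventually.of_forall fun x => ?_)
      simp
  refine ⟨hη, ?_⟩
  funext i j
  apply Lp.ext
  filter_upwards [(hη i j).coeFn_toLp, (hE i j).coeFn_toLp, coeFn_oneL2 g.basis,
    Lp.coeFn_sub (tensorToLp hE i j) (constL2 g.basis ebar i j),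
    Lp.coeFn_smul (ebar i j : ℂ) (oneL2 g.basis)] with x h1 h2 h3 h4 h5
  rw [Pi.sub_apply, Pi.sub_apply, h4, Pi.sub_apply, constL2, h5, Pi.smul_apply, h3]
  simp only [tensorToLp]
  rw [h1, h2]
  simp

theorem integrable_phaseFun_mul (g : Geometry d N) (s : Fin N → ℝ) {f : Space d → ℝ}
    (hf : Integrable f (cellMeasure g.basis)) :
    Integrable (fun x => s (g.phase x) * f x) (cellMeasure g.basis) :=
  hf.bdd_mul (g.measurable_phaseFun s).aestronglyMeasurable
    (Eventually.of_forall fun x => norm_le_pi_norm s (g.phase x))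

theorem setAverage_phaseCell_quadratic (g : Geometry d N) (φ : Fin N) (a c : ℝ)
    {l q : Space d → ℝ} (hl : Integrable l (cellMeasure g.basis))
    (hq : Integrable q (cellMeasure g.basis)) :
    ⨍ x in g.phaseCell φ, (a + c * l x + q x) =
      a + c * (⨍ x in g.phaseCell φ, l x) + ⨍ x in g.phaseCell φ, q x := by
  have h1 : (1 : ℝ) = ∫ x, phaseWeight g φ (g.phase x) * 1 ∂(cellMeasure g.basis) := by
    rw [← setAverage_phaseCell]
    exact (setAverage_const (g.phase_pos φ).ne' (measure_ne_top_of_subset Set.inter_subset_left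
      (volume_fundamentalDomain_ne_top g.basis)) 1).symm
  simp only [setAverage_phaseCell]
  have i0 := integrable_phaseFun_mul g (phaseWeight g φ) (integrable_const (1 : ℝ)
    (μ := cellMeasure g.basis))
  have i1 := integrable_phaseFun_mul g (phaseWeight g φ) hl
  have i2 := integrable_phaseFun_mul g (phaseWeight g φ) hq
  have h2 : ∀ x, phaseWeight g φ (g.phase x) * (a + c * l x + q x) =
      a * (phaseWeight g φ (g.phase x) * 1) + c * (phaseWeight g φ (g.phase x) * l x) +
        phaseWeight g φ (g.phase x) * q x := fun x => by ring
  simp_rw [h2]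
  have i01 : Integrable (fun x => a * (phaseWeight g φ (g.phase x) * 1) +
      c * (phaseWeight g φ (g.phase x) * l x)) (cellMeasure g.basis) :=
    (i0.const_mul a).add (i1.const_mul c)
  rw [integral_add i01 i2,
    integral_add (i0.const_mul a) (i1.const_mul c), integral_const_mul, integral_const_mul, ← h1,
    mul_one]

theorem memLp_inner2 (b : Basis (Fin d) ℝ (Space d)) (a : Tensor2 d) {η : Space d → Tensor2 d}
    (hη : ∀ i j, MemLp (fun x => (η x i j : ℂ)) 2 (cellMeasure b)) :
    MemLp (fun x => (inner2 a (η x) : ℂ)) 2 (cellMeasure b) := by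
  have h := memLp_finsetSum (p := 2) (μ := cellMeasure b) Finset.univ fun i _ =>
    memLp_finsetSum (p := 2) (μ := cellMeasure b) Finset.univ fun j _ =>
      (hη i j).const_mul (a i j : ℂ)
  refine h.ae_eq (Eventually.of_forall fun x => ?_)
  simp [inner2]

theorem toLp_inner2 (b : Basis (Fin d) ℝ (Space d)) (a : Tensor2 d) {η : Space d → Tensor2 d}
    (hη : ∀ i j, MemLp (fun x => (η x i j : ℂ)) 2 (cellMeasure b)) :
    (memLp_inner2 b a hη).toLp _ = ∑ i, ∑ j, (a i j : ℂ) • tensorToLp hη i j := by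
  apply Lp.ext
  have h1 : ∀ᵐ x ∂(cellMeasure b), ∀ i j, tensorToLp hη i j x = (η x i j : ℂ) :=
    ae_all_iff.2 fun i => ae_all_iff.2 fun j => (hη i j).coeFn_toLp
  have h2 : ∀ᵐ x ∂(cellMeasure b), ∀ i, (∑ j, (a i j : ℂ) • tensorToLp hη i j : CellL2 b) x =
      ∑ j, ((a i j : ℂ) • tensorToLp hη i j : CellL2 b) x :=
    ae_all_iff.2 fun i => Lp.coeFn_fun_finsetSum _ _
  have h3 : ∀ᵐ x ∂(cellMeasure b), ∀ i j, ((a i j : ℂ) • tensorToLp hη i j : CellL2 b) x =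
      (a i j : ℂ) * tensorToLp hη i j x :=
    ae_all_iff.2 fun i => ae_all_iff.2 fun j => Lp.coeFn_smul _ _
  filter_upwards [(memLp_inner2 b a hη).coeFn_toLp, h1, h2, h3, Lp.coeFn_fun_finsetSum
    (p := 2) (μ := cellMeasure b) Finset.univ
    fun i => ∑ j, (a i j : ℂ) • tensorToLp hη i j] with x h0 h1 h2 h3 h4
  rw [h0, h4, Finset.sum_congr rfl fun i _ => h2 i]
  simp only [h3, h1, inner2]
  push_cast
  rfl

theorem integrable_inner2_self (b : Basis (Fin d) ℝ (Space d)) {η : Space d → Tensor2 d}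
    (hη : ∀ i j, MemLp (fun x => (η x i j : ℂ)) 2 (cellMeasure b)) :
    Integrable (fun x => inner2 (η x) (η x)) (cellMeasure b) := by
  simp_rw [inner2_self_eq]
  exact integrable_finsetSum _ fun i _ => integrable_finsetSum _ fun j _ =>
    (memLp_re_of_ofReal b (hη i j)).integrable_sq

theorem integrable_trace_sq (b : Basis (Fin d) ℝ (Space d)) {η : Space d → Tensor2 d}
    (hη : ∀ i j, MemLp (fun x => (η x i j : ℂ)) 2 (cellMeasure b)) :
    Integrable (fun x => (η x).trace ^ 2) (cellMeasure b) := by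
  have h := (memLp_re_of_ofReal b (memLp_inner2 b ((1 : ℝ) • 1) hη)).integrable_sq
  simpa only [inner2_smul_one, one_mul] using h

/-- The polarization response: first-order term of a linear observable of the strain. -/
def firstOrder (g : Geometry d N) (κ₀ μ₀ : ℝ) (m : PhaseModuli N) (ebar a : Tensor2 d) :
    CellL2 g.basis :=
  ∑ i, ∑ j, (a i j : ℂ) • green g.basis κ₀ μ₀ (contrastOp g κ₀ μ₀ m (constL2 g.basis ebar)) i j

/-- In the weak contrast limit, strain fields differ from the macroscopic strain by a fluctuation
of known first order. -/
theorem exists_phase_expansion (hd : 2 ≤ d) (g : Geometry d N) {κ₀ μ₀ : ℝ} (hκ : 0 < κ₀)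
    (hμ : 0 < μ₀) (ebar a : Tensor2 d) (φ : Fin N) :
    ∃ C, ∀ᶠ m in weakContrast g κ₀ μ₀, ∀ ε, IsStrainField g m ebar ε →
      (∀ i j, MemLp (fun x => ((ε x - ebar) i j : ℂ)) 2 (cellMeasure g.basis)) ∧
      |(⨍ x in g.phaseCell φ, inner2 a (ε x - ebar)) +
        (inner ℂ (weightL2 g φ) (firstOrder g κ₀ μ₀ m ebar a)).re| ≤
          C * contrast g κ₀ μ₀ m ^ 2 ∧
      ∀ R : Tensor2 d → ℝ, (∀ A, 0 ≤ R A) → (∀ A, R A ≤ inner2 A A) →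
        |⨍ x in g.phaseCell φ, R (ε x - ebar)| ≤ C * contrast g κ₀ μ₀ m ^ 2 := by
  obtain ⟨r, hr, C, hC, H⟩ := exists_expansion hd g hκ hμ ebar
  set C1 := ‖weightL2 g φ‖ * (∑ i, ∑ j, |a i j|) * C
  set C2 := (volFrac g φ)⁻¹ * d ^ 2 * C ^ 2
  refine ⟨max C1 C2, ?_⟩
  filter_upwards [eventually_contrast_le g κ₀ μ₀ hr] with m hm ε hε
  obtain ⟨hE, h1, h2⟩ := (H m hm).2 ε hε
  obtain ⟨hη, hη'⟩ := tensorToLp_sub_constL2 g ebar hE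
  rw [← hη'] at h1 h2
  refine ⟨hη, ?_, fun R hR0 hR => ?_⟩
  -- The average of a linear observable is an L² pairing with the phase weight, so Cauchy-Schwarz
  -- transfers the second-order bound on `E - ē + Γ (δL : ē)`.
  · have hav : ⨍ x in g.phaseCell φ, inner2 a (ε x - ebar) =
        (inner ℂ (weightL2 g φ)
          (∑ i, ∑ j, (a i j : ℂ) • tensorToLp (e := fun x => ε x - ebar) hη i j)).re := by
      rw [← toLp_inner2, weightL2, inner_phaseL2_toLp, Complex.ofReal_re, setAverage_phaseCell]
    rw [hav, ← Complex.add_re, ← inner_add_right, firstOrder]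
    refine (Complex.abs_re_le_norm _).trans ((norm_inner_le_norm _ _).trans ?_)
    simp_rw [← Finset.sum_add_distrib, ← smul_add]
    calc _ ≤ ‖weightL2 g φ‖ * ∑ i, ∑ j, |a i j| * (C * contrast g κ₀ μ₀ m ^ 2) := by
          gcongr
          refine (norm_sum_le _ _).trans (Finset.sum_le_sum fun i _ =>
            (norm_sum_le _ _).trans (Finset.sum_le_sum fun j _ => ?_))
          rw [norm_smul, Complex.norm_real, Real.norm_eq_abs]
          gcongr
          exact ((norm_le_pi_norm ((tensorToLp hη + green g.basis κ₀ μ₀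
            (contrastOp g κ₀ μ₀ m (constL2 g.basis ebar))) i) j).trans
              (norm_le_pi_norm (tensorToLp hη + green g.basis κ₀ μ₀
            (contrastOp g κ₀ μ₀ m (constL2 g.basis ebar))) i)).trans h2
      _ = C1 * contrast g κ₀ μ₀ m ^ 2 := by
          simp_rw [← Finset.sum_mul]
          ring
      _ ≤ _ := by gcongr; exact le_max_left _ _
  -- A quadratic observable of the fluctuation is controlled by the square of its norm, and that
  -- norm is of first order.
  · refine (setAverage_phaseCell_le g φ hη (fun x => hR0 _) zero_le_one fun x => ?_).trans ?_
    · rw [one_mul, ← inner2_self_eq]; exact hR _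
    · have hv := (volFrac_pos g φ).le
      calc _ ≤ 1 * (volFrac g φ)⁻¹ * d ^ 2 * (C * contrast g κ₀ μ₀ m) ^ 2 := by gcongr
        _ = C2 * contrast g κ₀ μ₀ m ^ 2 := by ring
        _ ≤ _ := by gcongr; exact le_max_right _ _

/-! ### Spherical loading -/

theorem inner_phaseL2_phaseL2 (g : Geometry d N) (s r : Fin N → ℝ) :
    inner ℂ (phaseL2 g s) (phaseL2 g r) =
      ((∫ x, s (g.phase x) * r (g.phase x) ∂(cellMeasure g.basis) : ℝ) : ℂ) := by
  rw [L2.inner_def, ← integral_complex_ofReal]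
  refine integral_congr_ae ?_
  filter_upwards [coeFn_phaseL2 g s, coeFn_phaseL2 g r] with x h1 h2
  rw [h1, h2, RCLike.inner_apply, mul_comm, Complex.ofReal_mul]
  simp

theorem integrable_phaseFun (g : Geometry d N) (s : Fin N → ℝ) :
    Integrable (fun x => s (g.phase x)) (cellMeasure g.basis) := by
  simpa using integrable_phaseFun_mul g s (integrable_const (1 : ℝ))

theorem setAverage_phaseCell_phaseFun (g : Geometry d N) (φ : Fin N) (s : Fin N → ℝ) :
    ⨍ x in g.phaseCell φ, s (g.phase x) = s φ := by
  have h : ∀ x, phaseWeight g φ (g.phase x) * s (g.phase x) =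
      phaseWeight g φ (g.phase x) * s φ := fun x => by
    by_cases hx : g.phase x = φ
    · rw [hx]
    · simp [phaseWeight, hx]
  rw [setAverage_phaseCell]
  simp_rw [h]
  rw [← setAverage_phaseCell]
  exact setAverage_const (g.phase_pos φ).ne' (measure_ne_top_of_subset Set.inter_subset_left
      (volume_fundamentalDomain_ne_top g.basis)) _

/-- A field constant in each phase equals its own phase average. This is how an individual modulus
comes out of the averages. -/
theorem inner_weightL2_phaseL2 (g : Geometry d N) (φ : Fin N) (s : Fin N → ℝ) :
    inner ℂ (weightL2 g φ) (phaseL2 g s) = (s φ : ℂ) := by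
  rw [weightL2, inner_phaseL2_phaseL2, ← setAverage_phaseCell, setAverage_phaseCell_phaseFun]

theorem coeff_phaseL2_zero (g : Geometry d N) (s : Fin N → ℝ) :
    coeff g.basis (phaseL2 g s) 0 = ((∫ x, s (g.phase x) ∂(cellMeasure g.basis) : ℝ) : ℂ) := by
  have h1 : oneL2 g.basis = phaseL2 g (fun _ => 1) := by
    rw [phaseL2, phaseMul_const]; simp
  rw [coeff_zero_eq_inner, h1, inner_phaseL2_phaseL2]
  simp

theorem lamJInv_ne_zero (hd : 2 ≤ d) {κ₀ μ₀ : ℝ} (hκ : 0 < κ₀) (hμ : 0 < μ₀) :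
    lamJInv d κ₀ μ₀ ≠ 0 := (lame_denom_pos hd hκ hμ).ne'

/-- The trace of the strain induced by a spherical polarization. -/
theorem trace_green_spherical (hd : 2 ≤ d) (b : Basis (Fin d) ℝ (Space d)) {κ₀ μ₀ : ℝ}
    (hκ : 0 < κ₀) (hμ : 0 < μ₀) (F : CellL2 b) (hF : coeff b F 0 = 0) :
    traceL2 (green b κ₀ μ₀ fun i j => (delta i j : ℂ) • F) =
      ((d / lamJInv d κ₀ μ₀ : ℝ) : ℂ) • F := by
  refine ext_coeff b fun n => ?_
  rw [traceL2, coeff_sum, coeff_smul]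
  by_cases hn : n = 0
  · subst hn
    rw [hF, mul_zero]
    refine Finset.sum_eq_zero fun i _ => ?_
    rw [green_apply, coeff_smul, coeff_add, coeff_polGrad, wave_zero]
    simp
  have hdiv : ∀ i, divCoeff b (fun i j => (delta i j : ℂ) • F) n i =
      wave b n i * coeff b F n := fun i => by
    rw [divCoeff, ← sum_delta_left_complex i fun j => (wave b n j : ℂ) * coeff b F n]
    exact Finset.sum_congr rfl fun j _ => by rw [coeff_smul]; ring
  have hq0 : (waveSq b n : ℂ) ≠ 0 := by simpa using (waveSq_pos b hn).ne'
  have hμ0 : (μ₀ : ℂ) ≠ 0 := by exact_mod_cast hμ.ne'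
  have h1 : ∑ k, (wave b n k : ℂ) * divCoeff b (fun i j => (delta i j : ℂ) • F) n k =
      waveSq b n * coeff b F n := by
    rw [ofReal_waveSq, Finset.sum_mul]
    exact Finset.sum_congr rfl fun k _ => by rw [hdiv]; ring
  have h2 : ∀ i, coeff b (green b κ₀ μ₀ (fun i j => (delta i j : ℂ) • F) i i) n =
      (1 - lameRatio d κ₀ μ₀) / μ₀ * coeff b F n / waveSq b n * (wave b n i * wave b n i) := by
    intro i
    rw [green_apply, coeff_smul, coeff_add, coeff_polGrad, h1, hdiv]
    field_simp
    ring
  simp_rw [h2]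
  rw [← Finset.mul_sum, ← ofReal_waveSq, div_mul_cancel₀ _ hq0]
  congr 1
  -- Both sides are the inverse of the longitudinal modulus `λ₀ + 2 μ₀`.
  have h3 : (1 - lameRatio d κ₀ μ₀) / μ₀ = d / lamJInv d κ₀ μ₀ := by
    have := lamJInv_ne_zero hd hκ hμ
    rw [lameRatio]
    change (1 - _ / lamJInv d κ₀ μ₀) / μ₀ = _
    field_simp
    rw [lamJInv]
    ring
  rw [← h3]
  push_cast
  rfl

theorem nJ_eq (hd : d ≠ 0) : nJ d = 1 := by
  have hd' : (d : ℝ) ≠ 0 := by exact_mod_cast hd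
  have h : ∀ i j : Fin d, ∑ k : Fin d, ∑ l : Fin d, delta i j * delta k l / (d : ℝ) *
      (delta i j * delta k l / d) = delta i j / d := by
    intro i j
    have h1 : ∀ k : Fin d, ∑ l, delta i j * delta k l / (d : ℝ) * (delta i j * delta k l / d) =
        delta i j / d ^ 2 := by
      intro k
      rw [← sum_delta_left k fun _ => delta i j / (d : ℝ) ^ 2]
      refine Finset.sum_congr rfl fun l _ => ?_
      simp only [delta]
      split_ifs <;> (simp; try ring)
    simp only [h1, Finset.sum_const, Finset.card_univ, Fintype.card_fin, nsmul_eq_mul]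
    field_simp
  simp only [nJ, inner4, tensorJ, h]
  have h2 : ∀ i : Fin d, ∑ j, delta i j / (d : ℝ) = 1 / d := fun i => by
    rw [← sum_delta_left i fun _ => 1 / (d : ℝ)]
    exact Finset.sum_congr rfl fun j _ => by ring
  simp [h2, hd']

theorem integral_bulk_sub (g : Geometry d N) {κ₀ μ₀ : ℝ} {m : PhaseModuli N}
    (hm : IsAdmissible g κ₀ μ₀ m) :
    ∫ x, (m.κ (g.phase x) - κ₀) ∂(cellMeasure g.basis) = 0 := by
  have h := hm.bulk_mean
  rw [setAverage_cell] at h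
  rw [integral_sub (integrable_phaseFun g m.κ) (integrable_const _)]
  simp only [Geometry.bulk] at h
  rw [h]; simp

theorem integral_shear_sub (g : Geometry d N) {κ₀ μ₀ : ℝ} {m : PhaseModuli N}
    (hm : IsAdmissible g κ₀ μ₀ m) :
    ∫ x, (m.μ (g.phase x) - μ₀) ∂(cellMeasure g.basis) = 0 := by
  have h := hm.shear_mean
  rw [setAverage_cell] at h
  rw [integral_sub (integrable_phaseFun g m.μ) (integrable_const _)]
  simp only [Geometry.shear] at h
  rw [h]; simp

/-- A spherical `ē` has no deviator, so `ε_eq` sees the fluctuation alone and its square is of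
second order. For `ε₀` the first-order term is pointwise proportional to `δκ`. -/
theorem spherical_estimate (hd : 2 ≤ d) (g : Geometry d N) {κ₀ μ₀ : ℝ} (hκ : 0 < κ₀)
    (hμ : 0 < μ₀) {ebar : Tensor2 d} (hebar : ebar ≠ 0)
    {ε : PhaseModuli N → Space d → Tensor2 d}
    (hε : ∀ m, IsAdmissible g κ₀ μ₀ m → IsStrainField g m ebar (ε m)) (φ : Fin N)
    (hs : IsSpherical ebar) :
    (fun m => ⨍ x in g.phaseCell φ, equivStrain (ε m x) ^ 2)
        =o[weakContrast g κ₀ μ₀] contrast g κ₀ μ₀ ∧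
    (fun m => m.κ φ - (κ₀ + nJ d * lamJInv d κ₀ μ₀ / (2 * d) *
          (1 - (⨍ x in g.phaseCell φ, hydro (ε m x) ^ 2) / hydro ebar ^ 2)))
        =o[weakContrast g κ₀ μ₀] contrast g κ₀ μ₀ := by
  have hd' : (d : ℝ) ≠ 0 := by positivity
  obtain ⟨C, hC⟩ := exists_phase_expansion hd g hκ hμ ebar ((1 / d : ℝ) • 1) φ
  set e₀ := hydro ebar with he₀
  have hebar' : ebar = e₀ • 1 := hs.eq
  have he₀0 : e₀ ≠ 0 := by
    rintro h
    rw [h, zero_smul] at hebar'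
    exact hebar hebar'
  have htr : ebar.trace = d * e₀ := by rw [he₀, hydro]; field_simp
  constructor
  · refine isLittleO_contrast g κ₀ μ₀ (C := C) ?_
    filter_upwards [hC, eventually_isAdmissible g κ₀ μ₀] with m h hm
    obtain ⟨-, -, h3⟩ := h (ε m) (hε m hm)
    have h4 : ∀ x, equivStrain (ε m x) ^ 2 = equivStrain (ε m x - ebar) ^ 2 := by
      intro x
      have hdev : dev (ε m x - ebar) = dev (ε m x) := by
        rw [dev, dev, Matrix.trace_sub, htr]
        nth_rewrite 1 [hebar']
        rw [sub_div, mul_div_cancel_left₀ _ hd', sub_smul]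
        abel
      rw [equivStrain, equivStrain, hdev]
    simp_rw [h4]
    exact h3 (fun A => equivStrain A ^ 2) (fun A => sq_nonneg _) (equivStrain_sq_le hd)
  -- The constant is read off `hid` below: the prefactor times the error of the linear term plus
  -- that of the quadratic term.
  · refine isLittleO_contrast g κ₀ μ₀
      (C := |lamJInv d κ₀ μ₀ / (2 * d) / e₀ ^ 2| * (2 * |e₀| * C + C)) ?_
    filter_upwards [hC, eventually_isAdmissible g κ₀ μ₀] with m h hm
    obtain ⟨hη, h2, h3⟩ := h (ε m) (hε m hm)
    have h3' := h3 (fun A => hydro A ^ 2) (fun A => sq_nonneg _) (hydro_sq_le hd)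
    have hfirst : firstOrder g κ₀ μ₀ m ebar ((1 / d : ℝ) • 1) =
        ((d * e₀ / lamJInv d κ₀ μ₀ : ℝ) : ℂ) • phaseL2 g (fun φ => m.κ φ - κ₀) := by
      set F := phaseL2 g (fun φ => m.κ φ - κ₀) with hF
      have hop : contrastOp g κ₀ μ₀ m (constL2 g.basis ebar) =
          ((d * e₀ : ℝ) : ℂ) • fun i j => (delta i j : ℂ) • F := by
        funext i j
        have hij : ∀ i j, ebar i j = e₀ * delta i j := fun i j => by
          conv_lhs => rw [hebar']
          simp [Matrix.one_apply, delta]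
        have hz : (ebar i j + ebar j i - 2 / d * delta i j * ebar.trace : ℂ) = 0 := by
          have : ebar i j + ebar j i - 2 / d * delta i j * ebar.trace = 0 := by
            rw [hij, hij, delta_comm j i, htr]; field_simp; ring
          have h0 := congrArg Complex.ofReal this
          push_cast at h0
          exact h0
        rw [contrastOp_constL2, hz, zero_smul, add_zero, htr, Pi.smul_apply, Pi.smul_apply,
          smul_smul]
        congr 1
        push_cast; ring
      have hF0 : coeff g.basis F 0 = 0 := by
        rw [hF, coeff_phaseL2_zero, integral_bulk_sub g hm, Complex.ofReal_zero]
      have htg := trace_green_spherical hd g.basis hκ hμ F hF0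
      rw [firstOrder, hop, map_smul]
      have hsum : ∀ X : TensorL2 g.basis,
          ∑ i, ∑ j, ((((1 / d : ℝ) • (1 : Tensor2 d)) i j : ℝ) : ℂ) • X i j =
          ((1 / d : ℝ) : ℂ) • traceL2 X := by
        intro X
        rw [traceL2, Finset.smul_sum]
        refine Finset.sum_congr rfl fun i _ => ?_
        rw [Finset.sum_eq_single i]
        · simp
        · intro j _ hj; simp [hj.symm]
        · simp
      rw [hsum]
      have hts : ∀ (c : ℂ) (X : TensorL2 g.basis), traceL2 (c • X) = c • traceL2 X := by
        intro c X; simp [traceL2, Finset.smul_sum]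
      rw [hts, htg, smul_smul, smul_smul]
      congr 1
      have hd'' : (d : ℂ) ≠ 0 := by exact_mod_cast hd'
      push_cast
      field_simp
    rw [hfirst, inner_smul_right, inner_weightL2_phaseL2, ← Complex.ofReal_mul,
      Complex.ofReal_re] at h2
    have hhyd : ∀ A : Tensor2 d, inner2 ((1 / d : ℝ) • 1) A = hydro A := fun A => by
      rw [inner2_smul_one, hydro]; ring
    simp_rw [hhyd] at h2
    have hsq : ∀ x, hydro (ε m x) ^ 2 =
        e₀ ^ 2 + 2 * e₀ * hydro (ε m x - ebar) + hydro (ε m x - ebar) ^ 2 := by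
      intro x
      have : hydro (ε m x) = e₀ + hydro (ε m x - ebar) := by
        rw [he₀, hydro, hydro, hydro, Matrix.trace_sub]; ring
      rw [this]; ring
    have hlin : MemLp (fun x => hydro (ε m x - ebar)) 2 (cellMeasure g.basis) := by
      simpa only [hhyd] using memLp_re_of_ofReal g.basis
        (memLp_inner2 g.basis ((1 / d : ℝ) • 1) hη)
    simp_rw [hsq]
    rw [setAverage_phaseCell_quadratic g φ _ _ (hlin.integrable (by norm_num))
      hlin.integrable_sq, nJ_eq (by omega)]
    set I₁ := ⨍ x in g.phaseCell φ, hydro (ε m x - ebar)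
    set I₂ := ⨍ x in g.phaseCell φ, hydro (ε m x - ebar) ^ 2
    have hJ := lamJInv_ne_zero hd hκ hμ
    -- The terms of order zero cancel, and those of first order group into the expression bounded by
    -- `h2`.
    have hid : m.κ φ - (κ₀ + 1 * lamJInv d κ₀ μ₀ / (2 * d) *
        (1 - (e₀ ^ 2 + 2 * e₀ * I₁ + I₂) / e₀ ^ 2)) = lamJInv d κ₀ μ₀ / (2 * d) / e₀ ^ 2 *
          (2 * e₀ * (I₁ + d * e₀ / lamJInv d κ₀ μ₀ * (m.κ φ - κ₀)) + I₂) := by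
      field_simp
      ring
    rw [hid, abs_mul, mul_assoc |_|]
    refine mul_le_mul_of_nonneg_left ?_ (abs_nonneg (lamJInv d κ₀ μ₀ / (2 * d) / e₀ ^ 2))
    refine (abs_add_le (2 * e₀ * (I₁ + d * e₀ / lamJInv d κ₀ μ₀ * (m.κ φ - κ₀))) I₂).trans ?_
    rw [abs_mul, abs_mul, abs_two, add_mul, mul_assoc _ C]
    have h5 : 2 * |e₀| * |I₁ + d * e₀ / lamJInv d κ₀ μ₀ * (m.κ φ - κ₀)| ≤
        2 * |e₀| * (C * contrast g κ₀ μ₀ m ^ 2) := by gcongr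
    exact add_le_add h5 h3'

/-! ### Isotropic tensors -/

theorem inner2_sum_smul_left {ι : Type*} (s : Finset ι) (c : ι → ℝ) (P : ι → Tensor2 d)
    (X : Tensor2 d) : inner2 (∑ a ∈ s, c a • P a) X = ∑ a ∈ s, c a * inner2 (P a) X := by
  simp only [inner2, Matrix.sum_apply, Matrix.smul_apply, smul_eq_mul, Finset.sum_mul,
    Finset.mul_sum]
  rw [Finset.sum_comm (s := s)]
  refine Finset.sum_congr rfl fun i _ => ?_
  rw [Finset.sum_comm (s := s)]
  exact Finset.sum_congr rfl fun j _ => Finset.sum_congr rfl fun a _ => by ring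

theorem contract_sum_smul {ι : Type*} (s : Finset ι) (c : ι → ℝ) (P : ι → Tensor2 d)
    (T : Tensor4 d) : contract T (∑ a ∈ s, c a • P a) = ∑ a ∈ s, c a • contract T (P a) := by
  ext i j
  simp only [contract, Matrix.of_apply, Matrix.sum_apply, Matrix.smul_apply, smul_eq_mul,
    Finset.mul_sum]
  rw [Finset.sum_comm (s := s)]
  refine Finset.sum_congr rfl fun k _ => ?_
  rw [Finset.sum_comm (s := s)]
  exact Finset.sum_congr rfl fun l _ => Finset.sum_congr rfl fun a _ => by ring

theorem inner2_contract (T : Tensor4 d) (A B : Tensor2 d) :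
    inner2 A (contract T B) = ∑ p, ∑ q, ∑ r, ∑ s, A p q * B r s * T p q r s := by
  simp only [inner2, contract, Matrix.of_apply, Finset.mul_sum]
  refine Finset.sum_congr rfl fun p _ => Finset.sum_congr rfl fun q _ =>
    Finset.sum_congr rfl fun r _ => Finset.sum_congr rfl fun s _ => by ring

/-- The components `T i i k k` of an isotropic tensor are invariant under all orthogonal
transformations. -/
theorem IsIsotropic.diagonal_invariant {T : Tensor4 d} (hT : IsIsotropic T)
    {Q : Matrix (Fin d) (Fin d) ℝ} (hQ : Q ∈ Matrix.orthogonalGroup (Fin d) ℝ) (i k : Fin d) :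
    ∑ p, ∑ q, ∑ r, ∑ s, Q i p * Q i q * Q k r * Q k s * T p q r s = T i i k k := by
  have hdet : Q.det = 1 ∨ Q.det = -1 := by
    have h := congrArg Matrix.det ((Matrix.mem_orthogonalGroup_iff _ _).1 hQ)
    rw [Matrix.det_mul, Matrix.det_transpose, Matrix.det_one] at h
    exact mul_self_eq_one_iff.1 h
  rcases hdet with h | h
  · exact hT Q ((Matrix.mem_specialOrthogonalGroup_iff).2 ⟨hQ, h⟩) i i k k
  -- For determinant `-1`, composing with the reflection of axis `i` gives a rotation. It leaves the
  -- component unchanged, because rows `i` and `k` each enter twice.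
  · set v : Fin d → ℝ := Function.update 1 i (-1) with hv
    have hv2 : ∀ j, v j * v j = 1 := fun j => by
      by_cases hj : j = i
      · subst hj; simp [hv]
      · simp [hv, hj]
    have hD : Matrix.diagonal v ∈ Matrix.orthogonalGroup (Fin d) ℝ := by
      rw [Matrix.mem_orthogonalGroup_iff, Matrix.diagonal_transpose,
        Matrix.diagonal_mul_diagonal]
      simp [hv2]
    have hDdet : (Matrix.diagonal v).det = -1 := by
      rw [Matrix.det_diagonal, hv, Finset.prod_update_of_mem (Finset.mem_univ i)]
      simp
    have h1 := hT (Matrix.diagonal v * Q) ((Matrix.mem_specialOrthogonalGroup_iff).2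
      ⟨mul_mem hD hQ, by rw [Matrix.det_mul, hDdet, h]; norm_num⟩) i i k k
    rw [← h1]
    simp only [Matrix.diagonal_mul]
    refine Finset.sum_congr rfl fun p _ => Finset.sum_congr rfl fun q _ =>
      Finset.sum_congr rfl fun r _ => Finset.sum_congr rfl fun s _ => ?_
    linear_combination (Q i p * Q i q * Q k r * Q k s * T p q r s) *
      (-(hv2 i) - v i * v i * hv2 k)

/-- Permutation matrices are orthogonal but may have determinant `-1`, hence the use of invariance
under the full orthogonal group. -/
theorem IsIsotropic.diagonal_perm {T : Tensor4 d} (hT : IsIsotropic T)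
    (σ : Equiv.Perm (Fin d)) (i k : Fin d) : T (σ i) (σ i) (σ k) (σ k) = T i i k k := by
  have hQ : (σ.permMatrix ℝ) ∈ Matrix.orthogonalGroup (Fin d) ℝ := by
    rw [Matrix.mem_orthogonalGroup_iff, Matrix.transpose_permMatrix, ← Matrix.permMatrix_mul]
    simp
  rw [← hT.diagonal_invariant hQ i k]
  simp [Equiv.Perm.permMatrix, PEquiv.toMatrix_apply, Equiv.toPEquiv_apply]

/-- The components `T i i k k` of an isotropic tensor take one value for `i = k`, and another one
for `i ≠ k`. -/
theorem IsIsotropic.exists_diagonal_eq (hd : 2 ≤ d) {T : Tensor4 d} (hT : IsIsotropic T) :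
    ∃ α β, ∀ i k, T i i k k = β + α * delta i k := by
  set i₀ : Fin d := ⟨0, by omega⟩
  set k₀ : Fin d := ⟨1, by omega⟩
  have h0 : i₀ ≠ k₀ := by simp [i₀, k₀]
  refine ⟨T i₀ i₀ i₀ i₀ - T i₀ i₀ k₀ k₀, T i₀ i₀ k₀ k₀, fun i k => ?_⟩
  by_cases h : i = k
  · subst h
    have := hT.diagonal_perm (Equiv.swap i i₀) i i
    rw [Equiv.swap_apply_left] at this
    rw [← this, delta, if_pos rfl]; ring
  -- The pair `(i, k)` goes to `(i₀, k₀)` in two swaps: `i` to `i₀`, then the image of `k` to `k₀`.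
  -- The second swap must not move `i₀`.
  · have h1 : (Equiv.swap (Equiv.swap i i₀ k) k₀) i₀ = i₀ := by
      refine Equiv.swap_apply_of_ne_of_ne (fun h2 => h ?_) h0
      rw [← Equiv.swap_apply_left i i₀] at h2
      nth_rewrite 2 [Equiv.swap_apply_left] at h2
      exact (Equiv.swap i i₀).injective h2
    have := hT.diagonal_perm ((Equiv.swap i i₀).trans (Equiv.swap (Equiv.swap i i₀ k) k₀)) i k
    simp only [Equiv.trans_apply, Equiv.swap_apply_left, h1] at this
    rw [← this, delta, if_neg h]; ring

theorem exists_orthogonal_decomposition {e : Tensor2 d} (he : e.IsSymm) :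
    ∃ U ∈ Matrix.orthogonalGroup (Fin d) ℝ, ∃ v : Fin d → ℝ,
      e = U * Matrix.diagonal v * U.transpose := by
  have h : e.IsHermitian := by
    rw [Matrix.IsHermitian, Matrix.conjTranspose_eq_transpose_of_trivial]; exact he
  refine ⟨h.eigenvectorUnitary, h.eigenvectorUnitary.2, h.eigenvalues, ?_⟩
  have := h.spectral_theorem
  rw [Unitary.conjStarAlgAut_apply, Matrix.star_eq_conjTranspose,
    Matrix.conjTranspose_eq_transpose_of_trivial] at this
  exact this

/-- On symmetric traceless tensors, the quadratic form of an isotropic tensor is a multiple of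
the norm. -/
theorem IsIsotropic.exists_quadratic_eq (hd : 2 ≤ d) {T : Tensor4 d} (hT : IsIsotropic T) :
    ∃ c, ∀ e : Tensor2 d, e.IsSymm → e.trace = 0 →
      inner2 e (contract T e) = c * inner2 e e := by
  obtain ⟨α, β, hαβ⟩ := hT.exists_diagonal_eq hd
  refine ⟨α, fun e he htr => ?_⟩
  obtain ⟨U, hU, v, hv⟩ := exists_orthogonal_decomposition he
  have hU1 : U.transpose * U = 1 := (Matrix.mem_orthogonalGroup_iff' _ _).1 hU
  have hUt : U.transpose ∈ Matrix.orthogonalGroup (Fin d) ℝ := by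
    rw [Matrix.mem_orthogonalGroup_iff, Matrix.transpose_transpose, hU1]
  -- The spectral projectors of `e`. In an eigenbasis only the components `T a a b b` enter the
  -- quadratic form.
  set P : Fin d → Tensor2 d := fun a => Matrix.of fun p q => U p a * U q a with hP
  have he' : e = ∑ a, v a • P a := by
    ext p q
    rw [hv, Matrix.mul_apply, Matrix.sum_apply]
    refine Finset.sum_congr rfl fun a _ => ?_
    rw [Matrix.mul_diagonal]
    simp [hP]; ring
  have hPP : ∀ a b, inner2 (P a) (contract T (P b)) = T a a b b := by
    intro a b
    rw [inner2_contract, ← hT.diagonal_invariant hUt a b]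
    simp [hP, mul_assoc]
  have htr' : ∑ a, v a = 0 := by
    rw [← htr, hv, Matrix.trace_mul_comm, ← Matrix.mul_assoc, hU1, Matrix.one_mul,
      Matrix.trace_diagonal]
  have hnorm : inner2 e e = ∑ a, v a * v a := by
    have h1 : inner2 e e = (e * e.transpose).trace := by
      simp [inner2, Matrix.trace, Matrix.mul_apply]
    have h2 : e * e = U * Matrix.diagonal (fun a => v a * v a) * U.transpose := by
      nth_rewrite 1 2 [hv]
      rw [← Matrix.diagonal_mul_diagonal]
      simp only [Matrix.mul_assoc]
      rw [← Matrix.mul_assoc U.transpose U, hU1, Matrix.one_mul]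
    rw [h1, he.eq, h2, Matrix.trace_mul_comm, ← Matrix.mul_assoc, hU1, Matrix.one_mul,
      Matrix.trace_diagonal]
  rw [hnorm]
  nth_rewrite 1 [he']
  rw [inner2_sum_smul_left]
  -- The constant part `β` is multiplied by the sum of the eigenvalues, which is the trace, hence
  -- zero.
  have h3 : ∀ a, inner2 (P a) (contract T e) = α * v a := fun a => by
    rw [he', contract_sum_smul, inner2_comm, inner2_sum_smul_left]
    simp_rw [inner2_comm _ (P a), hPP, hαβ, mul_add, Finset.sum_add_distrib, ← Finset.sum_mul,
      htr']
    rw [zero_mul, zero_add, ← sum_delta_left a fun b => α * v b]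
    exact Finset.sum_congr rfl fun b _ => by ring
  simp_rw [h3, Finset.mul_sum]
  exact Finset.sum_congr rfl fun a _ => by ring

/-! ### Deviatoric polarizations -/

theorem isDeviatoric_of_symm {A : Tensor2 d} (hA : ∀ i j, A i j = A j i) (htr : A.trace = 0) :
    IsDeviatoric A := by
  ext i j
  rw [contract_tensorK, htr, ← hA i j]
  ring

theorem IsDeviatoric.isSymm {A : Tensor2 d} (hA : IsDeviatoric A) : A.IsSymm :=
  Matrix.IsSymm.ext fun i j => hA.symm j i

/-- The component along `e` of the strain induced by the polarization `F • e`. -/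
def response (b : Basis (Fin d) ℝ (Space d)) (κ₀ μ₀ : ℝ) (e : Tensor2 d) (F : CellL2 b) :
    CellL2 b :=
  ∑ i, ∑ j, (e i j : ℂ) • green b κ₀ μ₀ (fun i j => (e i j : ℂ) • F) i j

/-- The product of a tensor with a wave vector. -/
def waveVec (b : Basis (Fin d) ℝ (Space d)) (e : Tensor2 d) (n : Fin d → ℤ) (i : Fin d) : ℝ :=
  ∑ j, e i j * wave b n j

/-- The Fourier symbol of the response. -/
def responseSymbol (b : Basis (Fin d) ℝ (Space d)) (κ₀ μ₀ : ℝ) (e : Tensor2 d)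
    (n : Fin d → ℤ) : ℝ :=
  1 / μ₀ * ((∑ i, waveVec b e n i ^ 2) / waveSq b n -
    lameRatio d κ₀ μ₀ * (∑ i, wave b n i * waveVec b e n i) ^ 2 / waveSq b n ^ 2)

theorem coeff_response (b : Basis (Fin d) ℝ (Space d)) (κ₀ μ₀ : ℝ) {e : Tensor2 d}
    (he : ∀ i j, e i j = e j i) (F : CellL2 b) (n : Fin d → ℤ) :
    coeff b (response b κ₀ μ₀ e F) n = responseSymbol b κ₀ μ₀ e n * coeff b F n := by
  have hdiv : ∀ i, divCoeff b (fun i j => (e i j : ℂ) • F) n i =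
      waveVec b e n i * coeff b F n := fun i => by
    rw [divCoeff, waveVec, Complex.ofReal_sum, Finset.sum_mul]
    exact Finset.sum_congr rfl fun j _ => by rw [coeff_smul]; push_cast; ring
  set v : Fin d → ℂ := fun i => (waveVec b e n i : ℂ) with hv
  set w : Fin d → ℂ := fun i => (wave b n i : ℂ) with hw
  have hv' : ∀ i, v i = ∑ j, (e i j : ℂ) * w j := fun i => by simp [hv, hw, waveVec]
  set S : ℂ := ∑ k, w k * v k with hS
  have hS' : ∑ k, w k * divCoeff b (fun i j => (e i j : ℂ) • F) n k = S * coeff b F n := by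
    rw [hS, Finset.sum_mul]
    exact Finset.sum_congr rfl fun k _ => by rw [hdiv]; ring
  have hterm : ∀ i j, coeff b ((e i j : ℂ) •
      green b κ₀ μ₀ (fun i j => (e i j : ℂ) • F) i j) n =
      coeff b F n / (2 * μ₀) * (1 / waveSq b n * (v i * (e i j * w j)) +
        1 / waveSq b n * (v j * (e j i * w i)) -
        2 * (lameRatio d κ₀ μ₀ * S / waveSq b n ^ 2) * (w i * (e i j * w j))) := by
    intro i j
    rw [coeff_smul, green_apply, coeff_smul, coeff_add, coeff_polGrad, coeff_polGrad, hS', hdiv,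
      hdiv, ← he i j]
    simp only [hv, hw]
    ring
  have h2 : ∑ i, ∑ j, v j * (e j i * w i) = ∑ i, v i * v i := by
    rw [Finset.sum_comm]
    exact Finset.sum_congr rfl fun i _ => by rw [← Finset.mul_sum, ← hv']
  rw [response, coeff_sum]
  simp_rw [coeff_sum, hterm, ← Finset.mul_sum, Finset.sum_sub_distrib, Finset.sum_add_distrib,
    ← Finset.mul_sum, ← hv']
  rw [h2, ← hS, responseSymbol]
  push_cast
  simp_rw [sq (waveVec b e n _ : ℂ)]
  change _ = (1 / μ₀ * ((∑ i, v i * v i) / waveSq b n - lameRatio d κ₀ μ₀ * S ^ 2 /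
    waveSq b n ^ 2) : ℂ) * _
  ring

/-- The response is a Fourier multiplier with real symbol, hence self-adjoint. This permits
polarization of its quadratic form. -/
theorem inner_response_re_comm (b : Basis (Fin d) ℝ (Space d)) (κ₀ μ₀ : ℝ) {e : Tensor2 d}
    (he : ∀ i j, e i j = e j i) (f h : CellL2 b) :
    (inner ℂ f (response b κ₀ μ₀ e h)).re = (inner ℂ h (response b κ₀ μ₀ e f)).re := by
  rw [← Complex.conj_re, inner_conj_symm]
  congr 1
  refine (hasSum_inner_coeff b _ _).unique ?_
  convert hasSum_inner_coeff b h (response b κ₀ μ₀ e f) using 1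
  funext n
  rw [coeff_response b κ₀ μ₀ he, coeff_response b κ₀ μ₀ he, map_mul, Complex.conj_ofReal]
  ring

theorem response_add (b : Basis (Fin d) ℝ (Space d)) (κ₀ μ₀ : ℝ) {e : Tensor2 d}
    (he : ∀ i j, e i j = e j i) (f h : CellL2 b) :
    response b κ₀ μ₀ e (f + h) = response b κ₀ μ₀ e f + response b κ₀ μ₀ e h :=
  ext_coeff b fun n => by
    rw [coeff_add, coeff_response b κ₀ μ₀ he, coeff_response b κ₀ μ₀ he,
      coeff_response b κ₀ μ₀ he, coeff_add, mul_add]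

theorem response_smul (b : Basis (Fin d) ℝ (Space d)) (κ₀ μ₀ : ℝ) {e : Tensor2 d}
    (he : ∀ i j, e i j = e j i) (c : ℂ) (f : CellL2 b) :
    response b κ₀ μ₀ e (c • f) = c • response b κ₀ μ₀ e f :=
  ext_coeff b fun n => by
    rw [coeff_smul, coeff_response b κ₀ μ₀ he, coeff_response b κ₀ μ₀ he, coeff_smul]
    ring

/-- The column `(k, l)` of the deviatoric projector. -/
def deviatoricColumn (d : ℕ) (k l : Fin d) : Tensor2 d := Matrix.of fun i j => tensorK d i j k l

theorem deviatoricColumn_apply (i j k l : Fin d) : deviatoricColumn d k l i j =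
    (delta i k * delta j l + delta i l * delta j k) / 2 - delta i j * delta k l / d := rfl

theorem isDeviatoric_deviatoricColumn (k l : Fin d) : IsDeviatoric (deviatoricColumn d k l) := by
  have hd : (d : ℝ) ≠ 0 := by exact_mod_cast k.pos.ne'
  refine isDeviatoric_of_symm (fun i j => ?_) ?_
  · rw [deviatoricColumn_apply, deviatoricColumn_apply, delta_comm j i]; ring
  · have h1 : ∀ i, deviatoricColumn d k l i i =
        delta k i * delta l i - delta k l / d := fun i => by
      rw [deviatoricColumn_apply, delta_comm i k, delta_comm i l, show delta i i = 1 by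
        simp [delta]]
      ring
    rw [Matrix.trace]
    simp_rw [Matrix.diag_apply, h1]
    rw [Finset.sum_sub_distrib, sum_delta_left k fun i => delta l i, delta_comm l k]
    simp only [Finset.sum_const, Finset.card_univ, Fintype.card_fin, nsmul_eq_mul]
    field_simp
    ring

theorem sum_inner2_deviatoricColumn :
    ∑ k, ∑ l, inner2 (deviatoricColumn d k l) (deviatoricColumn d k l) = nK d := by
  simp only [inner2, nK, inner4]
  have h : ∀ i j k l : Fin d, deviatoricColumn d k l i j = tensorK d k l i j := fun i j k l => by
    rw [deviatoricColumn_apply, tensorK, Pi.sub_apply, Pi.sub_apply, Pi.sub_apply, Pi.sub_apply,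
      tensorI, tensorJ, delta_comm k i, delta_comm l j, delta_comm k j, delta_comm l i]
    ring
  simp_rw [h]

theorem waveVec_deviatoricColumn (b : Basis (Fin d) ℝ (Space d)) (n : Fin d → ℤ)
    (i k l : Fin d) : waveVec b (deviatoricColumn d k l) n i =
      (delta k i * wave b n l + delta l i * wave b n k) / 2 - delta k l * wave b n i / d := by
  rw [waveVec, ← sum_delta_left l fun j => wave b n j, ← sum_delta_left k fun j => wave b n j,
    ← sum_delta_left i fun j => wave b n j, Finset.mul_sum, Finset.mul_sum, Finset.mul_sum,
    ← Finset.sum_add_distrib, Finset.sum_div, Finset.sum_div, ← Finset.sum_sub_distrib]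
  refine Finset.sum_congr rfl fun j _ => ?_
  rw [deviatoricColumn_apply, delta_comm i k, delta_comm j l, delta_comm i l, delta_comm j k]
  ring

/-- The sum is the full contraction `K :: Γ̂(ξ)`, which is rotation invariant and homogeneous of
degree zero in `ξ`, hence constant. Explicitly, with `Kₖₗ` the columns, `∑ |Kₖₗ ξ|² = |ξ|² (d + 2)(d
- 1) / (2 d)` and `∑ (ξ · Kₖₗ ξ)² = |ξ|⁴ (d - 1) / d`. -/
theorem sum_responseSymbol_deviatoricColumn (hd : 2 ≤ d) (b : Basis (Fin d) ℝ (Space d))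
    {κ₀ μ₀ : ℝ} (hκ : 0 < κ₀) (hμ : 0 < μ₀) {n : Fin d → ℤ} (hn : n ≠ 0) :
    ∑ k, ∑ l, responseSymbol b κ₀ μ₀ (deviatoricColumn d k l) n = (lamKInv d κ₀ μ₀)⁻¹ := by
  have hd0 : (d : ℝ) ≠ 0 := by positivity
  have h2 : (2 : ℝ) ≤ d := by exact_mod_cast hd
  set w := wave b n with hw
  set q := waveSq b n with hq
  have hq0 : q ≠ 0 := (waveSq_pos b hn).ne'
  have hqs : ∑ i, w i ^ 2 = q := rfl
  have hdd : ∀ i : Fin d, delta i i = 1 := fun i => by simp [delta]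
  have hcross : ∀ k l : Fin d, ∑ i, w i * waveVec b (deviatoricColumn d k l) n i =
      w k * w l - delta k l * q / d := by
    intro k l
    have h : ∀ i, w i * waveVec b (deviatoricColumn d k l) n i =
        delta k i * (w i * w l / 2) + delta l i * (w i * w k / 2) -
          delta k l / d * w i ^ 2 := fun i => by
      rw [waveVec_deviatoricColumn]; ring
    simp_rw [h]
    rw [Finset.sum_sub_distrib, Finset.sum_add_distrib, sum_delta_left, sum_delta_left,
      ← Finset.mul_sum, hqs]
    ring
  have hnorm : ∀ k l : Fin d, ∑ i, waveVec b (deviatoricColumn d k l) n i ^ 2 =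
      (w l ^ 2 + w k ^ 2) / 4 + delta k l * (w k ^ 2 / 2 - 2 * w k * w l / d + q / d ^ 2) := by
    intro k l
    have hkk : delta k l * delta k l = delta k l := by unfold delta; split_ifs <;> simp
    have h : ∀ i, waveVec b (deviatoricColumn d k l) n i ^ 2 =
        delta k i * (delta k i * w l ^ 2 / 4 + delta l i * w l * w k / 2 -
          delta k l * w i * w l / d) +
        delta l i * (delta l i * w k ^ 2 / 4 - delta k l * w i * w k / d) +
        delta k l * delta k l / d ^ 2 * w i ^ 2 := fun i => by
      rw [waveVec_deviatoricColumn]; ring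
    simp_rw [h]
    rw [Finset.sum_add_distrib, Finset.sum_add_distrib, sum_delta_left, sum_delta_left,
      ← Finset.mul_sum, hqs, hdd, hdd, hkk, delta_comm l k]
    by_cases hkl : k = l
    · subst hkl; rw [hdd]; ring
    · rw [delta, if_neg hkl]; ring
  have hs1 : ∑ k : Fin d, ∑ l : Fin d, ∑ i, waveVec b (deviatoricColumn d k l) n i ^ 2 =
      q * ((d + 2) * (d - 1) / (2 * d)) := by
    have h : ∀ k, ∑ l, ∑ i, waveVec b (deviatoricColumn d k l) n i ^ 2 =
        q / 4 + q / d ^ 2 + (d / 4 + 1 / 2 - 2 / d) * w k ^ 2 := fun k => by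
      simp_rw [hnorm]
      rw [Finset.sum_add_distrib, sum_delta_left, ← Finset.sum_div, Finset.sum_add_distrib, hqs]
      simp only [Finset.sum_const, Finset.card_univ, Fintype.card_fin, nsmul_eq_mul]
      ring
    simp_rw [h]
    rw [Finset.sum_add_distrib, ← Finset.mul_sum, hqs]
    simp only [Finset.sum_const, Finset.card_univ, Fintype.card_fin, nsmul_eq_mul]
    field_simp
    ring
  have hs2 : ∑ k : Fin d, ∑ l : Fin d,
      (∑ i, w i * waveVec b (deviatoricColumn d k l) n i) ^ 2 = q ^ 2 * ((d - 1) / d) := by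
    have h : ∀ k, ∑ l, (∑ i, w i * waveVec b (deviatoricColumn d k l) n i) ^ 2 =
        (q - 2 * q / d) * w k ^ 2 + q ^ 2 / d ^ 2 := fun k => by
      have h' : ∀ l, (∑ i, w i * waveVec b (deviatoricColumn d k l) n i) ^ 2 =
          w k ^ 2 * w l ^ 2 + delta k l * (delta k l * q ^ 2 / d ^ 2 - 2 * q / d * w k * w l) :=
        fun l => by rw [hcross]; ring
      simp_rw [h']
      rw [Finset.sum_add_distrib, sum_delta_left, ← Finset.mul_sum, hqs, hdd]
      ring
    simp_rw [h]
    rw [Finset.sum_add_distrib, ← Finset.mul_sum, hqs]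
    simp only [Finset.sum_const, Finset.card_univ, Fintype.card_fin, nsmul_eq_mul]
    field_simp
    ring
  simp_rw [responseSymbol, ← Finset.mul_sum, Finset.sum_sub_distrib, ← Finset.sum_div,
    ← Finset.mul_sum]
  rw [← hq, hs1, hs2, lameRatio, lamKInv]
  have hL : (d : ℝ) * κ₀ + 2 * (d - 1) * μ₀ ≠ 0 := (lame_denom_pos hd hκ hμ).ne'
  have hd1 : (d : ℝ) - 1 ≠ 0 := by linarith
  have hK : κ₀ + 2 * μ₀ ≠ 0 := by positivity
  generalize hLdef : (d : ℝ) * κ₀ + 2 * (d - 1) * μ₀ = L at hL ⊢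
  field_simp
  rw [← hLdef]
  ring

/-- Zero mean is needed since the symbol of the response vanishes at frequency zero instead of
taking the constant value. -/
theorem sum_response_deviatoricColumn (hd : 2 ≤ d) (b : Basis (Fin d) ℝ (Space d))
    {κ₀ μ₀ : ℝ} (hκ : 0 < κ₀) (hμ : 0 < μ₀) (F : CellL2 b) (hF : coeff b F 0 = 0) :
    ∑ k, ∑ l, response b κ₀ μ₀ (deviatoricColumn d k l) F =
      (((lamKInv d κ₀ μ₀)⁻¹ : ℝ) : ℂ) • F := by
  refine ext_coeff b fun n => ?_
  rw [coeff_sum, coeff_smul]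
  simp_rw [coeff_sum, coeff_response b κ₀ μ₀ (isDeviatoric_deviatoricColumn _ _).symm,
    ← Finset.sum_mul]
  by_cases hn : n = 0
  · rw [hn, hF, mul_zero, mul_zero]
  · rw [← sum_responseSymbol_deviatoricColumn hd b hκ hμ hn]
    push_cast
    rfl

/-! ### The effective shear modulus at second order -/

/-- A traceless `e` annihilates every term carrying the identity, so only the shear modulus
contributes to the work of the stress in `e`. -/
theorem sum_smul_stiff {e : Tensor2 d} (he : IsDeviatoric e) (g : Geometry d N)
    (s r : Fin N → ℝ) (E : TensorL2 g.basis) :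
    ∑ i, ∑ j, (e i j : ℂ) • stiff g s r E i j =
      phaseMul g r ((2 : ℂ) • ∑ i, ∑ j, (e i j : ℂ) • E i j) := by
  have hz : ∀ f : CellL2 g.basis, ∑ i, ∑ j, ((e i j : ℂ) * delta i j) • f = 0 := by
    intro f
    simp_rw [← Finset.sum_smul]
    have h : ∑ i, ∑ j, e i j * delta i j = 0 := by
      rw [← he.trace, Matrix.trace]
      refine Finset.sum_congr rfl fun i _ => ?_
      rw [Matrix.diag_apply, ← sum_delta_left i fun j => e i j]
      exact Finset.sum_congr rfl fun j _ => mul_comm _ _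
    have h' := congrArg Complex.ofReal h
    push_cast at h'
    rw [h', zero_smul]
  have h1 : ∀ i j, (e i j : ℂ) • stiff g s r E i j =
      ((e i j : ℂ) * delta i j) • phaseMul g s (traceL2 E) +
      (phaseMul g r ((e i j : ℂ) • E i j) + phaseMul g r ((e j i : ℂ) • E j i)) -
        ((e i j : ℂ) * delta i j) • phaseMul g r ((2 / d : ℂ) • traceL2 E) := by
    intro i j
    rw [stiff_apply, ← he.symm i j]
    simp only [map_smul, map_add, map_sub, smul_add, smul_sub, smul_smul]
    rw [show (e i j : ℂ) * delta i j * (2 / d) = e i j * (2 / d * delta i j) by ring]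
    abel
  simp_rw [h1, Finset.sum_sub_distrib, Finset.sum_add_distrib]
  rw [hz, hz, zero_add, sub_zero, Finset.sum_comm (f := fun i j => phaseMul g r
    ((e j i : ℂ) • E j i)), ← two_smul ℂ, map_smul, map_sum]
  simp_rw [map_sum]

theorem coeff_green_zero (b : Basis (Fin d) ℝ (Space d)) (κ₀ μ₀ : ℝ) (τ : TensorL2 b)
    (i j : Fin d) : coeff b (green b κ₀ μ₀ τ i j) 0 = 0 := by
  rw [green_apply, coeff_smul, coeff_add, coeff_polGrad, coeff_polGrad]
  simp [wave_zero]

theorem coeff_phaseMul_zero (g : Geometry d N) (r : Fin N → ℝ) (X : CellL2 g.basis) :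
    coeff g.basis (phaseMul g r X) 0 = inner ℂ (phaseL2 g r) X := by
  rw [coeff_zero_eq_integral, L2.inner_def]
  refine integral_congr_ae ?_
  filter_upwards [coeFn_phaseMul g r X, coeFn_phaseL2 g r] with x h1 h2
  rw [h1, h2, RCLike.inner_apply, mul_comm]
  simp

theorem contrastOp_constL2_deviatoric {e : Tensor2 d} (he : IsDeviatoric e) (g : Geometry d N)
    (κ₀ μ₀ : ℝ) (m : PhaseModuli N) : contrastOp g κ₀ μ₀ m (constL2 g.basis e) =
      (2 : ℂ) • fun i j => (e i j : ℂ) • phaseL2 g (fun φ => m.μ φ - μ₀) := by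
  funext i j
  rw [contrastOp_constL2, he.trace, ← he.symm i j, Pi.smul_apply, Pi.smul_apply, smul_smul]
  simp only [Complex.ofReal_zero, mul_zero, zero_smul, zero_add, sub_zero]
  rw [two_mul]

theorem firstOrder_deviatoric {e : Tensor2 d} (he : IsDeviatoric e) (g : Geometry d N)
    (κ₀ μ₀ : ℝ) (m : PhaseModuli N) : firstOrder g κ₀ μ₀ m e e =
      (2 : ℂ) • response g.basis κ₀ μ₀ e (phaseL2 g (fun φ => m.μ φ - μ₀)) := by
  rw [firstOrder, contrastOp_constL2_deviatoric he, map_smul, response]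
  simp_rw [Finset.smul_sum, Pi.smul_apply, smul_smul, mul_comm (2 : ℂ)]

/-- The work `e : L̃ : e` is the mean of `2 μ e : ε`, which is `2 μ₀ e : e + 2 ⟨δμ, e : ε⟩`. As `δμ`
already carries one order and has mean zero, the first-order strain suffices for second-order
accuracy. The factor `‖δμ‖` kept in the bound makes the remainder cubic. -/
theorem exists_effective_expansion (hd : 2 ≤ d) (g : Geometry d N) {κ₀ μ₀ : ℝ} (hκ : 0 < κ₀)
    (hμ : 0 < μ₀) {e : Tensor2 d} (he : IsDeviatoric e) :
    ∃ r > 0, ∃ C, ∀ m T, contrast g κ₀ μ₀ m ≤ r → IsEffectiveTensor g m T →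
      ∫ x, (m.μ (g.phase x) - μ₀) ∂(cellMeasure g.basis) = 0 →
      |inner2 e (contract T e) - 2 * μ₀ * inner2 e e +
        4 * (inner ℂ (phaseL2 g (fun φ => m.μ φ - μ₀))
          (response g.basis κ₀ μ₀ e (phaseL2 g (fun φ => m.μ φ - μ₀)))).re| ≤
        C * ‖phaseL2 g (fun φ => m.μ φ - μ₀)‖ * contrast g κ₀ μ₀ m ^ 2 := by
  obtain ⟨r, hr, C, hC, H⟩ := exists_expansion hd g hκ hμ e
  refine ⟨r, hr, 2 * ((∑ i, ∑ j, |e i j|) * C), fun m T hm hT h0 => ?_⟩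
  obtain ⟨⟨ε, hε⟩, H'⟩ := H m hm
  obtain ⟨hE, -, h2⟩ := H' ε hε
  obtain ⟨_, hLS⟩ := hε.lippmannSchwinger hd hκ hμ
  set F := phaseL2 g (fun φ => m.μ φ - μ₀) with hF
  set E := tensorToLp hE
  set X : CellL2 g.basis := ∑ i, ∑ j, (e i j : ℂ) • E i j with hX
  set Err : CellL2 g.basis := ∑ i, ∑ j, (e i j : ℂ) • (E - constL2 g.basis e +
    green g.basis κ₀ μ₀ (contrastOp g κ₀ μ₀ m (constL2 g.basis e))) i j with hErr
  have hconst : ∑ i, ∑ j, (e i j : ℂ) • constL2 g.basis e i j =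
      ((inner2 e e : ℝ) : ℂ) • oneL2 g.basis := by
    simp_rw [constL2, smul_smul, ← Finset.sum_smul, inner2]
    push_cast
    rfl
  have hXeq : X = ((inner2 e e : ℝ) : ℂ) • oneL2 g.basis -
      (2 : ℂ) • response g.basis κ₀ μ₀ e F + Err := by
    rw [← hconst, ← firstOrder_deviatoric he g κ₀ μ₀ m, firstOrder, hErr, hX]
    simp only [Pi.add_apply, Pi.sub_apply, smul_add, smul_sub, Finset.sum_add_distrib,
      Finset.sum_sub_distrib]
    abel
  -- The mean of the strain is `e`, since the Green operator has no zero-frequency output in the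
  -- Lippmann-Schwinger equation.
  have hX0 : coeff g.basis X 0 = (inner2 e e : ℝ) := by
    have hX' : X = ((inner2 e e : ℝ) : ℂ) • oneL2 g.basis - ∑ i, ∑ j, (e i j : ℂ) •
        green g.basis κ₀ μ₀ (contrastOp g κ₀ μ₀ m E) i j := by
      rw [← hconst, hX]
      conv_lhs => rw [hLS]
      simp only [Pi.sub_apply, smul_sub, Finset.sum_sub_distrib]
    rw [hX', coeff_sub, coeff_smul, coeff_oneL2, if_pos rfl, coeff_sum]
    simp_rw [coeff_sum, coeff_smul, coeff_green_zero]
    simp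
  have hstress : ∀ i j, coeff g.basis (stiff g m.κ m.μ E i j) 0 = (contract T e i j : ℝ) := by
    intro i j
    rw [← hT.mean_stress e he.isSymm ε hε i j, setAverage_cell, coeff_zero_eq_integral,
      ← integral_complex_ofReal]
    exact integral_congr_ae (coeFn_stiff_tensorToLp g m hE i j)
  have hwork : ((inner2 e (contract T e) : ℝ) : ℂ) =
      2 * (μ₀ * (inner2 e e : ℝ) + inner ℂ F X) := by
    have h3 : coeff g.basis (∑ i, ∑ j, (e i j : ℂ) • stiff g m.κ m.μ E i j) 0 =
        (inner2 e (contract T e) : ℝ) := by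
      rw [coeff_sum]
      simp_rw [coeff_sum, coeff_smul, hstress, inner2]
      push_cast
      rfl
    rw [← h3, sum_smul_stiff he, map_smul, coeff_smul, ← hX]
    have h4 : m.μ = (fun _ => μ₀) + fun φ => m.μ φ - μ₀ := by funext φ; simp
    rw [h4, phaseMul_add_left, coeff_add, phaseMul_const, coeff_smul, hX0, coeff_phaseMul_zero]
  have hF1 : inner ℂ F (oneL2 g.basis) = 0 := by
    rw [← inner_conj_symm, ← coeff_zero_eq_inner, hF, coeff_phaseL2_zero, h0]
    simp
  have hval : inner2 e (contract T e) - 2 * μ₀ * inner2 e e +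
      4 * (inner ℂ F (response g.basis κ₀ μ₀ e F)).re = 2 * (inner ℂ F Err).re := by
    have h5 := congrArg Complex.re hwork
    rw [hXeq, inner_add_right, inner_sub_right, inner_smul_right, inner_smul_right, hF1] at h5
    simp at h5
    linarith
  rw [hval, abs_mul, abs_two]
  have hErr_le : ‖Err‖ ≤ (∑ i, ∑ j, |e i j|) * (C * contrast g κ₀ μ₀ m ^ 2) := by
    simp_rw [Finset.sum_mul]
    refine (norm_sum_le _ _).trans (Finset.sum_le_sum fun i _ =>
      (norm_sum_le _ _).trans (Finset.sum_le_sum fun j _ => ?_))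
    rw [norm_smul, Complex.norm_real, Real.norm_eq_abs]
    gcongr
    exact ((norm_le_pi_norm ((E - constL2 g.basis e + green g.basis κ₀ μ₀
      (contrastOp g κ₀ μ₀ m (constL2 g.basis e))) i) j).trans
        (norm_le_pi_norm (E - constL2 g.basis e + green g.basis κ₀ μ₀
      (contrastOp g κ₀ μ₀ m (constL2 g.basis e))) i)).trans h2
  have h6 := ((Complex.abs_re_le_norm _).trans (norm_inner_le_norm F Err)).trans
    (mul_le_mul_of_nonneg_left hErr_le (norm_nonneg F))
  calc 2 * |(inner ℂ F Err).re| ≤ 2 * (‖F‖ * ((∑ i, ∑ j, |e i j|) *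
      (C * contrast g κ₀ μ₀ m ^ 2))) := by gcongr
    _ = _ := by ring

/-! ### Consequences of macroscopic isotropy -/

/-- Phase moduli with constant bulk modulus, and shear modulus perturbed in the direction `s`. -/
def shearPerturbation (κ₀ μ₀ : ℝ) (s : Fin N → ℝ) (t : ℝ) : PhaseModuli N where
  κ := fun _ => κ₀
  μ := fun φ => μ₀ + t * s φ

theorem contrast_shearPerturbation_le (g : Geometry d N) (κ₀ μ₀ : ℝ) (s : Fin N → ℝ) (t : ℝ) :
    contrast g κ₀ μ₀ (shearPerturbation κ₀ μ₀ s t) ≤ 2 * (∑ φ, |s φ|) * |t| := by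
  refine contrast_le g κ₀ μ₀ _ fun φ => ?_
  have h : |s φ| ≤ ∑ φ, |s φ| :=
    Finset.single_le_sum (f := fun φ => |s φ|) (fun _ _ => abs_nonneg _) (Finset.mem_univ φ)
  simp only [shearPerturbation, sub_self, mul_zero, abs_zero, add_sub_cancel_left]
  rw [abs_mul, abs_mul, abs_two]
  refine max_le (by positivity) ?_
  calc 2 * (|t| * |s φ|) ≤ 2 * (|t| * ∑ φ, |s φ|) := by gcongr
    _ = _ := by ring

/-- These one-parameter families stay admissible for small `t`, so the isotropy hypothesis can be
applied along them and orders in `t` compared. -/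
theorem tendsto_shearPerturbation (g : Geometry d N) {κ₀ μ₀ : ℝ} (hκ : 0 < κ₀) (hμ : 0 < μ₀)
    {s : Fin N → ℝ} (hs : ∫ x, s (g.phase x) ∂(cellMeasure g.basis) = 0) :
    Tendsto (shearPerturbation κ₀ μ₀ s) (𝓝 0) (weakContrast g κ₀ μ₀) := by
  refine tendsto_inf.2 ⟨tendsto_comap_iff.2 ?_, tendsto_principal.2 ?_⟩
  · refine squeeze_zero (fun t => contrast_nonneg g κ₀ μ₀ _)
      (fun t => contrast_shearPerturbation_le g κ₀ μ₀ s t) ?_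
    have : Continuous fun t : ℝ => 2 * (∑ φ, |s φ|) * |t| := by fun_prop
    simpa using this.tendsto 0
  · have hpos : ∀ᶠ t : ℝ in 𝓝 0, ∀ φ, 0 < μ₀ + t * s φ := by
      refine eventually_all.2 fun φ => ?_
      have : Continuous fun t : ℝ => μ₀ + t * s φ := by fun_prop
      exact (this.tendsto 0).eventually_const_lt (by simpa using hμ)
    filter_upwards [hpos] with t ht
    refine ⟨fun _ => hκ, ht, ?_, ?_⟩
    · rw [setAverage_cell]
      simp [Geometry.bulk, shearPerturbation]
    · rw [setAverage_cell]
      simp only [Geometry.shear, shearPerturbation]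
      rw [integral_add (integrable_const _) ((integrable_phaseFun g s).const_mul t),
        integral_const_mul, hs]
      simp

theorem phaseL2_shearPerturbation (g : Geometry d N) (κ₀ μ₀ : ℝ) (s : Fin N → ℝ) (t : ℝ) :
    phaseL2 g (fun φ => (shearPerturbation κ₀ μ₀ s t).μ φ - μ₀) = (t : ℂ) • phaseL2 g s := by
  rw [phaseL2, phaseL2, ← phaseMul_smul_left]
  congr 2
  funext φ
  simp [shearPerturbation]

/-- Under macroscopic isotropy, the mean response to deviatoric polarizations does not depend on
their direction. -/
theorem inner_response_proportional (hd : 2 ≤ d) (g : Geometry d N) {κ₀ μ₀ : ℝ} (hκ : 0 < κ₀)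
    (hμ : 0 < μ₀) (hiso : ∀ᶠ m in weakContrast g κ₀ μ₀, MacroIsotropic g m) {s : Fin N → ℝ}
    (hs : ∫ x, s (g.phase x) ∂(cellMeasure g.basis) = 0) {e e' : Tensor2 d}
    (he : IsDeviatoric e) (he' : IsDeviatoric e') :
    inner2 e' e' * (inner ℂ (phaseL2 g s) (response g.basis κ₀ μ₀ e (phaseL2 g s))).re =
      inner2 e e * (inner ℂ (phaseL2 g s) (response g.basis κ₀ μ₀ e' (phaseL2 g s))).re := by
  obtain ⟨r, hr, C, H⟩ := exists_effective_expansion hd g hκ hμ he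
  obtain ⟨r', hr', C', H'⟩ := exists_effective_expansion hd g hκ hμ he'
  set F := phaseL2 g s
  set A := (inner ℂ F (response g.basis κ₀ μ₀ e F)).re
  set A' := (inner ℂ F (response g.basis κ₀ μ₀ e' F)).re
  set B := 2 * ∑ φ, |s φ|
  have hB : 0 ≤ B := by positivity
  have hquad : ∀ (t : ℝ) {a : Tensor2 d}, IsDeviatoric a →
      (inner ℂ ((t : ℂ) • F) (response g.basis κ₀ μ₀ a ((t : ℂ) • F))).re =
        t ^ 2 * (inner ℂ F (response g.basis κ₀ μ₀ a F)).re := fun t a ha => by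
    rw [response_smul g.basis κ₀ μ₀ ha.symm, inner_smul_left, inner_smul_right,
      Complex.conj_ofReal, ← mul_assoc, ← Complex.ofReal_mul, Complex.re_ofReal_mul, sq]
  set K := inner2 e' e' * (|C| * ‖F‖ * B ^ 2) + inner2 e e * (|C'| * ‖F‖ * B ^ 2)
  -- Both expansions involve the same isotropic constant `c`. Cross-multiplying by the norms of `e`
  -- and `e'` cancels it and the `μ₀` terms, leaving `t²` times the difference against an error of
  -- order `|t|³`. Dividing by `t²` requires `t ≠ 0`.
  have hbound : ∀ᶠ t : ℝ in 𝓝[≠] 0,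
      4 * |inner2 e' e' * A - inner2 e e * A'| ≤ K * |t| := by
    have htend := (tendsto_shearPerturbation g hκ hμ hs).mono_left
      (nhdsWithin_le_nhds (s := {0}ᶜ))
    filter_upwards [htend.eventually hiso, htend.eventually (eventually_contrast_le g κ₀ μ₀ hr),
      htend.eventually (eventually_contrast_le g κ₀ μ₀ hr'),
      htend.eventually (eventually_isAdmissible g κ₀ μ₀), self_mem_nhdsWithin]
      with t ⟨T, hT, hTiso⟩ h1 h1' hadm ht
    obtain ⟨c, hc⟩ := hTiso.exists_quadratic_eq hd
    have h2 := H _ T h1 hT (integral_shear_sub g hadm)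
    have h2' := H' _ T h1' hT (integral_shear_sub g hadm)
    have hle : contrast g κ₀ μ₀ (shearPerturbation κ₀ μ₀ s t) ^ 2 ≤ (B * |t|) ^ 2 :=
      pow_le_pow_left₀ (contrast_nonneg _ _ _ _) (contrast_shearPerturbation_le g κ₀ μ₀ s t) 2
    rw [hc e he.isSymm he.trace, phaseL2_shearPerturbation, hquad t he, norm_smul,
      Complex.norm_real, Real.norm_eq_abs] at h2
    rw [hc e' he'.isSymm he'.trace, phaseL2_shearPerturbation, hquad t he', norm_smul,
      Complex.norm_real, Real.norm_eq_abs] at h2'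
    have hCle : ∀ D : ℝ, D * (|t| * ‖F‖) * contrast g κ₀ μ₀ (shearPerturbation κ₀ μ₀ s t) ^ 2 ≤
        |D| * (|t| * ‖F‖) * (B * |t|) ^ 2 := fun D => by
      gcongr
      exact le_abs_self D
    have h3 := h2.trans (hCle C)
    have h3' := h2'.trans (hCle C')
    have ht0 : 0 < |t| := abs_pos.2 ht
    refine le_of_mul_le_mul_left ?_ (pow_pos ht0 2)
    have hid : |t| ^ 2 * (4 * |inner2 e' e' * A - inner2 e e * A'|) =
        |inner2 e' e' * (c * inner2 e e - 2 * μ₀ * inner2 e e + 4 * (t ^ 2 * A)) -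
          inner2 e e * (c * inner2 e' e' - 2 * μ₀ * inner2 e' e' + 4 * (t ^ 2 * A'))| := by
      rw [show inner2 e' e' * (c * inner2 e e - 2 * μ₀ * inner2 e e + 4 * (t ^ 2 * A)) -
          inner2 e e * (c * inner2 e' e' - 2 * μ₀ * inner2 e' e' + 4 * (t ^ 2 * A')) =
          t ^ 2 * (4 * (inner2 e' e' * A - inner2 e e * A')) by ring, abs_mul, abs_mul, abs_pow]
      norm_num
    rw [hid]
    refine (abs_sub _ _).trans ?_
    rw [abs_mul, abs_mul, abs_of_nonneg (inner2_self_nonneg e),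
      abs_of_nonneg (inner2_self_nonneg e')]
    refine (add_le_add (mul_le_mul_of_nonneg_left h3 (inner2_self_nonneg e'))
      (mul_le_mul_of_nonneg_left h3' (inner2_self_nonneg e))).trans (le_of_eq ?_)
    simp only [K]
    ring
  have hlim : Tendsto (fun t : ℝ => K * |t|) (𝓝[≠] 0) (𝓝 0) := by
    have : Continuous fun t : ℝ => K * |t| := by fun_prop
    simpa using (this.tendsto 0).mono_left (nhdsWithin_le_nhds (s := {0}ᶜ))
  have h0 := ge_of_tendsto hlim hbound
  have h1 : |inner2 e' e' * A - inner2 e e * A'| = 0 :=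
    le_antisymm (by linarith) (abs_nonneg _)
  linarith [abs_eq_zero.1 h1]

/-- Proportionality compares `e` with each column of `K`. Summing over the columns gives `n_K` on
one side and the constant symbol `λ_K` on the other. -/
theorem inner_response_self (hd : 2 ≤ d) (g : Geometry d N) {κ₀ μ₀ : ℝ} (hκ : 0 < κ₀)
    (hμ : 0 < μ₀) (hiso : ∀ᶠ m in weakContrast g κ₀ μ₀, MacroIsotropic g m) {s : Fin N → ℝ}
    (hs : ∫ x, s (g.phase x) ∂(cellMeasure g.basis) = 0) {e : Tensor2 d} (he : IsDeviatoric e) :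
    nK d * (inner ℂ (phaseL2 g s) (response g.basis κ₀ μ₀ e (phaseL2 g s))).re =
      inner2 e e * (lamKInv d κ₀ μ₀)⁻¹ * (inner ℂ (phaseL2 g s) (phaseL2 g s)).re := by
  set F := phaseL2 g s with hF
  have hF0 : coeff g.basis F 0 = 0 := by rw [hF, coeff_phaseL2_zero, hs, Complex.ofReal_zero]
  have h1 : ∑ k, ∑ l, (inner ℂ F (response g.basis κ₀ μ₀ (deviatoricColumn d k l) F)).re =
      (lamKInv d κ₀ μ₀)⁻¹ * (inner ℂ F F).re := by
    have h2 := congrArg (fun X => (inner ℂ F X).re)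
      (sum_response_deviatoricColumn hd g.basis hκ hμ F hF0)
    simp only [inner_sum, Complex.re_sum, inner_smul_right, Complex.re_ofReal_mul] at h2
    exact h2
  rw [mul_assoc, ← h1, ← sum_inner2_deviatoricColumn, Finset.sum_mul, Finset.mul_sum]
  refine Finset.sum_congr rfl fun k _ => ?_
  rw [Finset.sum_mul, Finset.mul_sum]
  exact Finset.sum_congr rfl fun l _ => inner_response_proportional hd g hκ hμ hiso hs he
    (isDeviatoric_deviatoricColumn k l)

theorem phaseL2_add (g : Geometry d N) (s r : Fin N → ℝ) :
    phaseL2 g (s + r) = phaseL2 g s + phaseL2 g r := phaseMul_add_left g s r _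

theorem phaseL2_const (g : Geometry d N) (c : ℝ) :
    phaseL2 g (fun _ => c) = (c : ℂ) • oneL2 g.basis := phaseMul_const g c _

/-- Polarization: the quadratic identity is applied to `r`, `s` and `r + s`, and the cross terms
agree by self-adjointness. -/
theorem inner_response_of_mean_zero (hd : 2 ≤ d) (g : Geometry d N) {κ₀ μ₀ : ℝ} (hκ : 0 < κ₀)
    (hμ : 0 < μ₀) (hiso : ∀ᶠ m in weakContrast g κ₀ μ₀, MacroIsotropic g m) {r s : Fin N → ℝ}
    (hr : ∫ x, r (g.phase x) ∂(cellMeasure g.basis) = 0)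
    (hs : ∫ x, s (g.phase x) ∂(cellMeasure g.basis) = 0) {e : Tensor2 d} (he : IsDeviatoric e) :
    nK d * (inner ℂ (phaseL2 g r) (response g.basis κ₀ μ₀ e (phaseL2 g s))).re =
      inner2 e e * (lamKInv d κ₀ μ₀)⁻¹ * (inner ℂ (phaseL2 g r) (phaseL2 g s)).re := by
  have hrs : ∫ x, (r + s) (g.phase x) ∂(cellMeasure g.basis) = 0 := by
    simp only [Pi.add_apply]
    rw [integral_add (integrable_phaseFun g r) (integrable_phaseFun g s), hr, hs, add_zero]
  have h1 := inner_response_self hd g hκ hμ hiso hr he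
  have h2 := inner_response_self hd g hκ hμ hiso hs he
  have h3 := inner_response_self hd g hκ hμ hiso hrs he
  have h4 := inner_response_re_comm g.basis κ₀ μ₀ he.symm (phaseL2 g r) (phaseL2 g s)
  have h5 : (inner ℂ (phaseL2 g s) (phaseL2 g r)).re =
      (inner ℂ (phaseL2 g r) (phaseL2 g s)).re := by
    rw [← inner_conj_symm, Complex.conj_re]
  rw [phaseL2_add, response_add g.basis κ₀ μ₀ he.symm] at h3
  simp only [inner_add_left, inner_add_right, Complex.add_re] at h3
  rw [h5, ← h4] at h3
  linear_combination (h3 - h1 - h2) / 2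

/-- The phase weight is not of mean zero, but subtracting its mean changes neither pairing, since
the response and the field `s` both have mean zero. -/
theorem inner_weightL2_response (hd : 2 ≤ d) (g : Geometry d N) {κ₀ μ₀ : ℝ} (hκ : 0 < κ₀)
    (hμ : 0 < μ₀) (hiso : ∀ᶠ m in weakContrast g κ₀ μ₀, MacroIsotropic g m) {s : Fin N → ℝ}
    (hs : ∫ x, s (g.phase x) ∂(cellMeasure g.basis) = 0) {e : Tensor2 d} (he : IsDeviatoric e)
    (φ : Fin N) :
    nK d * (inner ℂ (weightL2 g φ) (response g.basis κ₀ μ₀ e (phaseL2 g s))).re =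
      inner2 e e * (lamKInv d κ₀ μ₀)⁻¹ * s φ := by
  set c := ∫ x, phaseWeight g φ (g.phase x) ∂(cellMeasure g.basis) with hc
  set r : Fin N → ℝ := fun ψ => phaseWeight g φ ψ - c with hr
  have hr0 : ∫ x, r (g.phase x) ∂(cellMeasure g.basis) = 0 := by
    simp only [hr]
    rw [integral_sub (integrable_phaseFun g _) (integrable_const _), ← hc]
    simp
  have hw : weightL2 g φ = phaseL2 g r + (c : ℂ) • oneL2 g.basis := by
    rw [weightL2, ← phaseL2_const, ← phaseL2_add]
    congr 1
    funext ψ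
    simp [hr]
  have hS0 : coeff g.basis (phaseL2 g s) 0 = 0 := by
    rw [coeff_phaseL2_zero, hs, Complex.ofReal_zero]
  have h1 : inner ℂ (weightL2 g φ) (response g.basis κ₀ μ₀ e (phaseL2 g s)) =
      inner ℂ (phaseL2 g r) (response g.basis κ₀ μ₀ e (phaseL2 g s)) := by
    rw [hw, inner_add_left, inner_smul_left, ← coeff_zero_eq_inner,
      coeff_response g.basis κ₀ μ₀ he.symm, hS0]
    simp
  have h2 : inner ℂ (weightL2 g φ) (phaseL2 g s) = inner ℂ (phaseL2 g r) (phaseL2 g s) := by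
    rw [hw, inner_add_left, inner_smul_left, ← coeff_zero_eq_inner, hS0]
    simp
  rw [h1, inner_response_of_mean_zero hd g hκ hμ hiso hr0 hs he, ← h2, inner_weightL2_phaseL2,
    Complex.ofReal_re]

/-! ### Deviatoric loading -/

theorem lamKInv_ne_zero (hd : 2 ≤ d) {κ₀ μ₀ : ℝ} (hκ : 0 < κ₀) (hμ : 0 < μ₀) :
    lamKInv d κ₀ μ₀ ≠ 0 := by
  have h2 : (2 : ℝ) ≤ d := by exact_mod_cast hd
  have h1 : (0 : ℝ) < d - 1 := by linarith
  have h3 : (0 : ℝ) < d := by linarith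
  rw [lamKInv]
  positivity

/-- Here `ē` is traceless, so `ε₀` sees only the fluctuation. The linear term of `ε_eq²` is the
pairing with `ē`, whose phase average is known through isotropy. -/
theorem deviatoric_estimate (hd : 2 ≤ d) (g : Geometry d N) {κ₀ μ₀ : ℝ} (hκ : 0 < κ₀)
    (hμ : 0 < μ₀) (hiso : ∀ᶠ m in weakContrast g κ₀ μ₀, MacroIsotropic g m) {ebar : Tensor2 d}
    (hebar : ebar ≠ 0) {ε : PhaseModuli N → Space d → Tensor2 d}
    (hε : ∀ m, IsAdmissible g κ₀ μ₀ m → IsStrainField g m ebar (ε m)) (φ : Fin N)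
    (hdev : IsDeviatoric ebar) :
    (fun m => ⨍ x in g.phaseCell φ, hydro (ε m x) ^ 2)
        =o[weakContrast g κ₀ μ₀] contrast g κ₀ μ₀ ∧
    (fun m => m.μ φ - (μ₀ + nK d * lamKInv d κ₀ μ₀ / 4 *
          (1 - (⨍ x in g.phaseCell φ, equivStrain (ε m x) ^ 2) / equivStrain ebar ^ 2)))
        =o[weakContrast g κ₀ μ₀] contrast g κ₀ μ₀ := by
  have h2 : (2 : ℝ) ≤ d := by exact_mod_cast hd
  have hd0 : (d : ℝ) ≠ 0 := by positivity
  have hd1 : (d : ℝ) - 1 ≠ 0 := by linarith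
  obtain ⟨C, hC⟩ := exists_phase_expansion hd g hκ hμ ebar ebar φ
  set E := inner2 ebar ebar with hE
  have hE0 : E ≠ 0 := by
    intro h
    rw [hE, inner2_self_eq] at h
    apply hebar
    ext i j
    have h1 := (Finset.sum_eq_zero_iff_of_nonneg
      fun i _ => Finset.sum_nonneg fun j _ => sq_nonneg (ebar i j)).1 h i (Finset.mem_univ i)
    have h2 := (Finset.sum_eq_zero_iff_of_nonneg fun j _ => sq_nonneg (ebar i j)).1 h1 j
      (Finset.mem_univ j)
    simpa using h2
  constructor
  · refine isLittleO_contrast g κ₀ μ₀ (C := C) ?_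
    filter_upwards [hC, eventually_isAdmissible g κ₀ μ₀] with m h hm
    obtain ⟨-, -, h3⟩ := h (ε m) (hε m hm)
    have h4 : ∀ x, hydro (ε m x) ^ 2 = hydro (ε m x - ebar) ^ 2 := fun x => by
      rw [hydro, hydro, Matrix.trace_sub, hdev.trace, sub_zero]
    simp_rw [h4]
    exact h3 (fun A => hydro A ^ 2) (fun A => sq_nonneg _) (hydro_sq_le hd)
  · set p := ((d : ℝ) - 1) / d with hp
    have hp0 : p ≠ 0 := div_ne_zero hd1 hd0
    set c := nK d * lamKInv d κ₀ μ₀ / 4 with hc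
    refine isLittleO_contrast g κ₀ μ₀ (C := |c / (p * E)| * (2 * |p| * C + C)) ?_
    filter_upwards [hC, eventually_isAdmissible g κ₀ μ₀] with m h hm
    obtain ⟨hη, h3, h4⟩ := h (ε m) (hε m hm)
    have h4' := h4 (fun A => equivStrain A ^ 2) (fun A => sq_nonneg _) (equivStrain_sq_le hd)
    have hresp := inner_weightL2_response hd g hκ hμ hiso (s := fun φ => m.μ φ - μ₀)
      (integral_shear_sub g hm) hdev φ
    rw [firstOrder_deviatoric hdev, inner_smul_right] at h3
    set R := (inner ℂ (weightL2 g φ) (response g.basis κ₀ μ₀ ebar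
      (phaseL2 g fun φ => m.μ φ - μ₀))).re with hR
    have h3' : ((2 : ℂ) * inner ℂ (weightL2 g φ) (response g.basis κ₀ μ₀ ebar
      (phaseL2 g fun φ => m.μ φ - μ₀))).re = 2 * R := by
      rw [hR, ← Complex.re_ofReal_mul]; norm_num
    rw [h3'] at h3
    have hbar : equivStrain ebar ^ 2 = p * E := by
      rw [equivStrain_sq hd, hdev.trace]; ring
    have hsq : ∀ x, equivStrain (ε m x) ^ 2 =
        p * E + 2 * p * inner2 ebar (ε m x - ebar) + equivStrain (ε m x - ebar) ^ 2 := by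
      intro x
      have hx : ε m x = ebar + (ε m x - ebar) := by abel
      rw [equivStrain_sq hd, equivStrain_sq hd, Matrix.trace_sub, hdev.trace]
      nth_rewrite 1 2 [hx]
      rw [inner2_add_self]
      ring
    have hlin : Integrable (fun x => inner2 ebar (ε m x - ebar)) (cellMeasure g.basis) :=
      (memLp_re_of_ofReal g.basis (memLp_inner2 g.basis ebar hη)).integrable (by norm_num)
    have hquad : Integrable (fun x => equivStrain (ε m x - ebar) ^ 2) (cellMeasure g.basis) := by
      simp_rw [equivStrain_sq hd]
      exact ((integrable_inner2_self g.basis hη).sub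
        ((integrable_trace_sq g.basis hη).div_const _)).const_mul _
    simp_rw [hsq]
    rw [setAverage_phaseCell_quadratic g φ _ _ hlin hquad, hbar]
    set I₁ := ⨍ x in g.phaseCell φ, inner2 ebar (ε m x - ebar)
    set I₂ := ⨍ x in g.phaseCell φ, equivStrain (ε m x - ebar) ^ 2
    have hK := lamKInv_ne_zero hd hκ hμ
    -- The identity from isotropy, rescaled: `4 c` is `n_K` times the inverse of `λ_K`, which is why
    -- the coefficient in the statement is divided by `4`.
    have hkey : c * (4 * R) = E * (m.μ φ - μ₀) := by
      have := congrArg (fun y => lamKInv d κ₀ μ₀ * y) hresp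
      rw [hc]
      field_simp at this ⊢
      linarith
    have hid : m.μ φ - (μ₀ + c * (1 - (p * E + 2 * p * I₁ + I₂) / (p * E))) =
        c / (p * E) * (2 * p * (I₁ + 2 * R) + I₂) := by
      have : m.μ φ - μ₀ = c * (4 * R) / E := by rw [hkey]; field_simp
      rw [← sub_sub, this]
      field_simp
      ring
    rw [hid, abs_mul, mul_assoc |_|]
    refine mul_le_mul_of_nonneg_left ?_ (abs_nonneg (c / (p * E)))
    refine (abs_add_le (2 * p * (I₁ + 2 * R)) I₂).trans ?_
    rw [abs_mul, abs_mul, abs_two, add_mul, mul_assoc _ C]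
    have h5 : 2 * |p| * |I₁ + 2 * R| ≤ 2 * |p| * (C * contrast g κ₀ μ₀ m ^ 2) := by gcongr
    exact add_le_add h5 h4'

end Elast

end

/-! ### The two loading cases together. -/

theorem proposition3 {d N : ℕ} (hd : d = 2 ∨ d = 3) (g : Elast.Geometry d N)
    (κ₀ μ₀ : ℝ) (hκ₀ : 0 < κ₀) (hμ₀ : 0 < μ₀)
    (hiso : ∀ᶠ m in Elast.weakContrast g κ₀ μ₀, Elast.MacroIsotropic g m)
    (ebar : Elast.Tensor2 d) (hebar : ebar ≠ 0)
    (ε : Elast.PhaseModuli N → Elast.Space d → Elast.Tensor2 d)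
    (hε : ∀ m, Elast.IsAdmissible g κ₀ μ₀ m → Elast.IsStrainField g m ebar (ε m))
    (φ : Fin N) :
    (Elast.IsSpherical ebar →
      (fun m => ⨍ x in g.phaseCell φ, Elast.equivStrain (ε m x) ^ 2)
          =o[Elast.weakContrast g κ₀ μ₀] Elast.contrast g κ₀ μ₀ ∧
      (fun m => m.κ φ - (κ₀ + Elast.nJ d * Elast.lamJInv d κ₀ μ₀ / (2 * d) *
            (1 - (⨍ x in g.phaseCell φ, Elast.hydro (ε m x) ^ 2) / Elast.hydro ebar ^ 2)))
          =o[Elast.weakContrast g κ₀ μ₀] Elast.contrast g κ₀ μ₀) ∧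
    (Elast.IsDeviatoric ebar →
      (fun m => ⨍ x in g.phaseCell φ, Elast.hydro (ε m x) ^ 2)
          =o[Elast.weakContrast g κ₀ μ₀] Elast.contrast g κ₀ μ₀ ∧
      (fun m => m.μ φ - (μ₀ + Elast.nK d * Elast.lamKInv d κ₀ μ₀ / 4 *
            (1 - (⨍ x in g.phaseCell φ, Elast.equivStrain (ε m x) ^ 2) /
              Elast.equivStrain ebar ^ 2)))
          =o[Elast.weakContrast g κ₀ μ₀] Elast.contrast g κ₀ μ₀) := by
  have hd2 : 2 ≤ d := by omega
  exact ⟨Elast.spherical_estimate hd2 g hκ₀ hμ₀ hebar hε φ,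
    Elast.deviatoric_estimate hd2 g hκ₀ hμ₀ hiso hebar hε φ⟩
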